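/- Let $K$ be a knot with unknotting number $u(K)=1$ that can be unknotted by switching a positive crossing to a negative one; that is, $K$ has a diagram $D$ with a positive crossing $c$ such that changing $c$ turns $D$ into a diagram of the unknot. Let $V_K\in\mathbb Z[t,t^{-1}]$ be the Jones polynomial of $K$, normalized by $V=1$ on the unknot and $t^{-1}V_{L_+}-t\,V_{L_-}=-(t^{-1/2}-t^{1/2})\,V_{L_0}$ for every skein triple. Then $V_K-1$ is divisible by $t-1$ in $\mathbb Z[t,t^{-1}]$, and with $$\tilde V \;=\; 1-\frac{V_K-1}{t-1}\in\mathbb Z[t,t^{-1}]$$ there exists a knot $K'$ whose Jones polynomial is $$V_{K'}\;=\;t^{-\tilde V'(1)}\,\tilde V .$$ Moreover, $K'$ can be taken to be the knot presented by the diagram obtained from $D$ by smoothing $c$ in the way that does not respect the orientation. -/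

import Mathlib

open scoped LaurentPolynomial
open LaurentPolynomial (T)

namespace KnotDiag

/-- The number of classes that the equivalence relation generated by the pairs in `E` has on the
finite set `V` (the number of connected components of the graph with vertices `V`, edges `E`). -/
noncomputable def classCount {α : Type} (V : Finset α) (E : Multiset (α × α)) : ℕ :=
  (Quotient.mk (Relation.EqvGen.setoid fun x y => (x, y) ∈ E) '' (V : Set α)).ncard

/-- A crossing of an oriented diagram whose arcs are labelled by natural numbers: its sign, and the
labels of the arcs on which the under-strand comes in and goes out and on which the over-strand
comes in and goes out. Counterclockwise around the crossing one meets
`uin, oout, uout, oin` if the crossing is positive and `uin, oin, uout, oout` if it is negative. -/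
@[ext]
structure Crossing where
  sign : ℤˣ
  uin : ℕ
  uout : ℕ
  oin : ℕ
  oout : ℕ

namespace Crossing

/-- Apply `f` to the labels of the arcs. -/
def relabel (f : ℕ → ℕ) (c : Crossing) : Crossing :=
  ⟨c.sign, f c.uin, f c.uout, f c.oin, f c.oout⟩

/-- The crossing change: over-strand and under-strand are exchanged, so the sign is changed. -/
def switch (c : Crossing) : Crossing := ⟨-c.sign, c.oin, c.oout, c.uin, c.uout⟩

/-- The crossing after reversal of the orientation of the under-strand. -/
def revUnder (c : Crossing) : Crossing := ⟨-c.sign, c.uout, c.uin, c.oin, c.oout⟩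

/-- The crossing after reversal of the orientation of the over-strand. -/
def revOver (c : Crossing) : Crossing := ⟨-c.sign, c.uin, c.uout, c.oout, c.oin⟩

/-- `c` and `d` are the same crossing up to the orientations of the two strands. -/
def SameUnoriented (c d : Crossing) : Prop :=
  d = c ∨ d = c.revUnder ∨ d = c.revOver ∨ d = c.revUnder.revOver

/-- The pairs of arcs that are joined by passing straight through the crossing. -/
def through (c : Crossing) : Multiset (ℕ × ℕ) := {(c.uin, c.uout), (c.oin, c.oout)}

/-- The pairs of arcs joined by the splitting of the crossing that respects the orientation. -/
def orientedSplit (c : Crossing) : Multiset (ℕ × ℕ) := {(c.uin, c.oout), (c.oin, c.uout)}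

/-- The pairs of arcs joined by the splitting that does not respect the orientation. -/
def disorientedSplit (c : Crossing) : Multiset (ℕ × ℕ) := {(c.uin, c.oin), (c.uout, c.oout)}

/-- The type `A` splitting. The `A`-corners are the two swept by the over-strand when it is rotated
counterclockwise towards the under-strand; at a positive crossing these are the corner between the
two outgoing and the one between the two incoming arcs, so that connecting them gives the oriented
splitting. At a negative crossing it is the other way round. -/
def splitA (c : Crossing) : Multiset (ℕ × ℕ) :=
  if c.sign = 1 then c.orientedSplit else c.disorientedSplit

/-- The type `B` splitting. -/
def splitB (c : Crossing) : Multiset (ℕ × ℕ) :=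
  if c.sign = 1 then c.disorientedSplit else c.orientedSplit

/-- The sides of arcs that meet in the four corners at the crossing; `(a, true)` and `(a, false)`
stand for the left and the right side of the arc `a`. -/
def corners (c : Crossing) : Multiset ((ℕ × Bool) × (ℕ × Bool)) :=
  if c.sign = 1 then
    {((c.uin, false), (c.oout, false)), ((c.oout, true), (c.uout, false)),
      ((c.uout, true), (c.oin, true)), ((c.oin, false), (c.uin, true))}
  else
    {((c.uin, false), (c.oin, true)), ((c.oin, false), (c.uout, false)),
      ((c.uout, true), (c.oout, false)), ((c.oout, true), (c.uin, true))}

end Crossing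

/-- An oriented diagram, given by its marked points and its crossings. A marked point `(a, b)` is a
point of the curve, no crossing, in which the arc `a` ends and the arc `b` begins. Which of these
data are knot diagrams is said by `Diagram.IsKnotDiagram`. -/
@[ext]
structure Diagram where
  points : Multiset (ℕ × ℕ)
  crossings : Multiset Crossing

namespace Diagram

/-- Apply `f` to the labels of the arcs. -/
def relabel (f : ℕ → ℕ) (D : Diagram) : Diagram :=
  ⟨D.points.map (Prod.map f f), D.crossings.map (Crossing.relabel f)⟩

/-- The arcs that end in a marked point or a crossing. -/
def ins (D : Diagram) : Multiset ℕ :=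
  D.points.map Prod.fst + D.crossings.map Crossing.uin + D.crossings.map Crossing.oin

/-- The arcs that begin in a marked point or a crossing. -/
def outs (D : Diagram) : Multiset ℕ :=
  D.points.map Prod.snd + D.crossings.map Crossing.uout + D.crossings.map Crossing.oout

/-- The set of arcs. -/
def arcs (D : Diagram) : Finset ℕ := D.ins.toFinset

/-- The number of closed curves obtained by passing straight through all crossings. -/
noncomputable def componentCount (D : Diagram) : ℕ :=
  classCount D.arcs (D.points + D.crossings.bind Crossing.through)

/-- The number of regions of the diagram, each region being a cyclic sequence of sides of arcs. -/
noncomputable def regionCount (D : Diagram) : ℕ :=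
  classCount (D.arcs ×ˢ (Finset.univ : Finset Bool))
    (D.points.bind (fun p => {((p.1, true), (p.2, true)), ((p.1, false), (p.2, false))}) +
      D.crossings.bind Crossing.corners)

/-- `D` is a knot diagram on the oriented sphere: every arc begins once and ends once, there is
exactly one component, and the surface obtained by gluing a disc into each region is a sphere. If
there are `n` crossings and `m` marked points, then there are `n + m` vertices and `2 * n + m` arcs,
so that the Euler characteristic is `2` if and only if there are `n + 2` regions. -/
def IsKnotDiagram (D : Diagram) : Prop :=
  D.ins.Nodup ∧ D.ins = D.outs ∧ D.componentCount = 1 ∧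
    D.regionCount = Multiset.card D.crossings + 2

/-- The writhe, the sum of the signs of the crossings. -/
def writhe (D : Diagram) : ℤ := (D.crossings.map fun c => (c.sign : ℤ)).sum

/-- The number of circles in the state with type `A` splittings at the crossings in `S` and type `B`
splittings at the crossings in `S'`. -/
noncomputable def loops (D : Diagram) (S S' : Multiset Crossing) : ℕ :=
  classCount D.arcs (D.points + S.bind Crossing.splitA + S'.bind Crossing.splitB)

/-- The Kauffman bracket in the variable `A = T 1`: the sum of
`A ^ (#A - #B) * (- A ^ 2 - A ^ (-2)) ^ (number of circles - 1)` over all states. -/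
noncomputable def bracket (D : Diagram) : ℤ[T;T⁻¹] :=
  (D.crossings.antidiagonal.map fun S =>
    T ((Multiset.card S.1 : ℤ) - Multiset.card S.2) *
      (-T 2 - T (-2)) ^ (D.loops S.1 S.2 - 1)).sum

/-- `V(t)` is the Jones polynomial of the diagram `D`: the substitution `t = A ^ (-4)` turns it into
`(- A ^ 3) ^ (- writhe) * bracket`. As the substitution is injective, there is at most one `V`. -/
def HasJones (D : Diagram) (V : ℤ[T;T⁻¹]) : Prop :=
  AddMonoidAlgebra.mapDomain (fun n : ℤ => -4 * n) V =
    ((D.writhe.negOnePow : ℤˣ) : ℤ) • (T (-3 * D.writhe) * D.bracket)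

/-- A strand runs along the arcs `x, m, y` through two crossings. The arcs on which it comes in and
goes out at the crossing which is the first of the two if `k = 1`, the second if `k = -1`. -/
def pass (k : ℤˣ) (x m y : ℕ) : ℕ × ℕ := if k = 1 then (x, m) else (m, y)

/-- Crossing with sign `s`, under-strand `u` and over-strand `o`, both as (incoming, outgoing). -/
def mkCrossing (s : ℤˣ) (u o : ℕ × ℕ) : Crossing := ⟨s, u.1, u.2, o.1, o.2⟩

/-- Three strands forming a triangle: a top strand along `t₁, t₂, t₃`, a middle strand along
`m₁, m₂, m₃`, and a bottom strand along `b₁, b₂, b₃`. Let `p` be the crossing of top and middle, `q`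
that of top and bottom, `r` that of middle and bottom. The top strand meets `p` before `q` iff
`α = 1`, the middle strand meets `p` before `r` iff `β = 1`, the bottom strand meets `q` before `r`
iff `γ = 1`, and the triangle `p q r` is oriented counterclockwise iff `ε = 1`. The sign of a
crossing is the sign of the determinant of (over direction, under direction); this is
`ε * α * β` at `p`, `ε * α * γ` at `q` and `ε * β * γ` at `r`. -/
def triangle (α β γ ε : ℤˣ) (t₁ t₂ t₃ m₁ m₂ m₃ b₁ b₂ b₃ : ℕ) : Multiset Crossing :=
  {mkCrossing (ε * α * β) (pass β m₁ m₂ m₃) (pass α t₁ t₂ t₃),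
    mkCrossing (ε * α * γ) (pass γ b₁ b₂ b₃) (pass (-α) t₁ t₂ t₃),
    mkCrossing (ε * β * γ) (pass (-γ) b₁ b₂ b₃) (pass (-β) m₁ m₂ m₃)}

/-- The Reidemeister moves, with all orientations and signs, together with the renaming of arcs and
the removal of a marked point. `P` and `C` are the marked points and the crossings outside of the
disc in which the move takes place. -/
inductive Move : Diagram → Diagram → Prop
  /-- Renaming of the arcs. -/
  | relabel (f : Equiv.Perm ℕ) (D : Diagram) : Move D (D.relabel f)
  /-- Removal of a marked point: the arcs `a` and `b` become one arc `a`. -/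
  | point (a b : ℕ) (h : a ≠ b) (P : Multiset (ℕ × ℕ)) (C : Multiset Crossing) :
      Move ⟨(a, b) ::ₘ P, C⟩ (relabel (Function.update id b a) ⟨P, C⟩)
  /-- First move, for a kink that is passed first below and then above. -/
  | r1_under_over (s : ℤˣ) (a b c : ℕ) (P : Multiset (ℕ × ℕ)) (C : Multiset Crossing) :
      Move ⟨P, mkCrossing s (a, b) (b, c) ::ₘ C⟩ ⟨(a, c) ::ₘ P, C⟩
  /-- First move, for a kink that is passed first above and then below. -/
  | r1_over_under (s : ℤˣ) (a b c : ℕ) (P : Multiset (ℕ × ℕ)) (C : Multiset Crossing) :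
      Move ⟨P, mkCrossing s (b, c) (a, b) ::ₘ C⟩ ⟨(a, c) ::ₘ P, C⟩
  /-- Second move, for two strands in the same direction. -/
  | r2_parallel (s : ℤˣ) (a b c x y z : ℕ) (P : Multiset (ℕ × ℕ)) (C : Multiset Crossing) :
      Move ⟨P, mkCrossing s (a, b) (x, y) ::ₘ mkCrossing (-s) (b, c) (y, z) ::ₘ C⟩
        ⟨(a, c) ::ₘ (x, z) ::ₘ P, C⟩
  /-- Second move, for two strands in opposite directions. -/
  | r2_antiparallel (s : ℤˣ) (a b c x y z : ℕ) (P : Multiset (ℕ × ℕ)) (C : Multiset Crossing) :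
      Move ⟨P, mkCrossing s (a, b) (y, z) ::ₘ mkCrossing (-s) (b, c) (x, y) ::ₘ C⟩
        ⟨(a, c) ::ₘ (x, z) ::ₘ P, C⟩
  /-- Third move: each of the three strands meets its two crossings in the opposite order. -/
  | r3 (α β γ ε : ℤˣ) (t₁ t₂ t₃ m₁ m₂ m₃ b₁ b₂ b₃ : ℕ) (P : Multiset (ℕ × ℕ))
      (C : Multiset Crossing) :
      Move ⟨P, triangle α β γ ε t₁ t₂ t₃ m₁ m₂ m₃ b₁ b₂ b₃ + C⟩
        ⟨P, triangle (-α) (-β) (-γ) ε t₁ t₂ t₃ m₁ m₂ m₃ b₁ b₂ b₃ + C⟩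

/-- The diagram of the unknot without crossings: one arc, with one marked point. -/
def circle : Diagram := ⟨{(0, 0)}, 0⟩

theorem isKnotDiagram_circle : circle.IsKnotDiagram := by
  have harcs : circle.arcs = {0} := rfl
  refine ⟨by simp [circle, ins], by simp [circle, ins, outs], ?_, ?_⟩
  · rw [componentCount, harcs]
    simp [classCount]
  · rw [regionCount, harcs]
    have hne : ¬ Relation.EqvGen (fun x y : ℕ × Bool => (x, y) ∈
        ({((0, true), (0, true)), ((0, false), (0, false))} :
          Multiset ((ℕ × Bool) × (ℕ × Bool)))) (0, false) (0, true) := by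
      intro h
      have key : ∀ x y : ℕ × Bool, Relation.EqvGen (fun x y : ℕ × Bool => (x, y) ∈
          ({((0, true), (0, true)), ((0, false), (0, false))} :
            Multiset ((ℕ × Bool) × (ℕ × Bool)))) x y → x = y := by
        intro x y hxy
        induction hxy with
        | rel x y h =>
          simp only [Multiset.insert_eq_cons, Multiset.mem_cons, Multiset.mem_singleton,
            Prod.mk.injEq] at h
          rcases h with ⟨h1, h2⟩ | ⟨h1, h2⟩ <;> rw [h1, h2]
        | refl x => rfl
        | symm x y _ ih => exact ih.symm
        | trans x y z _ _ ih1 ih2 => exact ih1.trans ih2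
      simpa using key _ _ h
    have hprod : ((({0} ×ˢ Finset.univ : Finset (ℕ × Bool))) : Set (ℕ × Bool)) =
        {(0, false), (0, true)} := by
      ext ⟨x, y⟩
      cases y <;> simp
    rw [classCount, hprod, Set.image_pair]
    exact Set.ncard_pair fun h => hne (Quotient.exact h)

end Diagram

/-- Oriented knot diagrams on the sphere. -/
abbrev KnotDiagram : Type := {D : Diagram // D.IsKnotDiagram}

/-- Oriented knots, as knot diagrams modulo Reidemeister moves. -/
def Knot : Type := Quot fun D E : KnotDiagram => Diagram.Move D.1 E.1

/-- The knot presented by a diagram. -/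
def KnotDiagram.knot (D : KnotDiagram) : Knot := Quot.mk _ D

/-- `D'` is obtained from `D` by a change of the crossing `c`. -/
def KnotDiagram.IsSwitch (D : KnotDiagram) (c : Crossing) (D' : KnotDiagram) : Prop :=
  ∃ C : Multiset Crossing, D.1.crossings = c ::ₘ C ∧
    D'.1.crossings = c.switch ::ₘ C ∧ D'.1.points = D.1.points

/-- `D'` is obtained from `D` by smoothing the crossing `c` in the way that does not respect the
orientation, and by choosing an orientation of the result. -/
def KnotDiagram.IsDisorientedSmoothing (D : KnotDiagram) (c : Crossing) (D' : KnotDiagram) : Prop :=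
  ∃ C : Multiset Crossing, D.1.crossings = c ::ₘ C ∧
    Multiset.Rel (fun p q : ℕ × ℕ => q = p ∨ q = p.swap)
      (c.disorientedSplit + D.1.points) D'.1.points ∧
    Multiset.Rel Crossing.SameUnoriented C D'.1.crossings

namespace Knot

/-- The unknot. -/
def unknot : Knot := KnotDiagram.knot ⟨Diagram.circle, Diagram.isKnotDiagram_circle⟩

/-- `K` and `L` have diagrams that differ by one crossing change. -/
def CrossingChange (K L : Knot) : Prop :=
  ∃ (D E : KnotDiagram) (c : Crossing), D.knot = K ∧ E.knot = L ∧ D.IsSwitch c E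

/-- The unknotting number: the least length of a sequence of crossing changes from `K` to the
unknot. -/
noncomputable def unknottingNumber (K : Knot) : ℕ :=
  sInf {n : ℕ | ∃ s : ℕ → Knot, s 0 = K ∧ s n = unknot ∧
    ∀ i < n, CrossingChange (s i) (s (i + 1))}

/-- `V` is the Jones polynomial of `K`: it is that of every diagram of `K`. -/
def IsJones (K : Knot) (V : ℤ[T;T⁻¹]) : Prop :=
  ∀ D : KnotDiagram, D.knot = K → D.1.HasJones V

end Knot

/-- The value `W'(1)` of the derivative of a Laurent polynomial `W` at `1`. -/
def derivAtOne (W : ℤ[T;T⁻¹]) : ℤ := W.coeff.sum fun n a => n * a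

end KnotDiag

/-!
Let `c` be the positive crossing of `D`, let `D₀` be the diagram after the crossing change, and let
`D'` be the smoothing that does not respect the orientation. The Kauffman brackets satisfy
`⟨D⟩ = A X + A⁻¹ Y` and `⟨D₀⟩ = A⁻¹ X + A Y`, where `X` and `Y` are the state sums of the two
smoothings, and `⟨D'⟩ = Y` because brackets do not depend on orientations. As `D₀` presents the
unknot, the second equation determines `X`, and the first one becomes a relation between the Jones
polynomials `V` of `D` and `U` of `D'`, namely `V = t + (1 - t) t ^ (3 l) U`, where the
writhe of `D'` is that of `D` minus `1 + 4 l` (`jones_eq`). So `W = t ^ (3 l) U` satisfies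
`V - 1 = (t - 1) (1 - W)`. Finally `U(1) = 1` and the derivative of `U` at `1` is `0`, so that
`3 l` is the derivative of `W` at `1`.

The facts used in this argument are proved for the combinatorial diagrams at hand:

* The bracket, normalized by the writhe, is invariant under the Reidemeister moves
  (`Diagram.Move.normBracket_eq`). All local computations are made with `stateSum`, in which the
  crossings are split one after the other.
* `D'` is a knot diagram (`isKnotDiagram_smoothing`). It has one component because the removal of
  `c` leaves two strands, one of which is reversed. For its number of regions there are two bounds:
  the smoothing lowers it by at most one, which is a bound from below, and by induction on the
  crossings a diagram with `n` crossings and one component has at most `n + 2` regions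
  (`regionCount_le_of_componentCount_eq_one`).
* The same induction provides a checkerboard coloring of the regions of a knot diagram
  (`exists_alternating`), that is, an orientation of the arcs in which at each crossing one strand
  has two sources and the other one two sinks. Therefore the two splittings of a crossing in a state
  have numbers of circles of different parity, which fixes the exponents of the bracket modulo four;
  this gives the existence of the Jones polynomial (`exists_hasJones`). It also shows that the two
  strands at `c` cross in an even number of further crossings, so that the writhe of `D'` is as
  stated (`ReversesAt.writhe_smoothing`).
* At `A = 1` a circle has the value `-2`, and the three ways of joining four ends in pairs have the
  sum zero. The same holds up to second order in `A - 1`, so that the state sum can be computed to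
  first order by passing straight through all crossings (`jet_eq_one`).
-/

/-! ### Classes of the equivalence relation generated by pairs -/

namespace KnotDiag

/-- `x` and `y` lie in the same connected component of the graph with edges `E`. -/
def Conn {α : Type} (E : Multiset (α × α)) (x y : α) : Prop :=
  Relation.EqvGen (fun x y => (x, y) ∈ E) x y

namespace Conn

variable {α β : Type} {E E' : Multiset (α × α)} {x y z : α}

theorem refl (E : Multiset (α × α)) (x : α) : Conn E x x := Relation.EqvGen.refl x

theorem symm (h : Conn E x y) : Conn E y x := Relation.EqvGen.symm _ _ h

theorem trans (h : Conn E x y) (h' : Conn E y z) : Conn E x z := Relation.EqvGen.trans _ _ _ h h'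

theorem of_mem (h : (x, y) ∈ E) : Conn E x y := Relation.EqvGen.rel _ _ h

theorem lift {r : α → α → Prop} (hr : Equivalence r) (h : ∀ e ∈ E, r e.1 e.2)
    (hxy : Conn E x y) : r x y := by
  induction hxy with
  | rel x y hxy => exact h _ hxy
  | refl x => exact hr.refl x
  | symm x y _ ih => exact hr.symm ih
  | trans x y z _ _ ih ih' => exact hr.trans ih ih'

theorem equivalence (E : Multiset (α × α)) : Equivalence (Conn E) :=
  ⟨refl E, symm, trans⟩

theorem map {F : Multiset (β × β)} (f : α → β) (h : ∀ e ∈ E, Conn F (f e.1) (f e.2))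
    (hxy : Conn E x y) : Conn F (f x) (f y) :=
  lift (r := fun x y => Conn F (f x) (f y)) ⟨fun _ => refl _ _, symm, trans⟩ h hxy

theorem apply_eq (f : α → β) (h : ∀ e ∈ E, f e.1 = f e.2) (hxy : Conn E x y) : f x = f y :=
  lift (r := fun x y => f x = f y) ⟨fun _ => rfl, Eq.symm, Eq.trans⟩ h hxy

theorem mono' (h : ∀ e ∈ E, Conn E' e.1 e.2) (hxy : Conn E x y) : Conn E' x y :=
  hxy.map id h

theorem mono (h : E ≤ E') (hxy : Conn E x y) : Conn E' x y :=
  hxy.mono' fun _ he => of_mem (Multiset.mem_of_le h he)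

theorem cons (h : Conn E x y) (e : α × α) : Conn (e ::ₘ E) x y :=
  h.mono (Multiset.le_cons_self _ _)

theorem cons_iff {u v : α} : Conn ((x, y) ::ₘ E) u v ↔
    Conn E u v ∨ (Conn E u x ∧ Conn E y v) ∨ (Conn E u y ∧ Conn E x v) := by
  constructor
  · intro h
    refine lift (r := fun u v => Conn E u v ∨ (Conn E u x ∧ Conn E y v) ∨
      (Conn E u y ∧ Conn E x v)) ⟨fun x => Or.inl (refl _ _), ?_, ?_⟩ ?_ h
    · rintro u v (h | ⟨h, h'⟩ | ⟨h, h'⟩)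
      · exact Or.inl h.symm
      · exact Or.inr (Or.inr ⟨h'.symm, h.symm⟩)
      · exact Or.inr (Or.inl ⟨h'.symm, h.symm⟩)
    · rintro u v w (h | ⟨h, h'⟩ | ⟨h, h'⟩) (k | ⟨k, k'⟩ | ⟨k, k'⟩)
      · exact Or.inl (h.trans k)
      · exact Or.inr (Or.inl ⟨h.trans k, k'⟩)
      · exact Or.inr (Or.inr ⟨h.trans k, k'⟩)
      · exact Or.inr (Or.inl ⟨h, h'.trans k⟩)
      · exact Or.inr (Or.inl ⟨h, k'⟩)
      · exact Or.inl (h.trans k')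
      · exact Or.inr (Or.inr ⟨h, h'.trans k⟩)
      · exact Or.inl (h.trans k')
      · exact Or.inr (Or.inr ⟨h, k'⟩)
    · intro e he
      rcases Multiset.mem_cons.1 he with rfl | he
      · exact Or.inr (Or.inl ⟨refl _ _, refl _ _⟩)
      · exact Or.inl (of_mem he)
  · have hxy : Conn ((x, y) ::ₘ E) x y := of_mem (Multiset.mem_cons_self _ _)
    rintro (h | ⟨h, h'⟩ | ⟨h, h'⟩)
    · exact h.cons _
    · exact (h.cons _).trans (hxy.trans (h'.cons _))
    · exact (h.cons _).trans (hxy.symm.trans (h'.cons _))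

end Conn

section ClassCount

variable {α β : Type}

theorem classCount_def (V : Finset α) (E : Multiset (α × α)) : classCount V E =
    (Quot.mk (Conn E) '' (V : Set α)).ncard := rfl

theorem quot_mk_eq_iff {E : Multiset (α × α)} {x y : α} :
    Quot.mk (Conn E) x = Quot.mk (Conn E) y ↔ Conn E x y :=
  ⟨fun h => (Conn.equivalence E).eqvGen_iff.1 (Quot.eqvGen_exact h), fun h => Quot.sound h⟩

/-- Maps in both directions that respect connectedness and are inverse to each other up to
connectedness give equal numbers of classes. -/
theorem classCount_eq_of_maps {V : Finset α} {W : Finset β} {E : Multiset (α × α)}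
    {F : Multiset (β × β)} (f : α → β) (g : β → α)
    (hf : ∀ e ∈ E, Conn F (f e.1) (f e.2)) (hg : ∀ e ∈ F, Conn E (g e.1) (g e.2))
    (hfV : ∀ v ∈ V, f v ∈ W) (hgW : ∀ w ∈ W, g w ∈ V)
    (hgf : ∀ v ∈ V, Conn E (g (f v)) v) (hfg : ∀ w ∈ W, Conn F (f (g w)) w) :
    classCount V E = classCount W F := by
  rw [classCount_def, classCount_def]
  have hf' : ∀ x y, Conn E x y → Quot.mk (Conn F) (f x) = Quot.mk (Conn F) (f y) :=
    fun x y h => Quot.sound (h.map f hf)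
  have hinj : Set.InjOn (Quot.lift (fun x => Quot.mk (Conn F) (f x)) hf')
      (Quot.mk (Conn E) '' (V : Set α)) := by
    rintro _ ⟨v, hv, rfl⟩ _ ⟨w, hw, rfl⟩ h
    have h' : Conn F (f v) (f w) := quot_mk_eq_iff.1 h
    exact Quot.sound ((hgf v hv).symm.trans ((h'.map g hg).trans (hgf w hw)))
  rw [← hinj.ncard_image]
  congr 1
  ext q
  constructor
  · rintro ⟨_, ⟨v, hv, rfl⟩, rfl⟩
    exact ⟨f v, hfV v hv, rfl⟩
  · rintro ⟨w, hw, rfl⟩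
    exact ⟨_, ⟨g w, hgW w hw, rfl⟩, Quot.sound (hfg w hw)⟩

theorem classCount_congr (V : Finset α) {E F : Multiset (α × α)}
    (h : ∀ e ∈ E, Conn F e.1 e.2) (h' : ∀ e ∈ F, Conn E e.1 e.2) :
    classCount V E = classCount V F :=
  classCount_eq_of_maps id id h h' (fun _ h => h) (fun _ h => h) (fun _ _ => Conn.refl _ _)
    fun _ _ => Conn.refl _ _

theorem classCount_swap (V : Finset α) (x y : α) (E : Multiset (α × α)) :
    classCount V ((x, y) ::ₘ E) = classCount V ((y, x) ::ₘ E) := by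
  refine classCount_congr V ?_ ?_ <;> intro e he <;> rcases Multiset.mem_cons.1 he with rfl | he
  · exact (Conn.of_mem (Multiset.mem_cons_self _ _)).symm
  · exact (Conn.of_mem he).cons _
  · exact (Conn.of_mem (Multiset.mem_cons_self _ _)).symm
  · exact (Conn.of_mem he).cons _

theorem classCount_cons_of_conn (V : Finset α) {x y : α} {E : Multiset (α × α)}
    (h : Conn E x y) : classCount V ((x, y) ::ₘ E) = classCount V E := by
  refine classCount_congr V ?_ fun e he => (Conn.of_mem he).cons _
  intro e he
  rcases Multiset.mem_cons.1 he with rfl | he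
  · exact h
  · exact Conn.of_mem he

theorem classCount_cons_of_not_conn {V : Finset α} {x y : α} {E : Multiset (α × α)}
    (hx : x ∈ V) (hy : y ∈ V) (h : ¬ Conn E x y) :
    classCount V ((x, y) ::ₘ E) + 1 = classCount V E := by
  classical
  rw [classCount_def, classCount_def]
  set S := Quot.mk (Conn E) '' (V : Set α) with hS
  have hfin : S.Finite := V.finite_toSet.image _
  have hxS : Quot.mk (Conn E) x ∈ S := ⟨x, hx, rfl⟩
  rw [← Set.ncard_sdiff_singleton_add_one hxS hfin]
  congr 1
  have hc : ∀ u v, Conn E u v →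
      Quot.mk (Conn ((x, y) ::ₘ E)) u = Quot.mk (Conn ((x, y) ::ₘ E)) v :=
    fun u v h => Quot.sound (h.cons _)
  have hinj : Set.InjOn (Quot.lift (Quot.mk (Conn ((x, y) ::ₘ E))) hc)
      (S \ {Quot.mk (Conn E) x}) := by
    rintro _ ⟨⟨u, hu, rfl⟩, hux⟩ _ ⟨⟨v, hv, rfl⟩, hvx⟩ huv
    rw [Set.mem_singleton_iff, quot_mk_eq_iff] at hux hvx
    rcases Conn.cons_iff.1 (quot_mk_eq_iff.1 huv) with h | ⟨h, -⟩ | ⟨-, h⟩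
    · exact Quot.sound h
    · exact absurd h hux
    · exact absurd h.symm hvx
  rw [← hinj.ncard_image]
  congr 1
  ext q
  constructor
  · rintro ⟨u, hu, rfl⟩
    by_cases hux : Conn E u x
    · refine ⟨Quot.mk _ y, ⟨⟨y, hy, rfl⟩, ?_⟩, ?_⟩
      · rw [Set.mem_singleton_iff, quot_mk_eq_iff]
        exact fun h' => h h'.symm
      · exact Quot.sound (Conn.cons_iff.2 (Or.inr (Or.inr ⟨Conn.refl _ _, hux.symm⟩)))
    · refine ⟨Quot.mk _ u, ⟨⟨u, hu, rfl⟩, ?_⟩, rfl⟩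
      rwa [Set.mem_singleton_iff, quot_mk_eq_iff]
  · rintro ⟨_, ⟨⟨u, hu, rfl⟩, -⟩, rfl⟩
    exact ⟨u, hu, rfl⟩

theorem classCount_le_cons (V : Finset α) (e : α × α) (E : Multiset (α × α))
    (h₁ : e.1 ∈ V) (h₂ : e.2 ∈ V) : classCount V E ≤ classCount V (e ::ₘ E) + 1 := by
  by_cases h : Conn E e.1 e.2
  · rw [classCount_cons_of_conn V h]
    omega
  · exact (classCount_cons_of_not_conn h₁ h₂ h).ge

theorem classCount_mono (V : Finset α) {E F : Multiset (α × α)} (h : ∀ e ∈ E, Conn F e.1 e.2) :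
    classCount V F ≤ classCount V E := by
  rw [classCount_def, classCount_def]
  have hc : ∀ u v, Conn E u v → Quot.mk (Conn F) u = Quot.mk (Conn F) v :=
    fun u v huv => Quot.sound (huv.mono' h)
  have : Quot.mk (Conn F) '' (V : Set α) =
      Quot.lift (Quot.mk (Conn F)) hc '' (Quot.mk (Conn E) '' (V : Set α)) := by
    rw [Set.image_image]
  rw [this]
  exact Set.ncard_image_le (V.finite_toSet.image _)

theorem classCount_pos {V : Finset α} (hV : V.Nonempty) (E : Multiset (α × α)) :
    0 < classCount V E := by
  rw [classCount_def]
  exact (Set.ncard_pos (V.finite_toSet.image _)).2 ((Finset.coe_nonempty.2 hV).image _)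

theorem conn_of_classCount_le_one {V : Finset α} {E : Multiset (α × α)}
    (h : classCount V E ≤ 1) {x y : α} (hx : x ∈ V) (hy : y ∈ V) : Conn E x y := by
  rw [classCount_def, Set.ncard_le_one (V.finite_toSet.image _)] at h
  exact quot_mk_eq_iff.1 (h _ ⟨x, hx, rfl⟩ _ ⟨y, hy, rfl⟩)

theorem classCount_zero (V : Finset α) : classCount V (0 : Multiset (α × α)) = V.card := by
  rw [classCount_def, Set.ncard_image_of_injective, Set.ncard_coe_finset]
  intro x y hxy
  exact (quot_mk_eq_iff.1 hxy).apply_eq id (by simp)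

/-- A graph has at least `#V - #E` components. -/
theorem card_le_classCount_add_card (V : Finset α) (E : Multiset (α × α))
    (h : ∀ e ∈ E, e.1 ∈ V ∧ e.2 ∈ V) : V.card ≤ classCount V E + Multiset.card E := by
  induction E using Multiset.induction_on with
  | empty => simp [classCount_zero]
  | cons e E ih =>
    have h₁ := ih fun e he => h e (Multiset.mem_cons_of_mem he)
    have h₂ := h e (Multiset.mem_cons_self _ _)
    have h₃ := classCount_le_cons V e E h₂.1 h₂.2
    rw [Multiset.card_cons]
    omega

theorem conn_fresh {b x : α} {E : Multiset (α × α)} (h : ∀ e ∈ E, e.1 ≠ b ∧ e.2 ≠ b)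
    (hx : Conn E x b) : x = b := by
  have := hx.apply_eq (fun z => z = b) fun e he => by simp [h e he]
  simpa using this

theorem classCount_fresh [DecidableEq α] {V : Finset α} {b : α} {E : Multiset (α × α)}
    (hb : b ∈ V) (h : ∀ e ∈ E, e.1 ≠ b ∧ e.2 ≠ b) :
    classCount V E = classCount (V.erase b) E + 1 := by
  conv_lhs => rw [← Finset.insert_erase hb]
  rw [classCount_def, classCount_def, Finset.coe_insert, Set.image_insert_eq,
    Set.ncard_insert_of_notMem _ ((V.erase b).finite_toSet.image _)]
  rintro ⟨x, hx, hxb⟩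
  rw [quot_mk_eq_iff] at hxb
  have := conn_fresh h hxb
  simp [this] at hx

/-- Contraction of an edge. -/
theorem classCount_contract [DecidableEq α] {V : Finset α} {a b : α} (hab : a ≠ b)
    (ha : a ∈ V) (hb : b ∈ V) (E : Multiset (α × α)) :
    classCount V ((a, b) ::ₘ E) = classCount (V.erase b)
      (E.map (Prod.map (Function.update id b a) (Function.update id b a))) := by
  have key : ∀ x, Conn ((a, b) ::ₘ E) (Function.update id b a x) x := by
    intro x
    by_cases hx : x = b
    · subst hx
      rw [Function.update_self]
      exact Conn.of_mem (Multiset.mem_cons_self _ _)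
    · rw [Function.update_of_ne hx]
      exact Conn.refl _ _
  refine classCount_eq_of_maps (Function.update id b a) id ?_ ?_ ?_ ?_ (fun v _ => key v) ?_
  · intro e he
    rcases Multiset.mem_cons.1 he with rfl | he
    · simp only [Function.update_self, Function.update_of_ne hab, id]
      exact Conn.refl _ _
    · exact Conn.of_mem (Multiset.mem_map.2 ⟨e, he, rfl⟩)
  · intro e he
    obtain ⟨d, hd, rfl⟩ := Multiset.mem_map.1 he
    exact (key d.1).trans (((Conn.of_mem hd).cons _).trans (key d.2).symm)
  · intro v hv
    by_cases hvb : v = b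
    · subst hvb
      rw [Function.update_self]
      exact Finset.mem_erase.2 ⟨hab, ha⟩
    · rw [Function.update_of_ne hvb]
      exact Finset.mem_erase.2 ⟨hvb, hv⟩
  · exact fun w hw => Finset.mem_of_mem_erase hw
  · intro w hw
    rw [id, Function.update_of_ne (Finset.ne_of_mem_erase hw)]
    exact Conn.refl _ _

theorem classCount_map [DecidableEq β] {f : α → β} (hf : Function.Injective f) (V : Finset α)
    (E : Multiset (α × α)) :
    classCount V E = classCount (V.image f) (E.map (Prod.map f f)) := by
  by_cases hα : Nonempty α
  · have hinv := Function.leftInverse_invFun hf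
    refine classCount_eq_of_maps f (Function.invFun f) ?_ ?_ ?_ ?_ ?_ ?_
    · exact fun e he => Conn.of_mem (Multiset.mem_map.2 ⟨e, he, rfl⟩)
    · intro e he
      obtain ⟨d, hd, rfl⟩ := Multiset.mem_map.1 he
      simp only [Prod.map_fst, Prod.map_snd, hinv _]
      exact Conn.of_mem hd
    · exact fun v hv => Finset.mem_image_of_mem f hv
    · intro w hw
      obtain ⟨v, hv, rfl⟩ := Finset.mem_image.1 hw
      rwa [hinv]
    · intro v _
      rw [hinv]
      exact Conn.refl _ _
    · intro w hw
      obtain ⟨v, hv, rfl⟩ := Finset.mem_image.1 hw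
      rw [hinv]
      exact Conn.refl _ _
  · rw [not_nonempty_iff] at hα
    rw [Finset.eq_empty_of_isEmpty V]
    simp [classCount_def]

end ClassCount

/-- The endpoints of the edges in `E`. -/
def ends {α : Type} (E : Multiset (α × α)) : Multiset α := E.map Prod.fst + E.map Prod.snd

section Ends

variable {α : Type}

@[simp] theorem ends_zero : ends (0 : Multiset (α × α)) = 0 := rfl

@[simp] theorem ends_add (E F : Multiset (α × α)) : ends (E + F) = ends E + ends F := by
  simp only [ends, Multiset.map_add]
  abel

@[simp] theorem ends_cons (x y : α) (E : Multiset (α × α)) :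
    ends ((x, y) ::ₘ E) = x ::ₘ y ::ₘ ends E := by
  simp [ends, Multiset.cons_swap]

theorem card_ends (E : Multiset (α × α)) : Multiset.card (ends E) = 2 * Multiset.card E := by
  simp [ends, two_mul]

theorem mem_ends_of_mem {E : Multiset (α × α)} {e : α × α} (h : e ∈ E) :
    e.1 ∈ ends E ∧ e.2 ∈ ends E :=
  ⟨Multiset.mem_add.2 (Or.inl (Multiset.mem_map_of_mem _ h)),
    Multiset.mem_add.2 (Or.inr (Multiset.mem_map_of_mem _ h))⟩

open Classical in
/-- In a graph in which all degrees are two after the addition of the half-edges `S`, each component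
contains either none or two of the half-edges. The number is even because the degrees add up to
an even number, and it is at most two because a component with `k` vertices has at least `k - 1`
edges. -/
theorem card_filter_conn {V : Finset α} {E : Multiset (α × α)} {S : Multiset α}
    (h : ends E + S = V.val + V.val) {a : α} (ha : a ∈ S) :
    Multiset.card (S.filter (Conn E a)) = 2 := by
  set p := Conn E a with hp
  have hpe : ∀ e ∈ E, (p e.1 ↔ p e.2) := fun e he =>
    ⟨fun h => h.trans (Conn.of_mem he), fun h => h.trans (Conn.of_mem he).symm⟩
  set F := E.filter (fun e => p e.1) with hF
  have hends : ends F = (ends E).filter p := by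
    rw [ends, ends, Multiset.filter_add, Multiset.filter_map, Multiset.filter_map, hF]
    congr 2
    exact Multiset.filter_congr hpe
  set W := V.filter p with hW
  have hsum : ends F + S.filter p = W.val + W.val := by
    rw [hends, ← Multiset.filter_add, h, Multiset.filter_add]
    rfl
  have hcard := congrArg Multiset.card hsum
  rw [Multiset.card_add, Multiset.card_add, card_ends, Finset.card_val] at hcard
  have haW : a ∈ W := by
    have : a ∈ W.val + W.val := by
      rw [← hsum]
      exact Multiset.mem_add.2 (Or.inr (Multiset.mem_filter.2 ⟨ha, Conn.refl _ _⟩))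
    simpa using this
  have hpos : 0 < Multiset.card (S.filter p) :=
    Multiset.card_pos_iff_exists_mem.2 ⟨a, Multiset.mem_filter.2 ⟨ha, Conn.refl _ _⟩⟩
  have hconn : ∀ x, p x → Conn F a x := by
    intro x hx
    have key : p a ∧ Conn F a a ↔ p x ∧ Conn F a x := by
      have := hx.apply_eq (fun z => p z ∧ Conn F a z) fun e he => by
        have hiff := hpe e he
        refine propext ⟨fun ⟨h₁, h₂⟩ => ⟨hiff.1 h₁, h₂.trans (Conn.of_mem ?_)⟩,
          fun ⟨h₁, h₂⟩ => ⟨hiff.2 h₁, h₂.trans (Conn.of_mem ?_).symm⟩⟩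
        · exact Multiset.mem_filter.2 ⟨he, h₁⟩
        · exact Multiset.mem_filter.2 ⟨he, hiff.2 h₁⟩
      exact iff_of_eq this
    exact (key.1 ⟨Conn.refl _ _, Conn.refl _ _⟩).2
  have hone : classCount W F ≤ 1 := by
    rw [classCount_def, Set.ncard_le_one (W.finite_toSet.image _)]
    rintro _ ⟨x, hx, rfl⟩ _ ⟨y, hy, rfl⟩
    refine quot_mk_eq_iff.2 ((hconn x ?_).symm.trans (hconn y ?_))
    · exact (Finset.mem_filter.1 hx).2
    · exact (Finset.mem_filter.1 hy).2
  have hle := card_le_classCount_add_card W F fun e he => by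
    have h₁ := mem_ends_of_mem he
    have h₂ : ∀ x ∈ ends F, x ∈ W := fun x hx => by
      have : x ∈ W.val + W.val := by
        rw [← hsum]
        exact Multiset.mem_add.2 (Or.inl hx)
      simpa using this
    exact ⟨h₂ _ h₁.1, h₂ _ h₁.2⟩
  omega

/-- Four half-edges `a, b, c, d` are joined in pairs by the rest of the graph, in one of three
ways. -/
theorem pairing {V : Finset α} {E : Multiset (α × α)} {a b c d : α}
    (h : ends E + {a, b, c, d} = V.val + V.val) :
    (Conn E a b ∧ Conn E c d ∧ ¬ Conn E a c) ∨ (Conn E a c ∧ Conn E b d ∧ ¬ Conn E a b) ∨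
      (Conn E a d ∧ Conn E b c ∧ ¬ Conn E a b) := by
  classical
  have ha := card_filter_conn h (a := a) (by simp)
  have hb := card_filter_conn h (a := b) (by simp)
  have hc := card_filter_conn h (a := c) (by simp)
  have hsym : ∀ {x y}, Conn E x y ↔ Conn E y x := ⟨Conn.symm, Conn.symm⟩
  simp only [Multiset.insert_eq_cons, ← Multiset.cons_zero, Multiset.filter_cons,
    Multiset.card_add, Conn.refl, if_true, Multiset.filter_zero, Multiset.card_zero,
    hsym (x := b) (y := a), hsym (x := c) (y := a), hsym (x := c) (y := b),
    apply_ite Multiset.card] at ha hb hc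
  by_cases hab : Conn E a b <;> by_cases hac : Conn E a c <;> by_cases had : Conn E a d <;>
    simp [hab, hac, had] at ha hb hc ⊢
  · by_cases hbc : Conn E b c
    · exact absurd (hab.trans hbc) hac
    · by_cases hcd : Conn E c d
      · exact hcd
      · simp [hbc, hcd] at hc
  · by_cases hbd : Conn E b d
    · exact hbd
    · have hbc : ¬ Conn E b c := fun h => hab (hac.trans h.symm)
      simp [hbc, hbd] at hb
  · by_cases hbc : Conn E b c
    · exact hbc
    · have hbd : ¬ Conn E b d := fun h => hab (had.trans h.symm)
      simp [hbc, hbd] at hb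

theorem mem_of_ends_add {V : Finset α} {E : Multiset (α × α)} {S : Multiset α}
    (h : ends E + S = V.val + V.val) {a : α} (ha : a ∈ S) : a ∈ V := by
  have : a ∈ V.val + V.val := by
    rw [← h]
    exact Multiset.mem_add.2 (Or.inr ha)
  simpa using this

/-- Closing up the half-edges in the way in which they are already joined, or in another way. -/
theorem classCount_close {V : Finset α} {E : Multiset (α × α)} {a b c d : α} (ha : a ∈ V)
    (hc : c ∈ V) (hd : d ∈ V) (hab : Conn E a b) (hcd : Conn E c d)
    (hac : ¬ Conn E a c) :
    classCount V ({(a, b), (c, d)} + E) = classCount V E ∧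
    classCount V ({(a, c), (b, d)} + E) + 1 = classCount V E ∧
    classCount V ({(a, d), (b, c)} + E) + 1 = classCount V E := by
  simp only [Multiset.insert_eq_cons, Multiset.cons_add, Multiset.singleton_add]
  refine ⟨?_, ?_, ?_⟩
  · rw [classCount_cons_of_conn V (hab.cons _), classCount_cons_of_conn V hcd]
  · rw [Multiset.cons_swap, classCount_cons_of_conn V, classCount_cons_of_not_conn ha hc hac]
    exact (hab.symm.cons _).trans ((Conn.of_mem (Multiset.mem_cons_self _ _)).trans (hcd.cons _))
  · rw [Multiset.cons_swap, classCount_cons_of_conn V, classCount_cons_of_not_conn ha hd]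
    · exact fun h => hac (h.trans hcd.symm)
    · exact (hab.symm.cons _).trans
        ((Conn.of_mem (Multiset.mem_cons_self _ _)).trans (hcd.symm.cons _))

end Ends

end KnotDiag

/-! ### The state sum -/

namespace KnotDiag

/-- The value `-A² - A⁻²` of a circle. -/
noncomputable def loopValue : ℤ[T;T⁻¹] := -T 2 - T (-2)

/-- The Kauffman state sum of the curves formed by the arcs in `V`, joined by the edges in `P`, with
crossings `C`. In contrast to `Diagram.bracket`, the set of arcs is given and the edges have no
direction, so that crossings can be smoothed one after the other. -/
noncomputable def stateSum (V : Finset ℕ) (P : Multiset (ℕ × ℕ)) (C : Multiset Crossing) :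
    ℤ[T;T⁻¹] :=
  (C.antidiagonal.map fun S =>
    T ((Multiset.card S.1 : ℤ) - Multiset.card S.2) *
      loopValue ^ (classCount V (P + S.1.bind Crossing.splitA + S.2.bind Crossing.splitB) - 1)).sum

theorem Diagram.bracket_eq_stateSum (D : Diagram) :
    D.bracket = stateSum D.arcs D.points D.crossings := rfl

theorem stateSum_zero (V : Finset ℕ) (P : Multiset (ℕ × ℕ)) :
    stateSum V P 0 = loopValue ^ (classCount V P - 1) := by
  simp [stateSum]

theorem stateSum_cons (V : Finset ℕ) (P : Multiset (ℕ × ℕ)) (c : Crossing)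
    (C : Multiset Crossing) : stateSum V P (c ::ₘ C) =
      T 1 * stateSum V (c.splitA + P) C + T (-1) * stateSum V (c.splitB + P) C := by
  simp only [stateSum, Multiset.antidiagonal_cons, Multiset.map_add, Multiset.sum_add,
    Multiset.map_map, ← Multiset.sum_map_mul_left]
  rw [add_comm]
  congr 2 <;> refine Multiset.map_congr rfl fun S _ => ?_
  · simp only [Function.comp, Prod.map_fst, Prod.map_snd, id, Multiset.card_cons,
      Multiset.cons_bind, ← mul_assoc, ← LaurentPolynomial.T_add]
    congr 2
    · push_cast; ring
    · congr 2; abel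
  · simp only [Function.comp, Prod.map_fst, Prod.map_snd, id, Multiset.card_cons,
      Multiset.cons_bind, ← mul_assoc, ← LaurentPolynomial.T_add]
    congr 2
    · push_cast; ring
    · congr 2; abel

theorem Crossing.sign_eq (c : Crossing) : c.sign = 1 ∨ c.sign = -1 := Int.units_eq_one_or _

/-- The bracket relation in terms of the oriented and the disoriented splitting. -/
theorem stateSum_cons_sign (V : Finset ℕ) (P : Multiset (ℕ × ℕ)) (c : Crossing)
    (C : Multiset Crossing) : stateSum V P (c ::ₘ C) =
      T (c.sign : ℤ) * stateSum V (c.orientedSplit + P) C +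
        T (-(c.sign : ℤ)) * stateSum V (c.disorientedSplit + P) C := by
  rw [stateSum_cons, Crossing.splitA, Crossing.splitB]
  rcases c.sign_eq with h | h <;> rw [h]
  · simp
  · rw [if_neg (by decide), if_neg (by decide), add_comm]
    simp

theorem Crossing.map_splitA (f : ℕ → ℕ) (c : Crossing) :
    c.splitA.map (Prod.map f f) = (c.relabel f).splitA := by
  by_cases h : c.sign = 1 <;> simp [splitA, relabel, orientedSplit, disorientedSplit, h]

theorem Crossing.map_splitB (f : ℕ → ℕ) (c : Crossing) :
    c.splitB.map (Prod.map f f) = (c.relabel f).splitB := by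
  by_cases h : c.sign = 1 <;> simp [splitB, relabel, orientedSplit, disorientedSplit, h]

theorem stateSum_eq_of_map {V W : Finset ℕ} {P Q : Multiset (ℕ × ℕ)} (f : ℕ → ℕ)
    (h : ∀ F, classCount V (P + F) = classCount W (Q + F.map (Prod.map f f)))
    (C : Multiset Crossing) :
    stateSum V P C = stateSum W Q (C.map (Crossing.relabel f)) := by
  induction C using Multiset.induction_on generalizing P Q with
  | empty =>
    have := h 0
    simp only [add_zero, Multiset.map_zero] at this
    simp [stateSum_zero, this]
  | cons c C ih =>
    rw [Multiset.map_cons, stateSum_cons, stateSum_cons, ih (Q := (c.relabel f).splitA + Q),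
      ih (Q := (c.relabel f).splitB + Q)]
    · intro F
      rw [← c.map_splitB f, add_comm _ Q, add_assoc Q, ← Multiset.map_add, ← h, add_comm _ P,
        add_assoc]
    · intro F
      rw [← c.map_splitA f, add_comm _ Q, add_assoc Q, ← Multiset.map_add, ← h, add_comm _ P,
        add_assoc]

theorem stateSum_congr {V W : Finset ℕ} {P Q : Multiset (ℕ × ℕ)}
    (h : ∀ F, classCount V (P + F) = classCount W (Q + F)) (C : Multiset Crossing) :
    stateSum V P C = stateSum W Q C := by
  have hid : Crossing.relabel id = id := rfl
  have := stateSum_eq_of_map (V := V) (W := W) (P := P) (Q := Q) id (by simpa using h) C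
  rwa [hid, Multiset.map_id] at this

theorem stateSum_swap (V : Finset ℕ) (x y : ℕ) (P : Multiset (ℕ × ℕ)) (C : Multiset Crossing) :
    stateSum V ((x, y) ::ₘ P) C = stateSum V ((y, x) ::ₘ P) C :=
  stateSum_congr (fun F => by rw [Multiset.cons_add, classCount_swap, Multiset.cons_add]) C

theorem stateSum_map_of_injective {f : ℕ → ℕ} (hf : Function.Injective f) (V : Finset ℕ)
    (P : Multiset (ℕ × ℕ)) (C : Multiset Crossing) : stateSum V P C =
      stateSum (V.image f) (P.map (Prod.map f f)) (C.map (Crossing.relabel f)) :=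
  stateSum_eq_of_map f (fun F => by rw [classCount_map hf, Multiset.map_add]) C

/-- Contraction of an edge. -/
theorem stateSum_contract {V : Finset ℕ} {a b : ℕ} (hab : a ≠ b) (ha : a ∈ V) (hb : b ∈ V)
    (P : Multiset (ℕ × ℕ)) (C : Multiset Crossing) : stateSum V ((a, b) ::ₘ P) C =
      stateSum (V.erase b) (P.map (Prod.map (Function.update id b a) (Function.update id b a)))
        (C.map (Crossing.relabel (Function.update id b a))) :=
  stateSum_eq_of_map _ (fun F => by
    rw [Multiset.cons_add, classCount_contract hab ha hb, Multiset.map_add]) C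

/-- The label `b` does not occur among the endpoints of the edges in `P` and the crossings in
`C`. -/
structure Fresh (b : ℕ) (P : Multiset (ℕ × ℕ)) (C : Multiset Crossing) : Prop where
  points : ∀ e ∈ P, e.1 ≠ b ∧ e.2 ≠ b
  crossings : ∀ c ∈ C, c.uin ≠ b ∧ c.uout ≠ b ∧ c.oin ≠ b ∧ c.oout ≠ b

theorem Fresh.map_points {b : ℕ} {P : Multiset (ℕ × ℕ)} {C : Multiset Crossing}
    (h : Fresh b P C) (a : ℕ) :
    P.map (Prod.map (Function.update id b a) (Function.update id b a)) = P := by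
  conv_rhs => rw [← Multiset.map_id P]
  refine Multiset.map_congr rfl fun e he => ?_
  have := h.points e he
  simp [Prod.map, this]

theorem Fresh.map_crossings {b : ℕ} {P : Multiset (ℕ × ℕ)} {C : Multiset Crossing}
    (h : Fresh b P C) (a : ℕ) :
    C.map (Crossing.relabel (Function.update id b a)) = C := by
  conv_rhs => rw [← Multiset.map_id C]
  refine Multiset.map_congr rfl fun c hc => ?_
  have := h.crossings c hc
  simp [Crossing.relabel, this]

theorem Crossing.mem_splitA {c : Crossing} {e : ℕ × ℕ} {b : ℕ}
    (h : c.uin ≠ b ∧ c.uout ≠ b ∧ c.oin ≠ b ∧ c.oout ≠ b) (he : e ∈ c.splitA) :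
    e.1 ≠ b ∧ e.2 ≠ b := by
  simp only [splitA, orientedSplit, disorientedSplit] at he
  split at he <;> simp at he <;> rcases he with rfl | rfl <;> simp [h]

theorem Crossing.mem_splitB {c : Crossing} {e : ℕ × ℕ} {b : ℕ}
    (h : c.uin ≠ b ∧ c.uout ≠ b ∧ c.oin ≠ b ∧ c.oout ≠ b) (he : e ∈ c.splitB) :
    e.1 ≠ b ∧ e.2 ≠ b := by
  simp only [splitB, orientedSplit, disorientedSplit] at he
  split at he <;> simp at he <;> rcases he with rfl | rfl <;> simp [h]

/-- An arc that is joined to nothing is a circle, and contributes a factor. -/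
theorem stateSum_fresh {V : Finset ℕ} {b : ℕ} {P : Multiset (ℕ × ℕ)} {C : Multiset Crossing}
    (h : Fresh b P C) (hb : b ∈ V) (hV : (V.erase b).Nonempty) :
    stateSum V P C = loopValue * stateSum (V.erase b) P C := by
  induction C using Multiset.induction_on generalizing P with
  | empty =>
    have := classCount_pos hV P
    rw [stateSum_zero, stateSum_zero, classCount_fresh hb h.points, ← pow_succ']
    congr 1
    omega
  | cons c C ih =>
    have hc := h.crossings c (Multiset.mem_cons_self _ _)
    have hC : ∀ d ∈ C, _ := fun d hd => h.crossings d (Multiset.mem_cons_of_mem hd)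
    rw [stateSum_cons, stateSum_cons, ih, ih]
    · ring
    · refine ⟨fun e he => ?_, hC⟩
      rcases Multiset.mem_add.1 he with he | he
      · exact c.mem_splitB hc he
      · exact h.points e he
    · refine ⟨fun e he => ?_, hC⟩
      rcases Multiset.mem_add.1 he with he | he
      · exact c.mem_splitA hc he
      · exact h.points e he

theorem classCount_loop {α : Type} (V : Finset α) (x : α) (E : Multiset (α × α)) :
    classCount V ((x, x) ::ₘ E) = classCount V E :=
  classCount_cons_of_conn V (Conn.refl _ _)

theorem stateSum_loop (V : Finset ℕ) (x : ℕ) (P : Multiset (ℕ × ℕ)) (C : Multiset Crossing) :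
    stateSum V ((x, x) ::ₘ P) C = stateSum V P C :=
  stateSum_congr (fun F => by rw [Multiset.cons_add, classCount_loop]) C

/-- Two edges that meet in an arc which is met by nothing else become one edge. -/
theorem stateSum_join {V : Finset ℕ} {x b y : ℕ} {P : Multiset (ℕ × ℕ)} {C : Multiset Crossing}
    (h : Fresh b P C) (hx : x ∈ V) (hb : b ∈ V) (hxb : x ≠ b) (hyb : y ≠ b) :
    stateSum V ((x, b) ::ₘ (b, y) ::ₘ P) C = stateSum (V.erase b) ((x, y) ::ₘ P) C := by
  rw [stateSum_contract hxb hx hb, Multiset.map_cons, h.map_points, h.map_crossings]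
  simp [hyb]

theorem stateSum_revUnder (V : Finset ℕ) (P : Multiset (ℕ × ℕ)) (c : Crossing)
    (C : Multiset Crossing) : stateSum V P (c.revUnder ::ₘ C) = stateSum V P (c ::ₘ C) := by
  rw [stateSum_cons_sign, stateSum_cons_sign, add_comm]
  simp only [Crossing.revUnder, Crossing.orientedSplit, Crossing.disorientedSplit,
    Multiset.insert_eq_cons, Multiset.cons_add, Multiset.singleton_add, Units.val_neg, neg_neg]
  rw [stateSum_swap V c.uout c.oin, Multiset.cons_swap, Multiset.cons_swap (c.uout, c.oout),
    stateSum_swap V c.oin c.uin]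

theorem stateSum_revOver (V : Finset ℕ) (P : Multiset (ℕ × ℕ)) (c : Crossing)
    (C : Multiset Crossing) : stateSum V P (c.revOver ::ₘ C) = stateSum V P (c ::ₘ C) := by
  rw [stateSum_cons_sign, stateSum_cons_sign, add_comm]
  simp only [Crossing.revOver, Crossing.orientedSplit, Crossing.disorientedSplit,
    Multiset.insert_eq_cons, Multiset.cons_add, Multiset.singleton_add, Units.val_neg, neg_neg]
  rw [Multiset.cons_swap, stateSum_swap V c.uout c.oin, Multiset.cons_swap,
    Multiset.cons_swap (c.uin, c.oin), stateSum_swap V c.oout c.uout,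
    Multiset.cons_swap (c.uout, c.oout)]

theorem stateSum_sameUnoriented (V : Finset ℕ) (P : Multiset (ℕ × ℕ)) {c d : Crossing}
    (h : c.SameUnoriented d) (C : Multiset Crossing) :
    stateSum V P (d ::ₘ C) = stateSum V P (c ::ₘ C) := by
  rcases h with rfl | rfl | rfl | rfl
  · rfl
  · exact stateSum_revUnder V P c C
  · exact stateSum_revOver V P c C
  · rw [stateSum_revOver, stateSum_revUnder]

theorem stateSum_rel_points {P Q : Multiset (ℕ × ℕ)}
    (h : Multiset.Rel (fun p q : ℕ × ℕ => q = p ∨ q = p.swap) P Q) (V : Finset ℕ)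
    (C : Multiset Crossing) : stateSum V Q C = stateSum V P C := by
  refine stateSum_congr (fun F => ?_) C
  induction h generalizing F with
  | zero => rfl
  | @cons p q P Q hpq _ ih =>
    have h₁ : classCount V (q ::ₘ Q + F) = classCount V (p ::ₘ Q + F) := by
      rcases hpq with rfl | rfl
      · rfl
      · rw [Multiset.cons_add, Multiset.cons_add]
        exact classCount_swap V _ _ _
    rw [h₁, Multiset.cons_add, Multiset.cons_add, ← Multiset.add_cons, ← Multiset.add_cons, ih]

theorem stateSum_rel_crossings {C C' : Multiset Crossing}
    (h : Multiset.Rel Crossing.SameUnoriented C C') (V : Finset ℕ)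
    (P : Multiset (ℕ × ℕ)) : stateSum V P C' = stateSum V P C := by
  induction h generalizing P with
  | zero => rfl
  | @cons c d C C' hcd _ ih =>
    rw [stateSum_sameUnoriented V P hcd, stateSum_cons, stateSum_cons, ih, ih]

end KnotDiag

/-! ### The state sum under Reidemeister moves -/

namespace KnotDiag

open Diagram (mkCrossing triangle)

section LocalMoves

theorem T_mul_T (m n : ℤ) : (T m * T n : ℤ[T;T⁻¹]) = T (m + n) := (LaurentPolynomial.T_add m n).symm

theorem units_kink (s : ℤˣ) :
    T (s : ℤ) * loopValue + T (-(s : ℤ)) = -T (3 * (s : ℤ)) := by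
  have : (T (s : ℤ) * loopValue : ℤ[T;T⁻¹]) = -T (s + 2 : ℤ) - T (s + -2 : ℤ) := by
    rw [loopValue, mul_sub, mul_neg, T_mul_T, T_mul_T]
  rw [this]
  rcases Int.units_eq_one_or s with rfl | rfl
  · norm_num
  · norm_num
    ring

variable {V : Finset ℕ} {P : Multiset (ℕ × ℕ)} {C : Multiset Crossing}

theorem stateSum_kink {s : ℤˣ} {a b c : ℕ} {d : Crossing}
    (hd : d = mkCrossing s (a, b) (b, c) ∨ d = mkCrossing s (b, c) (a, b))
    (hb : Fresh b P C) (hbV : b ∈ V) (haV : a ∈ V) (hab : a ≠ b) (hcb : c ≠ b) :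
    stateSum V P (d ::ₘ C) = -T (3 * (s : ℤ)) * stateSum (V.erase b) ((a, c) ::ₘ P) C := by
  have h₁ : stateSum V ((a, c) ::ₘ (b, b) ::ₘ P) C =
      loopValue * stateSum (V.erase b) ((a, c) ::ₘ P) C := by
    rw [Multiset.cons_swap, stateSum_loop, stateSum_fresh ?_ hbV ⟨a, Finset.mem_erase.2 ⟨hab, haV⟩⟩]
    refine ⟨?_, hb.crossings⟩
    intro e he
    rcases Multiset.mem_cons.1 he with rfl | he
    · exact ⟨hab, hcb⟩
    · exact hb.points e he
  have h₂ := stateSum_join hb haV hbV hab hcb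
  have hsign : d.sign = s := by rcases hd with rfl | rfl <;> rfl
  have hor : stateSum V (d.orientedSplit + P) C = stateSum V ((a, c) ::ₘ (b, b) ::ₘ P) C := by
    rcases hd with rfl | rfl <;>
      simp only [mkCrossing, Crossing.orientedSplit, Multiset.insert_eq_cons, Multiset.cons_add,
        Multiset.singleton_add]
    rw [Multiset.cons_swap]
  have hdis : stateSum V (d.disorientedSplit + P) C = stateSum V ((a, b) ::ₘ (b, c) ::ₘ P) C := by
    rcases hd with rfl | rfl <;>
      simp only [mkCrossing, Crossing.disorientedSplit, Multiset.insert_eq_cons, Multiset.cons_add,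
        Multiset.singleton_add]
    rw [stateSum_swap, Multiset.cons_swap, stateSum_swap, Multiset.cons_swap]
  rw [stateSum_cons_sign, hor, hdis, hsign, h₁, h₂, ← units_kink]
  ring

theorem Fresh.cons_points {b x y : ℕ} (h : Fresh b P C) (hx : x ≠ b) (hy : y ≠ b) :
    Fresh b ((x, y) ::ₘ P) C := by
  refine ⟨fun e he => ?_, h.crossings⟩
  rcases Multiset.mem_cons.1 he with rfl | he
  · exact ⟨hx, hy⟩
  · exact h.points e he

theorem stateSum_parallel {s : ℤˣ} {a b c x y z : ℕ}
    (hb : Fresh b P C) (hy : Fresh y P C) (hV : {a, b, c, x, y, z} ⊆ V)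
    (hby : b ≠ y) (hb' : a ≠ b ∧ c ≠ b ∧ x ≠ b ∧ z ≠ b) (hy' : a ≠ y ∧ c ≠ y ∧ x ≠ y ∧ z ≠ y) :
    stateSum V P (mkCrossing s (a, b) (x, y) ::ₘ mkCrossing (-s) (b, c) (y, z) ::ₘ C) =
      stateSum ((V.erase b).erase y) ((a, c) ::ₘ (x, z) ::ₘ P) C := by
  obtain ⟨hab, hcb, hxb, hzb⟩ := hb'
  obtain ⟨hay, hcy, hxy, hzy⟩ := hy'
  simp only [Finset.insert_subset_iff, Finset.singleton_subset_iff] at hV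
  obtain ⟨haV, hbV, hcV, hxV, hyV, hzV⟩ := hV
  have hE : ∀ {v}, v ≠ b → v ∈ V → v ∈ V.erase b := fun h h' => Finset.mem_erase.2 ⟨h, h'⟩
  set W := (V.erase b).erase y with hW
  -- both crossings are split along the strands
  have h₁ : stateSum V ((b, z) ::ₘ (y, c) ::ₘ (a, y) ::ₘ (x, b) ::ₘ P) C =
      stateSum W ((a, c) ::ₘ (x, z) ::ₘ P) C := by
    have e₁ : ((b, z) ::ₘ (y, c) ::ₘ (a, y) ::ₘ (x, b) ::ₘ P) =
        (x, b) ::ₘ (b, z) ::ₘ (a, y) ::ₘ (y, c) ::ₘ P := by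
      simp only [← Multiset.singleton_add]; abel
    have e₂ : ((x, z) ::ₘ (a, y) ::ₘ (y, c) ::ₘ P) = (a, y) ::ₘ (y, c) ::ₘ (x, z) ::ₘ P := by
      simp only [← Multiset.singleton_add]; abel
    rw [e₁, stateSum_join ((hb.cons_points hby.symm hcb).cons_points hab hby.symm) hxV hbV hxb hzb,
      e₂, stateSum_join (hy.cons_points hxy hzy) (hE hab haV) (hE hby.symm hyV) hay hcy]
  -- in the three other states the strands `a, x` and `c, z` turn back
  have h₂ : stateSum V ((b, y) ::ₘ (c, z) ::ₘ (a, y) ::ₘ (x, b) ::ₘ P) C =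
      stateSum W ((a, x) ::ₘ (c, z) ::ₘ P) C := by
    have e₁ : ((b, y) ::ₘ (c, z) ::ₘ (a, y) ::ₘ (x, b) ::ₘ P) =
        (x, b) ::ₘ (b, y) ::ₘ (a, y) ::ₘ (c, z) ::ₘ P := by
      simp only [← Multiset.singleton_add]; abel
    rw [e₁, stateSum_join ((hb.cons_points hcb hzb).cons_points hab hby.symm) hxV hbV hxb hby.symm,
      stateSum_swap, Multiset.cons_swap,
      stateSum_join (hy.cons_points hcy hzy) (hE hab haV) (hE hby.symm hyV) hay hxy]
  have h₃ : stateSum V ((b, z) ::ₘ (y, c) ::ₘ (a, x) ::ₘ (b, y) ::ₘ P) C =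
      stateSum W ((a, x) ::ₘ (c, z) ::ₘ P) C := by
    have e₁ : ((z, b) ::ₘ (y, c) ::ₘ (a, x) ::ₘ (b, y) ::ₘ P) =
        (z, b) ::ₘ (b, y) ::ₘ (y, c) ::ₘ (a, x) ::ₘ P := by
      simp only [← Multiset.singleton_add]; abel
    rw [stateSum_swap, e₁,
      stateSum_join ((hb.cons_points hab hxb).cons_points hby.symm hcb) hzV hbV hzb hby.symm,
      stateSum_join (hy.cons_points hay hxy) (hE hzb hzV) (hE hby.symm hyV) hzy hcy, stateSum_swap,
      Multiset.cons_swap]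
  have h₄ : stateSum V ((b, y) ::ₘ (c, z) ::ₘ (a, x) ::ₘ (b, y) ::ₘ P) C =
      loopValue * stateSum W ((a, x) ::ₘ (c, z) ::ₘ P) C := by
    have e₂ : ((b, y) ::ₘ (c, z) ::ₘ (a, x) ::ₘ (b, y) ::ₘ P) =
        (b, y) ::ₘ (b, y) ::ₘ (a, x) ::ₘ (c, z) ::ₘ P := by
      simp only [← Multiset.singleton_add]; abel
    rw [e₂, stateSum_swap,
      stateSum_join ((hb.cons_points hcb hzb).cons_points hab hxb) hyV hbV hby.symm hby.symm,
      stateSum_loop, stateSum_fresh ((hy.cons_points hcy hzy).cons_points hay hxy)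
        (hE hby.symm hyV) ⟨a, Finset.mem_erase.2 ⟨hay, hE hab haV⟩⟩]
  rw [stateSum_cons_sign, stateSum_cons_sign, stateSum_cons_sign]
  simp only [mkCrossing, Crossing.orientedSplit, Crossing.disorientedSplit,
    Multiset.insert_eq_cons, Multiset.cons_add, Multiset.singleton_add, Units.val_neg, neg_neg]
  rw [h₁, h₂, h₃, h₄, loopValue]
  have hs : (T (s : ℤ) * T (-(s : ℤ)) : ℤ[T;T⁻¹]) = 1 := by
    rw [T_mul_T, add_neg_cancel, LaurentPolynomial.T_zero]
  have hs2 : (T (s : ℤ) * T (s : ℤ) + T (-(s : ℤ)) * T (-(s : ℤ)) : ℤ[T;T⁻¹]) = T 2 + T (-2) := by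
    rw [T_mul_T, T_mul_T]
    rcases Int.units_eq_one_or s with rfl | rfl
    · norm_num
    · norm_num [add_comm]
  linear_combination (stateSum W ((a, c) ::ₘ (x, z) ::ₘ P) C +
    (-T 2 - T (-2)) * stateSum W ((a, x) ::ₘ (c, z) ::ₘ P) C) * hs +
    stateSum W ((a, x) ::ₘ (c, z) ::ₘ P) C * hs2

theorem stateSum_antiparallel {s : ℤˣ} {a b c x y z : ℕ}
    (hb : Fresh b P C) (hy : Fresh y P C) (hV : {a, b, c, x, y, z} ⊆ V)
    (hby : b ≠ y) (hb' : a ≠ b ∧ c ≠ b ∧ x ≠ b ∧ z ≠ b) (hy' : a ≠ y ∧ c ≠ y ∧ x ≠ y ∧ z ≠ y) :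
    stateSum V P (mkCrossing s (a, b) (y, z) ::ₘ mkCrossing (-s) (b, c) (x, y) ::ₘ C) =
      stateSum ((V.erase b).erase y) ((a, c) ::ₘ (x, z) ::ₘ P) C := by
  have h := stateSum_parallel (V := V) (s := -s) (a := a) (c := c) (x := z) (z := x) hb hy
    (by rw [Finset.insert_subset_iff] at hV ⊢
        simp only [Finset.insert_subset_iff, Finset.singleton_subset_iff] at hV ⊢
        tauto) hby (by tauto) (by tauto)
  rw [Multiset.cons_swap (a, c), stateSum_swap, Multiset.cons_swap (x, z)] at h
  rw [← h, ← stateSum_revOver, Multiset.cons_swap, ← stateSum_revOver, Multiset.cons_swap]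
  simp only [mkCrossing, Crossing.revOver]

/-- The labels inside of the triangle of the third move. -/
structure TriangleFresh (V : Finset ℕ) (t₁ t₂ t₃ m₁ m₂ m₃ b₁ b₂ b₃ : ℕ) (P : Multiset (ℕ × ℕ))
    (C : Multiset Crossing) : Prop where
  subset : {t₁, t₂, t₃, m₁, m₂, m₃, b₁, b₂, b₃} ⊆ V
  fresh_t : Fresh t₂ P C
  fresh_m : Fresh m₂ P C
  fresh_b : Fresh b₂ P C
  ne_tm : t₂ ≠ m₂
  ne_tb : t₂ ≠ b₂
  ne_mb : m₂ ≠ b₂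
  ne_t : t₁ ≠ t₂ ∧ t₃ ≠ t₂ ∧ m₁ ≠ t₂ ∧ m₃ ≠ t₂ ∧ b₁ ≠ t₂ ∧ b₃ ≠ t₂
  ne_m : t₁ ≠ m₂ ∧ t₃ ≠ m₂ ∧ m₁ ≠ m₂ ∧ m₃ ≠ m₂ ∧ b₁ ≠ m₂ ∧ b₃ ≠ m₂
  ne_b : t₁ ≠ b₂ ∧ t₃ ≠ b₂ ∧ m₁ ≠ b₂ ∧ m₃ ≠ b₂ ∧ b₁ ≠ b₂ ∧ b₃ ≠ b₂

variable {t₁ t₂ t₃ m₁ m₂ m₃ b₁ b₂ b₃ : ℕ}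

/-- The third move with all strands running in the standard direction: the crossing of the middle
and the bottom strand is split. In one state the top strand crosses two strands in a position that
is the same on both sides; in the other it can be pulled away by a second move on both sides. -/
theorem stateSum_triangle_one (ε : ℤˣ) (h : TriangleFresh V t₁ t₂ t₃ m₁ m₂ m₃ b₁ b₂ b₃ P C) :
    stateSum V P (triangle 1 1 1 ε t₁ t₂ t₃ m₁ m₂ m₃ b₁ b₂ b₃ + C) =
      stateSum V P (triangle (-1) (-1) (-1) ε t₁ t₂ t₃ m₁ m₂ m₃ b₁ b₂ b₃ + C) := by
  obtain ⟨hV, ft, fm, fb, htm, htb, hmb, ⟨t1, t2, t3, t4, t5, t6⟩, ⟨k1, k2, k3, k4, k5, k6⟩,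
    ⟨l1, l2, l3, l4, l5, l6⟩⟩ := h
  simp only [Finset.insert_subset_iff, Finset.singleton_subset_iff] at hV
  obtain ⟨v1, v2, v3, v4, v5, v6, v7, v8, v9⟩ := hV
  have hne : ¬ (-1 : ℤˣ) = 1 := by decide
  have eL : triangle 1 1 1 ε t₁ t₂ t₃ m₁ m₂ m₃ b₁ b₂ b₃ + C =
      mkCrossing ε (b₂, b₃) (m₂, m₃) ::ₘ mkCrossing ε (m₁, m₂) (t₁, t₂) ::ₘ
        mkCrossing ε (b₁, b₂) (t₂, t₃) ::ₘ C := by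
    simp only [triangle, Diagram.pass, if_true, if_neg hne, mul_one, Multiset.insert_eq_cons,
      ← Multiset.singleton_add]
    abel
  have eR : triangle (-1) (-1) (-1) ε t₁ t₂ t₃ m₁ m₂ m₃ b₁ b₂ b₃ + C =
      mkCrossing ε (b₁, b₂) (m₁, m₂) ::ₘ mkCrossing ε (m₂, m₃) (t₂, t₃) ::ₘ
        mkCrossing ε (b₂, b₃) (t₁, t₂) ::ₘ C := by
    simp only [triangle, Diagram.pass, if_true, if_neg hne, mul_neg, mul_one, neg_neg,
      Multiset.insert_eq_cons, ← Multiset.singleton_add]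
    abel
  have hE : ∀ {v}, v ≠ b₂ → v ∈ V → v ∈ V.erase b₂ := fun h h' => Finset.mem_erase.2 ⟨h, h'⟩
  have upd : ∀ x y, Function.update id b₂ x y = if y = b₂ then x else y := fun x y => by
    rw [Function.update_apply]; rfl
  have upm : ∀ x y, Function.update id m₂ x y = if y = m₂ then x else y := fun x y => by
    rw [Function.update_apply]; rfl
  rw [eL, eR, stateSum_cons_sign, stateSum_cons_sign V P (mkCrossing ε (b₁, b₂) (m₁, m₂))]
  simp only [mkCrossing, Crossing.orientedSplit, Crossing.disorientedSplit,
    Multiset.insert_eq_cons, Multiset.cons_add, Multiset.singleton_add]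
  congr 2
  · have eL : stateSum V ((b₂, m₃) ::ₘ (m₂, b₃) ::ₘ P)
        (⟨ε, m₁, m₂, t₁, t₂⟩ ::ₘ ⟨ε, b₁, b₂, t₂, t₃⟩ ::ₘ C) =
        stateSum ((V.erase b₂).erase m₂) P
          (⟨ε, m₁, b₃, t₁, t₂⟩ ::ₘ ⟨ε, b₁, m₃, t₂, t₃⟩ ::ₘ C) := by
      rw [stateSum_swap, stateSum_contract l4 v6 v8]
      simp only [Multiset.map_cons, fb.map_points, fb.map_crossings]
      simp only [Prod.map_apply, Crossing.relabel, upd, l1, l2, l3, l5, l6, hmb, htb, if_true,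
        if_false]
      rw [stateSum_swap, stateSum_contract k6 (hE l6 v9) (hE hmb v5)]
      simp only [Multiset.map_cons, fm.map_points, fm.map_crossings]
      simp only [Crossing.relabel, upm, k1, k2, k3, k4, k5, htm, if_true, if_false]
    have eR : stateSum V ((b₁, m₂) ::ₘ (m₁, b₂) ::ₘ P)
        (⟨ε, m₂, m₃, t₂, t₃⟩ ::ₘ ⟨ε, b₂, b₃, t₁, t₂⟩ ::ₘ C) =
        stateSum ((V.erase b₂).erase m₂) P
          (⟨ε, b₁, m₃, t₂, t₃⟩ ::ₘ ⟨ε, m₁, b₃, t₁, t₂⟩ ::ₘ C) := by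
      rw [Multiset.cons_swap, stateSum_contract l3 v4 v8]
      simp only [Multiset.map_cons, fb.map_points, fb.map_crossings]
      simp only [Prod.map_apply, Crossing.relabel, upd, l1, l2, l4, l5, l6, hmb, htb, if_true,
        if_false]
      rw [stateSum_contract k5 (hE l5 v7) (hE hmb v5)]
      simp only [Multiset.map_cons, fm.map_points, fm.map_crossings]
      simp only [Crossing.relabel, upm, k1, k2, k3, k4, k6, htm, if_true, if_false]
    rw [eL, eR, Multiset.cons_swap]
  · have eL : stateSum V ((b₂, m₂) ::ₘ (b₃, m₃) ::ₘ P)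
        (⟨ε, m₁, m₂, t₁, t₂⟩ ::ₘ ⟨ε, b₁, b₂, t₂, t₃⟩ ::ₘ C) =
        stateSum (((V.erase b₂).erase m₂).erase t₂)
          ((m₁, b₁) ::ₘ (t₁, t₃) ::ₘ (b₃, m₃) ::ₘ P) C := by
      rw [stateSum_swap, stateSum_contract hmb v5 v8]
      simp only [Multiset.map_cons, fb.map_points, fb.map_crossings]
      simp only [Prod.map_apply, Crossing.relabel, upd, l1, l2, l3, l4, l5, l6, hmb, htb, if_true,
        if_false]
      rw [Multiset.cons_swap, ← stateSum_revUnder, Multiset.cons_swap]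
      exact stateSum_parallel (fm.cons_points k6 k4) (ft.cons_points t6 t4)
        (by simp only [Finset.insert_subset_iff, Finset.singleton_subset_iff]
            exact ⟨hE l3 v4, hE hmb v5, hE l5 v7, hE l1 v1, hE htb v2, hE l2 v3⟩)
        htm.symm ⟨k3, k5, k1, k2⟩ ⟨t3, t5, t1, t2⟩
    have eR : stateSum V ((b₁, m₁) ::ₘ (b₂, m₂) ::ₘ P)
        (⟨ε, m₂, m₃, t₂, t₃⟩ ::ₘ ⟨ε, b₂, b₃, t₁, t₂⟩ ::ₘ C) =
        stateSum (((V.erase b₂).erase m₂).erase t₂)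
          ((b₃, m₃) ::ₘ (t₁, t₃) ::ₘ (b₁, m₁) ::ₘ P) C := by
      rw [Multiset.cons_swap, stateSum_swap, stateSum_contract hmb v5 v8]
      simp only [Multiset.map_cons, fb.map_points, fb.map_crossings]
      simp only [Prod.map_apply, Crossing.relabel, upd, l1, l2, l3, l4, l5, l6, hmb, htb, if_true,
        if_false]
      rw [Multiset.cons_swap, ← stateSum_revUnder]
      have := stateSum_parallel (V := V.erase b₂) (s := -ε) (a := b₃) (c := m₃) (x := t₁) (z := t₃)
        (fm.cons_points k5 k3) (ft.cons_points t5 t3)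
        (by simp only [Finset.insert_subset_iff, Finset.singleton_subset_iff]
            exact ⟨hE l6 v9, hE hmb v5, hE l4 v6, hE l1 v1, hE htb v2, hE l2 v3⟩)
        htm.symm ⟨k6, k4, k1, k2⟩ ⟨t6, t4, t1, t2⟩
      rw [neg_neg] at this
      exact this
    have e₁ : ((b₁, m₁) ::ₘ (t₁, t₃) ::ₘ (b₃, m₃) ::ₘ P) =
        (b₃, m₃) ::ₘ (t₁, t₃) ::ₘ (b₁, m₁) ::ₘ P := by
      simp only [← Multiset.singleton_add]; abel
    rw [eL, eR, stateSum_swap, e₁]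

theorem Crossing.sameUnoriented_refl (c : Crossing) : c.SameUnoriented c := Or.inl rfl

theorem pass_neg (k : ℤˣ) (x m y : ℕ) : Diagram.pass (-k) y m x = (Diagram.pass k x m y).swap := by
  rcases Int.units_eq_one_or k with rfl | rfl <;> simp [Diagram.pass]

theorem sameUnoriented_swap_over (s : ℤˣ) (u o : ℕ × ℕ) :
    (mkCrossing s u o).SameUnoriented (mkCrossing (-s) u o.swap) := Or.inr (Or.inr (Or.inl rfl))

theorem sameUnoriented_swap_under (s : ℤˣ) (u o : ℕ × ℕ) :
    (mkCrossing s u o).SameUnoriented (mkCrossing (-s) u.swap o) := Or.inr (Or.inl rfl)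

theorem stateSum_of_rel_three {c d e c' d' e' : Crossing} (hc : c.SameUnoriented c')
    (hd : d.SameUnoriented d') (he : e.SameUnoriented e') :
    stateSum V P ({c', d', e'} + C) = stateSum V P ({c, d, e} + C) :=
  stateSum_rel_crossings (Multiset.Rel.add (Multiset.Rel.cons hc (Multiset.Rel.cons hd
    (Multiset.Rel.cons he Multiset.Rel.zero)))
    (Multiset.rel_refl_of_refl_on fun c _ => c.sameUnoriented_refl)) V P

theorem stateSum_triangle_neg_top (α β γ ε : ℤˣ) :
    stateSum V P (triangle (-α) β γ ε t₃ t₂ t₁ m₁ m₂ m₃ b₁ b₂ b₃ + C) =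
      stateSum V P (triangle α β γ ε t₁ t₂ t₃ m₁ m₂ m₃ b₁ b₂ b₃ + C) := by
  simp only [triangle, pass_neg, mul_neg, neg_mul]
  exact stateSum_of_rel_three (sameUnoriented_swap_over _ _ _) (sameUnoriented_swap_over _ _ _)
    (Crossing.sameUnoriented_refl _)

theorem stateSum_triangle_neg_middle (α β γ ε : ℤˣ) :
    stateSum V P (triangle α (-β) γ ε t₁ t₂ t₃ m₃ m₂ m₁ b₁ b₂ b₃ + C) =
      stateSum V P (triangle α β γ ε t₁ t₂ t₃ m₁ m₂ m₃ b₁ b₂ b₃ + C) := by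
  simp only [triangle, pass_neg, mul_neg, neg_mul]
  exact stateSum_of_rel_three (sameUnoriented_swap_under _ _ _) (Crossing.sameUnoriented_refl _)
    (sameUnoriented_swap_over _ _ _)

theorem stateSum_triangle_neg_bottom (α β γ ε : ℤˣ) :
    stateSum V P (triangle α β (-γ) ε t₁ t₂ t₃ m₁ m₂ m₃ b₃ b₂ b₁ + C) =
      stateSum V P (triangle α β γ ε t₁ t₂ t₃ m₁ m₂ m₃ b₁ b₂ b₃ + C) := by
  simp only [triangle, pass_neg, mul_neg]
  exact stateSum_of_rel_three (Crossing.sameUnoriented_refl _) (sameUnoriented_swap_under _ _ _)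
    (sameUnoriented_swap_under _ _ _)

theorem stateSum_triangle (α β γ ε : ℤˣ)
    (h : TriangleFresh V t₁ t₂ t₃ m₁ m₂ m₃ b₁ b₂ b₃ P C) :
    stateSum V P (triangle α β γ ε t₁ t₂ t₃ m₁ m₂ m₃ b₁ b₂ b₃ + C) =
      stateSum V P (triangle (-α) (-β) (-γ) ε t₁ t₂ t₃ m₁ m₂ m₃ b₁ b₂ b₃ + C) := by
  have hsub := h.subset
  simp only [Finset.insert_subset_iff, Finset.singleton_subset_iff] at hsub
  -- reversal of strands reduces to the case of three positive signs
  wlog hα : α = 1 generalizing α t₁ t₃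
  · have hα' : -α = 1 := by rcases Int.units_eq_one_or α with rfl | rfl <;> simp_all
    rw [← stateSum_triangle_neg_top α, ← stateSum_triangle_neg_top (-α) (-β) (-γ)]
    refine this (-α) ?_ (by tauto) hα'
    obtain ⟨_, h1, h2, h3, h4, h5, h6, h7, h8, h9⟩ := h
    exact ⟨by simp only [Finset.insert_subset_iff, Finset.singleton_subset_iff]; tauto,
      h1, h2, h3, h4, h5, h6, by tauto, by tauto, by tauto⟩
  wlog hβ : β = 1 generalizing β m₁ m₃
  · have hβ' : -β = 1 := by rcases Int.units_eq_one_or β with rfl | rfl <;> simp_all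
    rw [← stateSum_triangle_neg_middle _ β, ← stateSum_triangle_neg_middle (-α) (-β) (-γ)]
    refine this (-β) ?_ (by tauto) hβ'
    obtain ⟨_, h1, h2, h3, h4, h5, h6, h7, h8, h9⟩ := h
    exact ⟨by simp only [Finset.insert_subset_iff, Finset.singleton_subset_iff]; tauto,
      h1, h2, h3, h4, h5, h6, by tauto, by tauto, by tauto⟩
  wlog hγ : γ = 1 generalizing γ b₁ b₃
  · have hγ' : -γ = 1 := by rcases Int.units_eq_one_or γ with rfl | rfl <;> simp_all
    rw [← stateSum_triangle_neg_bottom _ _ γ, ← stateSum_triangle_neg_bottom (-α) (-β) (-γ)]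
    refine this (-γ) ?_ (by tauto) hγ'
    obtain ⟨_, h1, h2, h3, h4, h5, h6, h7, h8, h9⟩ := h
    exact ⟨by simp only [Finset.insert_subset_iff, Finset.singleton_subset_iff]; tauto,
      h1, h2, h3, h4, h5, h6, by tauto, by tauto, by tauto⟩
  subst hα hβ hγ
  exact stateSum_triangle_one ε h

end LocalMoves

end KnotDiag

/-! ### Invariance of the normalized bracket -/

namespace KnotDiag

namespace Diagram

variable {P : Multiset (ℕ × ℕ)} {C : Multiset Crossing}

/-- Every arc begins once and ends once. -/
structure Proper (D : Diagram) : Prop where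
  nodup : D.ins.Nodup
  ins_eq : D.ins = D.outs

theorem IsKnotDiagram.proper {D : Diagram} (h : D.IsKnotDiagram) : D.Proper := ⟨h.1, h.2.1⟩

theorem ins_cons_crossing (c : Crossing) :
    ins ⟨P, c ::ₘ C⟩ = c.uin ::ₘ c.oin ::ₘ ins ⟨P, C⟩ := by
  simp [ins, Multiset.cons_swap]

theorem outs_cons_crossing (c : Crossing) :
    outs ⟨P, c ::ₘ C⟩ = c.uout ::ₘ c.oout ::ₘ outs ⟨P, C⟩ := by
  simp [outs, Multiset.cons_swap]

theorem ins_cons_point (e : ℕ × ℕ) : ins ⟨e ::ₘ P, C⟩ = e.1 ::ₘ ins ⟨P, C⟩ := by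
  simp [ins]

theorem outs_cons_point (e : ℕ × ℕ) : outs ⟨e ::ₘ P, C⟩ = e.2 ::ₘ outs ⟨P, C⟩ := by
  simp [outs]

theorem ins_relabel (f : ℕ → ℕ) (D : Diagram) : (D.relabel f).ins = D.ins.map f := by
  simp [ins, relabel, Multiset.map_map, Function.comp_def, Crossing.relabel]

theorem writhe_cons (c : Crossing) :
    writhe ⟨P, c ::ₘ C⟩ = c.sign + writhe ⟨P, C⟩ := by
  simp [writhe]

theorem writhe_points (Q : Multiset (ℕ × ℕ)) : writhe ⟨P, C⟩ = writhe ⟨Q, C⟩ := rfl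

theorem writhe_relabel (f : ℕ → ℕ) (D : Diagram) : (D.relabel f).writhe = D.writhe := by
  simp [writhe, relabel, Multiset.map_map, Function.comp_def, Crossing.relabel]

theorem fresh_of_notMem {b : ℕ} (hi : b ∉ ins ⟨P, C⟩) (ho : b ∉ outs ⟨P, C⟩) : Fresh b P C := by
  simp only [ins, outs, Multiset.mem_add, Multiset.mem_map, not_or, not_exists, not_and] at hi ho
  exact ⟨fun e he => ⟨hi.1.1 e he, ho.1.1 e he⟩,
    fun c hc => ⟨hi.1.2 c hc, ho.1.2 c hc, hi.2 c hc, ho.2 c hc⟩⟩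

theorem mem_arcs {D : Diagram} {a : ℕ} : a ∈ D.arcs ↔ a ∈ D.ins := Multiset.mem_toFinset

theorem Proper.mem_arcs_of_mem_outs {D : Diagram} (h : D.Proper) {a : ℕ} (ha : a ∈ D.outs) :
    a ∈ D.arcs := by
  rw [mem_arcs, h.ins_eq]
  exact ha

theorem Proper.nodup_outs {D : Diagram} (h : D.Proper) : D.outs.Nodup := h.ins_eq ▸ h.nodup

/-- The Kauffman bracket, normalized by the writhe. -/
noncomputable def normBracket (D : Diagram) : ℤ[T;T⁻¹] :=
  ((D.writhe.negOnePow : ℤˣ) : ℤ) • (T (-3 * D.writhe) * D.bracket)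

theorem hasJones_iff {D : Diagram} {V : ℤ[T;T⁻¹]} : D.HasJones V ↔
    AddMonoidAlgebra.mapDomain (fun n : ℤ => -4 * n) V = D.normBracket := Iff.rfl

theorem normBracket_congr {D E : Diagram} (hw : D.writhe = E.writhe) (hb : D.bracket = E.bracket) :
    D.normBracket = E.normBracket := by
  rw [normBracket, normBracket, hw, hb]

theorem normBracket_relabel {f : ℕ → ℕ} (hf : Function.Injective f) (D : Diagram) :
    (D.relabel f).normBracket = D.normBracket := by
  refine normBracket_congr (writhe_relabel f D) ?_
  rw [bracket_eq_stateSum, bracket_eq_stateSum, stateSum_map_of_injective hf D.arcs]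
  congr 1
  rw [arcs, ins_relabel, arcs, Multiset.toFinset_map]

theorem normBracket_point {a b : ℕ} (hab : a ≠ b) (h : Proper ⟨(a, b) ::ₘ P, C⟩) :
    (relabel (Function.update id b a) ⟨P, C⟩).normBracket =
      normBracket ⟨(a, b) ::ₘ P, C⟩ := by
  have hn := h.nodup
  rw [ins_cons_point, Multiset.nodup_cons] at hn
  have ha : a ∈ arcs ⟨(a, b) ::ₘ P, C⟩ := by simp [mem_arcs, ins_cons_point]
  have hb : b ∈ arcs ⟨(a, b) ::ₘ P, C⟩ :=
    h.mem_arcs_of_mem_outs (by simp [outs_cons_point])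
  refine normBracket_congr (writhe_relabel _ _) ?_
  rw [bracket_eq_stateSum, bracket_eq_stateSum, stateSum_contract hab ha hb]
  congr 1
  have hb' : b ∈ ins ⟨P, C⟩ := by
    rw [mem_arcs, ins_cons_point] at hb
    exact (Multiset.mem_cons.1 hb).resolve_left hab.symm
  ext x
  rw [mem_arcs, ins_relabel, Multiset.mem_map, Finset.mem_erase, mem_arcs, ins_cons_point,
    Multiset.mem_cons]
  constructor
  · rintro ⟨y, hy, rfl⟩
    by_cases hyb : y = b
    · subst hyb
      simp [hab]
    · simp [hyb, hy]
  · rintro ⟨hxb, rfl | hx⟩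
    · exact ⟨b, hb', by simp⟩
    · exact ⟨x, hx, by simp [hxb]⟩

theorem negOnePow_sign (s : ℤˣ) : (s : ℤ).negOnePow = -1 := by
  rcases Int.units_eq_one_or s with rfl | rfl <;> simp

theorem normBracket_kink {s : ℤˣ} {a b c : ℕ} {d : Crossing}
    (hd : d = mkCrossing s (a, b) (b, c) ∨ d = mkCrossing s (b, c) (a, b))
    (h : Proper ⟨P, d ::ₘ C⟩) :
    normBracket ⟨P, d ::ₘ C⟩ = normBracket ⟨(a, c) ::ₘ P, C⟩ := by
  have hi : ins ⟨P, d ::ₘ C⟩ = a ::ₘ b ::ₘ ins ⟨P, C⟩ := by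
    rcases hd with rfl | rfl <;> simp [ins_cons_crossing, mkCrossing, Multiset.cons_swap]
  have ho : outs ⟨P, d ::ₘ C⟩ = b ::ₘ c ::ₘ outs ⟨P, C⟩ := by
    rcases hd with rfl | rfl <;> simp [outs_cons_crossing, mkCrossing, Multiset.cons_swap]
  have hsign : d.sign = s := by rcases hd with rfl | rfl <;> rfl
  have h₁ := h.nodup
  have h₂ := h.nodup_outs
  simp only [hi, ho, Multiset.nodup_cons, Multiset.mem_cons, not_or] at h₁ h₂
  have harcs : arcs ⟨(a, c) ::ₘ P, C⟩ = (arcs ⟨P, d ::ₘ C⟩).erase b := by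
    ext x
    simp only [Finset.mem_erase, mem_arcs, hi, ins_cons_point, Multiset.mem_cons]
    constructor
    · rintro (rfl | hx)
      · exact ⟨h₁.1.1, Or.inl rfl⟩
      · exact ⟨fun hxb => h₁.2.1 (hxb ▸ hx), Or.inr (Or.inr hx)⟩
    · tauto
  have hbr := stateSum_kink (V := arcs ⟨P, d ::ₘ C⟩) hd (fresh_of_notMem h₁.2.1 h₂.1.2)
    (by simp [mem_arcs, hi]) (by simp [mem_arcs, hi]) h₁.1.1 (Ne.symm h₂.1.1)
  rw [normBracket, normBracket, bracket_eq_stateSum, bracket_eq_stateSum, harcs, hbr, writhe_cons,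
    hsign, Int.negOnePow_add, negOnePow_sign, writhe_points (C := C) ((a, c) ::ₘ P), mul_add,
    LaurentPolynomial.T_add]
  have : (T (-(3 * (s : ℤ))) * T (3 * (s : ℤ)) : ℤ[T;T⁻¹]) = 1 := by
    rw [T_mul_T, neg_add_cancel, LaurentPolynomial.T_zero]
  simp only [Units.val_neg, neg_mul, one_mul, neg_smul, mul_neg,
    smul_neg, neg_neg]
  congr 1
  linear_combination (T (-(3 * writhe ⟨(a, c) ::ₘ P, C⟩)) *
    stateSum ((arcs ⟨P, d ::ₘ C⟩).erase b) ((a, c) ::ₘ P) C) * this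

theorem normBracket_two {s : ℤˣ} {a b c x y z : ℕ} {d e : Crossing}
    (hde : (d = mkCrossing s (a, b) (x, y) ∧ e = mkCrossing (-s) (b, c) (y, z)) ∨
      (d = mkCrossing s (a, b) (y, z) ∧ e = mkCrossing (-s) (b, c) (x, y)))
    (h : Proper ⟨P, d ::ₘ e ::ₘ C⟩) :
    normBracket ⟨P, d ::ₘ e ::ₘ C⟩ = normBracket ⟨(a, c) ::ₘ (x, z) ::ₘ P, C⟩ := by
  have hi : ins ⟨P, d ::ₘ e ::ₘ C⟩ = a ::ₘ b ::ₘ x ::ₘ y ::ₘ ins ⟨P, C⟩ := by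
    rcases hde with ⟨rfl, rfl⟩ | ⟨rfl, rfl⟩ <;>
      simp only [ins_cons_crossing] <;> simp only [mkCrossing, ← Multiset.singleton_add] <;> abel
  have ho : outs ⟨P, d ::ₘ e ::ₘ C⟩ = b ::ₘ c ::ₘ y ::ₘ z ::ₘ outs ⟨P, C⟩ := by
    rcases hde with ⟨rfl, rfl⟩ | ⟨rfl, rfl⟩ <;>
      simp only [outs_cons_crossing] <;> simp only [mkCrossing, ← Multiset.singleton_add] <;> abel
  have h₁ := h.nodup
  have h₂ := h.nodup_outs
  have hmi : ∀ v, v ∈ arcs ⟨P, d ::ₘ e ::ₘ C⟩ ↔ v ∈ a ::ₘ b ::ₘ x ::ₘ y ::ₘ ins ⟨P, C⟩ := by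
    intro v
    rw [mem_arcs, hi]
  have hmo : ∀ v ∈ b ::ₘ c ::ₘ y ::ₘ z ::ₘ outs ⟨P, C⟩, v ∈ arcs ⟨P, d ::ₘ e ::ₘ C⟩ :=
    fun v hv => h.mem_arcs_of_mem_outs (ho ▸ hv)
  simp only [hi, ho, Multiset.nodup_cons, Multiset.mem_cons, not_or] at h₁ h₂
  obtain ⟨⟨a1, a2, a3, a4⟩, ⟨a5, a6, a7⟩, ⟨a8, a9⟩, a10, a11⟩ := h₁
  obtain ⟨⟨b1, b2, b3, b4⟩, ⟨b5, b6, b7⟩, ⟨b8, b9⟩, b10, b11⟩ := h₂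
  have harcs : arcs ⟨(a, c) ::ₘ (x, z) ::ₘ P, C⟩ =
      ((arcs ⟨P, d ::ₘ e ::ₘ C⟩).erase b).erase y := by
    ext v
    simp only [Finset.mem_erase, hmi]
    simp only [mem_arcs, ins_cons_point, Multiset.mem_cons]
    constructor
    · rintro (rfl | rfl | hv)
      · exact ⟨a3, a1, Or.inl rfl⟩
      · exact ⟨a8, Ne.symm a5, Or.inr (Or.inr (Or.inl rfl))⟩
      · exact ⟨fun h => a10 (h ▸ hv), fun h => a7 (h ▸ hv), Or.inr (Or.inr (Or.inr (Or.inr hv)))⟩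
    · tauto
  have hsub : {a, b, c, x, y, z} ⊆ arcs ⟨P, d ::ₘ e ::ₘ C⟩ := by
    simp only [Finset.insert_subset_iff, Finset.singleton_subset_iff]
    refine ⟨?_, ?_, hmo _ ?_, ?_, ?_, hmo _ ?_⟩ <;> simp [hmi]
  have hb := fresh_of_notMem a7 b4
  have hy := fresh_of_notMem a10 b9
  refine normBracket_congr ?_ ?_
  · rw [writhe_cons, writhe_cons]
    rcases hde with ⟨rfl, rfl⟩ | ⟨rfl, rfl⟩ <;> simp [mkCrossing, writhe]
  · rw [bracket_eq_stateSum, bracket_eq_stateSum, harcs]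
    rcases hde with ⟨rfl, rfl⟩ | ⟨rfl, rfl⟩
    · exact stateSum_parallel hb hy hsub a6 ⟨a1, Ne.symm b1, Ne.symm a5, Ne.symm b3⟩
        ⟨a3, b5, a8, Ne.symm b8⟩
    · exact stateSum_antiparallel hb hy hsub a6 ⟨a1, Ne.symm b1, Ne.symm a5, Ne.symm b3⟩
        ⟨a3, b5, a8, Ne.symm b8⟩

theorem ins_triangle (α β γ ε : ℤˣ) (t₁ t₂ t₃ m₁ m₂ m₃ b₁ b₂ b₃ : ℕ) :
    ins ⟨P, triangle α β γ ε t₁ t₂ t₃ m₁ m₂ m₃ b₁ b₂ b₃ + C⟩ =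
      t₁ ::ₘ t₂ ::ₘ m₁ ::ₘ m₂ ::ₘ b₁ ::ₘ b₂ ::ₘ ins ⟨P, C⟩ := by
  simp only [triangle, Multiset.insert_eq_cons, Multiset.cons_add, Multiset.singleton_add,
    ins_cons_crossing, mkCrossing]
  rcases Int.units_eq_one_or α with rfl | rfl <;> rcases Int.units_eq_one_or β with rfl | rfl <;>
    rcases Int.units_eq_one_or γ with rfl | rfl <;>
    simp only [pass, neg_neg, if_true, show ¬ (-1 : ℤˣ) = 1 by decide, if_false,
      ← Multiset.singleton_add] <;> abel

theorem outs_triangle (α β γ ε : ℤˣ) (t₁ t₂ t₃ m₁ m₂ m₃ b₁ b₂ b₃ : ℕ) :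
    outs ⟨P, triangle α β γ ε t₁ t₂ t₃ m₁ m₂ m₃ b₁ b₂ b₃ + C⟩ =
      t₂ ::ₘ t₃ ::ₘ m₂ ::ₘ m₃ ::ₘ b₂ ::ₘ b₃ ::ₘ outs ⟨P, C⟩ := by
  simp only [triangle, Multiset.insert_eq_cons, Multiset.cons_add, Multiset.singleton_add,
    outs_cons_crossing, mkCrossing]
  rcases Int.units_eq_one_or α with rfl | rfl <;> rcases Int.units_eq_one_or β with rfl | rfl <;>
    rcases Int.units_eq_one_or γ with rfl | rfl <;>
    simp only [pass, neg_neg, if_true, show ¬ (-1 : ℤˣ) = 1 by decide, if_false,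
      ← Multiset.singleton_add] <;> abel

theorem normBracket_triangle {α β γ ε : ℤˣ} {t₁ t₂ t₃ m₁ m₂ m₃ b₁ b₂ b₃ : ℕ}
    (h : Proper ⟨P, triangle α β γ ε t₁ t₂ t₃ m₁ m₂ m₃ b₁ b₂ b₃ + C⟩) :
    normBracket ⟨P, triangle α β γ ε t₁ t₂ t₃ m₁ m₂ m₃ b₁ b₂ b₃ + C⟩ =
      normBracket ⟨P, triangle (-α) (-β) (-γ) ε t₁ t₂ t₃ m₁ m₂ m₃ b₁ b₂ b₃ + C⟩ := by
  set D : Diagram := ⟨P, triangle α β γ ε t₁ t₂ t₃ m₁ m₂ m₃ b₁ b₂ b₃ + C⟩ with hD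
  have hi : D.ins = _ := ins_triangle α β γ ε t₁ t₂ t₃ m₁ m₂ m₃ b₁ b₂ b₃
  have ho : D.outs = _ := outs_triangle α β γ ε t₁ t₂ t₃ m₁ m₂ m₃ b₁ b₂ b₃
  have harcs : arcs ⟨P, triangle (-α) (-β) (-γ) ε t₁ t₂ t₃ m₁ m₂ m₃ b₁ b₂ b₃ + C⟩ = D.arcs := by
    rw [arcs, arcs, hi, ins_triangle]
  have h₁ := h.nodup
  have h₂ := h.nodup_outs
  have hmi : ∀ v ∈ t₁ ::ₘ t₂ ::ₘ m₁ ::ₘ m₂ ::ₘ b₁ ::ₘ b₂ ::ₘ ins ⟨P, C⟩, v ∈ D.arcs :=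
    fun v hv => mem_arcs.2 (hi ▸ hv)
  have hmo : ∀ v ∈ t₂ ::ₘ t₃ ::ₘ m₂ ::ₘ m₃ ::ₘ b₂ ::ₘ b₃ ::ₘ outs ⟨P, C⟩, v ∈ D.arcs :=
    fun v hv => h.mem_arcs_of_mem_outs (ho ▸ hv)
  rw [hi] at h₁
  rw [ho] at h₂
  simp only [Multiset.nodup_cons, Multiset.mem_cons, not_or] at h₁ h₂
  refine normBracket_congr ?_ ?_
  · simp [hD, writhe, triangle, mkCrossing]
  · rw [bracket_eq_stateSum, bracket_eq_stateSum, harcs]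
    refine stateSum_triangle α β γ ε ⟨?_, ?_, ?_, ?_, ?_, ?_, ?_, ?_, ?_, ?_⟩
    · simp only [Finset.insert_subset_iff, Finset.singleton_subset_iff]
      refine ⟨hmi _ ?_, hmi _ ?_, hmo _ ?_, hmi _ ?_, hmi _ ?_, hmo _ ?_, hmi _ ?_, hmi _ ?_,
        hmo _ ?_⟩ <;> simp
    · exact fresh_of_notMem (by tauto) (by tauto)
    · exact fresh_of_notMem (by tauto) (by tauto)
    · exact fresh_of_notMem (by tauto) (by tauto)
    · tauto
    · tauto
    · tauto
    · exact ⟨h₁.1.1, Ne.symm h₂.1.1, Ne.symm h₁.2.1.1, Ne.symm h₂.1.2.2.1,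
        Ne.symm h₁.2.1.2.2.1, Ne.symm h₂.1.2.2.2.2.1⟩
    · exact ⟨h₁.1.2.2.1, h₂.2.1.1, h₁.2.2.1.1, Ne.symm h₂.2.2.1.1, Ne.symm h₁.2.2.2.1.1,
        Ne.symm h₂.2.2.1.2.2.1⟩
    · exact ⟨h₁.1.2.2.2.2.1, h₂.2.1.2.2.1, h₁.2.2.1.2.2.1, h₂.2.2.2.1.1, h₁.2.2.2.2.1.1,
        Ne.symm h₂.2.2.2.2.1.1⟩

/-- The normalized bracket is invariant under the Reidemeister moves. -/
theorem Move.normBracket_eq {D E : Diagram} (h : Move D E) (hD : D.Proper) :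
    D.normBracket = E.normBracket := by
  cases h with
  | relabel f D => exact (normBracket_relabel f.injective D).symm
  | point a b hab P C => exact (normBracket_point hab hD).symm
  | r1_under_over s a b c P C => exact normBracket_kink (Or.inl rfl) hD
  | r1_over_under s a b c P C => exact normBracket_kink (Or.inr rfl) hD
  | r2_parallel s a b c x y z P C => exact normBracket_two (Or.inl ⟨rfl, rfl⟩) hD
  | r2_antiparallel s a b c x y z P C => exact normBracket_two (Or.inr ⟨rfl, rfl⟩) hD
  | r3 => exact normBracket_triangle hD

end Diagram

theorem normBracket_eq_of_knot_eq {D E : KnotDiagram} (h : D.knot = E.knot) :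
    D.1.normBracket = E.1.normBracket := by
  have hE := Quot.eqvGen_exact h
  clear h
  induction hE with
  | rel D E h => exact h.normBracket_eq D.2.proper
  | refl D => rfl
  | symm D E _ ih => exact ih.symm
  | trans D E F _ _ ih ih' => exact ih.trans ih'

theorem KnotDiagram.isJones_of_hasJones {D : KnotDiagram} {V : ℤ[T;T⁻¹]} (h : D.1.HasJones V) :
    D.knot.IsJones V := by
  intro E hE
  rw [Diagram.hasJones_iff] at h ⊢
  rw [h, normBracket_eq_of_knot_eq hE]

end KnotDiag

/-! ### Balanced weights, and the smoothing against the orientation -/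

namespace KnotDiag

/-- The four ends of arcs at a crossing. -/
def Crossing.ends (c : Crossing) : Multiset ℕ := {c.uin, c.uout, c.oin, c.oout}

theorem Crossing.ends_through (c : Crossing) : KnotDiag.ends c.through = c.ends := by
  simp only [through, ends, Multiset.insert_eq_cons, ends_cons, ← Multiset.cons_zero, ends_zero]

theorem Crossing.ends_orientedSplit (c : Crossing) : KnotDiag.ends c.orientedSplit = c.ends := by
  simp only [orientedSplit, ends, Multiset.insert_eq_cons, ← Multiset.cons_zero, ends_cons,
    ends_zero]
  simp only [← Multiset.singleton_add]
  abel

theorem Crossing.ends_disorientedSplit (c : Crossing) :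
    KnotDiag.ends c.disorientedSplit = c.ends := by
  simp only [disorientedSplit, ends, Multiset.insert_eq_cons, ← Multiset.cons_zero, ends_cons,
    ends_zero]
  simp only [← Multiset.singleton_add]
  abel

theorem ends_bind {s : Crossing → Multiset (ℕ × ℕ)} (hs : ∀ c, ends (s c) = c.ends)
    (C : Multiset Crossing) : ends (C.bind s) = C.bind Crossing.ends := by
  induction C using Multiset.induction_on with
  | empty => rfl
  | cons c C ih => rw [Multiset.cons_bind, Multiset.cons_bind, ends_add, ih, hs]

/-- Each arc in `V` has two ends, each in an edge in `P` or a crossing in `C`. -/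
def Closed (V : Finset ℕ) (P : Multiset (ℕ × ℕ)) (C : Multiset Crossing) : Prop :=
  ends P + C.bind Crossing.ends = V.val + V.val

section Closed

variable {V : Finset ℕ} {P : Multiset (ℕ × ℕ)} {C : Multiset Crossing} {c : Crossing}

theorem Closed.split (h : Closed V P (c ::ₘ C)) {s : Multiset (ℕ × ℕ)} (hs : ends s = c.ends) :
    Closed V (s + P) C := by
  rw [Closed, Multiset.cons_bind] at h
  rw [Closed, ends_add, hs, ← h]
  abel

theorem Closed.ends_add (h : Closed V P (c ::ₘ C)) {s : Crossing → Multiset (ℕ × ℕ)}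
    (hs : ∀ c, ends (s c) = c.ends) : ends (P + C.bind s) + c.ends = V.val + V.val := by
  rw [Closed, Multiset.cons_bind] at h
  rw [KnotDiag.ends_add, ends_bind hs, ← h]
  abel

theorem Closed.mem (h : Closed V P (c ::ₘ C)) :
    c.uin ∈ V ∧ c.uout ∈ V ∧ c.oin ∈ V ∧ c.oout ∈ V := by
  have h' := h.ends_add Crossing.ends_through
  refine ⟨mem_of_ends_add h' ?_, mem_of_ends_add h' ?_, mem_of_ends_add h' ?_,
    mem_of_ends_add h' ?_⟩ <;> simp [Crossing.ends]

theorem Diagram.Proper.closed {D : Diagram} (h : D.Proper) :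
    Closed D.arcs D.points D.crossings := by
  have h₁ : D.arcs.val = D.ins := by
    rw [Diagram.arcs, Multiset.toFinset_val, Multiset.dedup_eq_self.2 h.nodup]
  have h₂ : ∀ C : Multiset Crossing, C.bind Crossing.ends = C.map Crossing.uin +
      C.map Crossing.uout + C.map Crossing.oin + C.map Crossing.oout := by
    intro C
    induction C using Multiset.induction_on with
    | empty => rfl
    | cons c C ih =>
      simp only [Multiset.cons_bind, ih, Crossing.ends, Multiset.map_cons, Multiset.insert_eq_cons]
      simp only [← Multiset.singleton_add]
      abel
  rw [Closed, h₁]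
  conv_rhs => rw [h.ins_eq, ← h.ins_eq]
  nth_rw 2 [h.ins_eq]
  rw [h₂, ends, Diagram.ins, Diagram.outs]
  abel

end Closed

/-- A linear condition that holds for all functions that are constant along the edges in `P`: the
sum of the weights of the crossings is zero. It expresses that edges and crossings can be directed
in a coherent way. -/
def Balanced (w : Crossing → (ℕ → ℤ) → ℤ) (P : Multiset (ℕ × ℕ)) (C : Multiset Crossing) : Prop :=
  ∀ f : ℕ → ℤ, (∀ e ∈ P, f e.1 = f e.2) → (C.map fun c => w c f).sum = 0

section Balanced

variable {w : Crossing → (ℕ → ℤ) → ℤ} {P : Multiset (ℕ × ℕ)} {C : Multiset Crossing} {c : Crossing}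

theorem Balanced.split (h : Balanced w P (c ::ₘ C)) {s : Multiset (ℕ × ℕ)}
    (hs : ∀ f : ℕ → ℤ, (∀ e ∈ s, f e.1 = f e.2) → w c f = 0) : Balanced w (s + P) C := by
  intro f hf
  have := h f fun e he => hf e (Multiset.mem_add.2 (Or.inr he))
  rwa [Multiset.map_cons, Multiset.sum_cons,
    hs f fun e he => hf e (Multiset.mem_add.2 (Or.inl he)), zero_add] at this

theorem Balanced.apply (h : Balanced w P (c ::ₘ C)) {s : Crossing → Multiset (ℕ × ℕ)}
    (hs : ∀ d ∈ C, ∀ f : ℕ → ℤ, (∀ e ∈ s d, f e.1 = f e.2) → w d f = 0) {f : ℕ → ℤ}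
    (hf : ∀ e ∈ P + C.bind s, f e.1 = f e.2) : w c f = 0 := by
  have := h f fun e he => hf e (Multiset.mem_add.2 (Or.inl he))
  rw [Multiset.map_cons, Multiset.sum_cons] at this
  rw [← this, Multiset.sum_eq_zero, add_zero]
  intro x hx
  obtain ⟨d, hd, rfl⟩ := Multiset.mem_map.1 hx
  exact hs d hd f fun e he => hf e (Multiset.mem_add.2 (Or.inr (Multiset.mem_bind.2 ⟨d, hd, he⟩)))

open Classical in
/-- The indicator function of a component. -/
theorem indicator_conn (E : Multiset (ℕ × ℕ)) (a : ℕ) :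
    ∀ e ∈ E, (fun x => if Conn E a x then (1 : ℤ) else 0) e.1 =
      (fun x => if Conn E a x then (1 : ℤ) else 0) e.2 := by
  intro e he
  have : Conn E a e.1 ↔ Conn E a e.2 :=
    ⟨fun h => h.trans (Conn.of_mem he), fun h => h.trans (Conn.of_mem he).symm⟩
  simp only [this]

/-- The number of incoming strands minus the number of outgoing strands. -/
def inOut (c : Crossing) (f : ℕ → ℤ) : ℤ := f c.uin + f c.oin - f c.uout - f c.oout

theorem inOut_through (c : Crossing) (f : ℕ → ℤ) (h : ∀ e ∈ c.through, f e.1 = f e.2) :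
    inOut c f = 0 := by
  simp only [Crossing.through, Multiset.insert_eq_cons, Multiset.mem_cons, Multiset.mem_singleton,
    forall_eq_or_imp, forall_eq] at h
  rw [inOut]
  linarith

theorem inOut_orientedSplit (c : Crossing) (f : ℕ → ℤ)
    (h : ∀ e ∈ c.orientedSplit, f e.1 = f e.2) : inOut c f = 0 := by
  simp only [Crossing.orientedSplit, Multiset.insert_eq_cons, Multiset.mem_cons,
    Multiset.mem_singleton, forall_eq_or_imp, forall_eq] at h
  rw [inOut]
  linarith

theorem Diagram.Proper.balanced {D : Diagram} (h : D.Proper) :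
    Balanced inOut D.points D.crossings := by
  intro f hf
  have hsum := congrArg (fun s => (s.map f).sum) h.ins_eq
  simp only [Diagram.ins, Diagram.outs, Multiset.map_add, Multiset.sum_add, Multiset.map_map,
    Function.comp_def] at hsum
  have hP : (D.points.map fun e => f e.1).sum = (D.points.map fun e => f e.2).sum :=
    congrArg Multiset.sum (Multiset.map_congr rfl hf)
  simp only [inOut, Multiset.sum_map_add, Multiset.sum_map_sub]
  linarith

theorem pairing_inOut {V : Finset ℕ} (hV : Closed V P (c ::ₘ C)) (h : Balanced inOut P (c ::ₘ C))
    {s : Crossing → Multiset (ℕ × ℕ)} (hs : ∀ c, ends (s c) = c.ends)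
    (hs' : ∀ d f, (∀ e ∈ s d, f e.1 = f e.2) → inOut d f = 0) :
    (Conn (P + C.bind s) c.uin c.uout ∧ Conn (P + C.bind s) c.oin c.oout ∧
        ¬ Conn (P + C.bind s) c.uin c.oin) ∨
      (Conn (P + C.bind s) c.uin c.oout ∧ Conn (P + C.bind s) c.oin c.uout ∧
        ¬ Conn (P + C.bind s) c.uin c.oin) := by
  classical
  rcases pairing (hV.ends_add hs) with h₁ | ⟨h₁, h₂, h₃⟩ | ⟨h₁, h₂, h₃⟩
  · exact Or.inl h₁
  · exfalso
    have := h.apply (f := fun x => if Conn (P + C.bind s) c.uin x then 1 else 0)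
      (fun d _ => hs' d) (indicator_conn _ c.uin)
    have h₄ : ¬ Conn (P + C.bind s) c.uin c.oout := fun h => h₃ (h.trans h₂.symm)
    simp [inOut, h₁, h₃, h₄, Conn.refl] at this
  · exact Or.inr ⟨h₁, h₂.symm, fun h => h₃ (h.trans h₂.symm)⟩

end Balanced

section Smoothing

variable {P : Multiset (ℕ × ℕ)} {C : Multiset Crossing} {c : Crossing}

open Diagram in
/-- In a diagram with one component, the removal of a crossing leaves two strands, each of which
joins an outgoing end at the crossing to an incoming end of the other branch. -/
theorem conn_of_componentCount_eq_one (hD : Proper ⟨P, c ::ₘ C⟩)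
    (h : componentCount ⟨P, c ::ₘ C⟩ = 1) :
    Conn (P + C.bind Crossing.through) c.uin c.oout ∧
      Conn (P + C.bind Crossing.through) c.oin c.uout ∧
        ¬ Conn (P + C.bind Crossing.through) c.uin c.oin := by
  have hV := hD.closed
  obtain ⟨m₁, m₂, m₃, m₄⟩ := hV.mem
  refine (pairing_inOut hV hD.balanced Crossing.ends_through inOut_through).resolve_left ?_
  rintro ⟨h₁, h₂, h₃⟩
  have h₄ := (classCount_close m₁ m₃ m₄ h₁ h₂ h₃).1
  have h₅ : classCount (arcs ⟨P, c ::ₘ C⟩) (P + C.bind Crossing.through) = 1 := by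
    rw [← h₄, ← h, componentCount, Multiset.cons_bind, Crossing.through]
    congr 1
    abel
  exact h₃ (conn_of_classCount_le_one h₅.le m₁ m₃)

/-- The crossing after reversal of the arcs `a` with `r a`. -/
def Crossing.reorient (r : ℕ → Bool) (c : Crossing) : Crossing :=
  if r c.uin then (if r c.oin then c.revUnder.revOver else c.revUnder)
  else if r c.oin then c.revOver else c

/-- The marked point after reversal of the arcs `a` with `r a`. -/
def reorientPoint (r : ℕ → Bool) (p : ℕ × ℕ) : ℕ × ℕ := if r p.1 then p.swap else p

/-- The smoothing of the crossing `c` that does not respect the orientation, in a diagram with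
marked points `P` and further crossings `C`. The arcs `a` with `r a` are reversed. -/
def smoothing (r : ℕ → Bool) (P : Multiset (ℕ × ℕ)) (c : Crossing) (C : Multiset Crossing) :
    Diagram :=
  ⟨c.disorientedSplit + P.map (reorientPoint r), C.map (Crossing.reorient r)⟩

theorem Crossing.sameUnoriented_reorient (r : ℕ → Bool) (c : Crossing) :
    c.SameUnoriented (c.reorient r) := by
  unfold reorient SameUnoriented
  split <;> split <;> simp

/-- The reversal of the arcs `a` with `r a` is coherent, except at the crossing `c`, where one
strand is reversed after the crossing and the other one before the crossing. -/
structure ReversesAt (r : ℕ → Bool) (P : Multiset (ℕ × ℕ)) (c : Crossing)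
    (C : Multiset Crossing) : Prop where
  points : ∀ p ∈ P, r p.1 = r p.2
  under_eq : ∀ d ∈ C, r d.uin = r d.uout
  over_eq : ∀ d ∈ C, r d.oin = r d.oout
  uin : r c.uin = false
  uout : r c.uout = true
  oin : r c.oin = true
  oout : r c.oout = false

open Diagram in
/-- The arcs to be reversed are those of the strand that leads to the incoming end of the
over-strand at `c`. -/
theorem exists_reversesAt (hD : Proper ⟨P, c ::ₘ C⟩) (h : componentCount ⟨P, c ::ₘ C⟩ = 1) :
    ∃ r, ReversesAt r P c C := by
  classical
  obtain ⟨h₁, h₂, h₃⟩ := conn_of_componentCount_eq_one hD h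
  set E := P + C.bind Crossing.through with hE
  have key : ∀ e ∈ E, decide (Conn E c.oin e.1) = decide (Conn E c.oin e.2) := by
    intro e he
    exact decide_eq_decide.2
      ⟨fun h => h.trans (Conn.of_mem he), fun h => h.trans (Conn.of_mem he).symm⟩
  have hC : ∀ d ∈ C, ∀ e ∈ d.through, e ∈ E := fun d hd e he =>
    Multiset.mem_add.2 (Or.inr (Multiset.mem_bind.2 ⟨d, hd, he⟩))
  refine ⟨fun a => decide (Conn E c.oin a), fun p hp => key p (Multiset.mem_add.2 (Or.inl hp)),
    fun d hd => key (d.uin, d.uout) (hC d hd _ (by simp [Crossing.through])),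
    fun d hd => key (d.oin, d.oout) (hC d hd _ (by simp [Crossing.through])), ?_, ?_, ?_, ?_⟩
  · exact decide_eq_false fun h => h₃ h.symm
  · exact decide_eq_true h₂
  · exact decide_eq_true (Conn.refl _ _)
  · exact decide_eq_false fun h => h₃ (h₁.trans h.symm)

namespace ReversesAt

variable {r : ℕ → Bool}

theorem map_points (h : ∀ p ∈ P, r p.1 = r p.2) :
    (P.map (reorientPoint r)).map Prod.fst =
        (P.map Prod.fst).filter (fun a => ¬ r a) + (P.map Prod.snd).filter (fun a => r a) ∧
      (P.map (reorientPoint r)).map Prod.snd =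
        (P.map Prod.snd).filter (fun a => ¬ r a) + (P.map Prod.fst).filter (fun a => r a) := by
  induction P using Multiset.induction_on with
  | empty => simp
  | cons p P ih =>
    obtain ⟨ih₁, ih₂⟩ := ih fun q hq => h q (Multiset.mem_cons_of_mem hq)
    have hp := h p (Multiset.mem_cons_self _ _)
    simp only [Multiset.map_cons, ih₁, ih₂]
    cases hr : r p.1 <;> rw [hr] at hp <;> simp [hr, ← hp, reorientPoint]

theorem map_under (h : ∀ d ∈ C, r d.uin = r d.uout) :
    (C.map (Crossing.reorient r)).map Crossing.uin =
        (C.map Crossing.uin).filter (fun a => ¬ r a) +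
          (C.map Crossing.uout).filter (fun a => r a) ∧
      (C.map (Crossing.reorient r)).map Crossing.uout =
        (C.map Crossing.uout).filter (fun a => ¬ r a) +
          (C.map Crossing.uin).filter (fun a => r a) := by
  induction C using Multiset.induction_on with
  | empty => simp
  | cons d C ih =>
    obtain ⟨ih₁, ih₂⟩ := ih fun q hq => h q (Multiset.mem_cons_of_mem hq)
    have hp := h d (Multiset.mem_cons_self _ _)
    simp only [Multiset.map_cons, ih₁, ih₂]
    cases hr : r d.uin <;> cases hr' : r d.oin <;> rw [hr] at hp <;>
      simp [hr, hr', ← hp, Crossing.reorient, Crossing.revUnder, Crossing.revOver]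

theorem map_over (h : ∀ d ∈ C, r d.oin = r d.oout) :
    (C.map (Crossing.reorient r)).map Crossing.oin =
        (C.map Crossing.oin).filter (fun a => ¬ r a) +
          (C.map Crossing.oout).filter (fun a => r a) ∧
      (C.map (Crossing.reorient r)).map Crossing.oout =
        (C.map Crossing.oout).filter (fun a => ¬ r a) +
          (C.map Crossing.oin).filter (fun a => r a) := by
  induction C using Multiset.induction_on with
  | empty => simp
  | cons d C ih =>
    obtain ⟨ih₁, ih₂⟩ := ih fun q hq => h q (Multiset.mem_cons_of_mem hq)
    have hp := h d (Multiset.mem_cons_self _ _)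
    simp only [Multiset.map_cons, ih₁, ih₂]
    cases hr : r d.oin <;> cases hr' : r d.uin <;> rw [hr] at hp <;>
      simp [hr, hr', ← hp, Crossing.reorient, Crossing.revUnder, Crossing.revOver]

end ReversesAt

open Diagram

theorem ReversesAt.ins_smoothing {r : ℕ → Bool} (h : ReversesAt r P c C)
    (hD : Proper ⟨P, c ::ₘ C⟩) : (smoothing r P c C).ins = ins ⟨P, c ::ₘ C⟩ := by
  have h₁ := Multiset.filter_add_not (fun a => r a = true) (ins ⟨P, c ::ₘ C⟩)
  nth_rw 1 [hD.ins_eq] at h₁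
  rw [← h₁]
  simp only [smoothing, ins, outs, Multiset.map_add, (ReversesAt.map_points h.points).1,
    (ReversesAt.map_under h.under_eq).1, (ReversesAt.map_over h.over_eq).1,
    Multiset.filter_add, Crossing.disorientedSplit, Multiset.insert_eq_cons,
    Multiset.map_singleton, ← Multiset.singleton_add]
  simp [h.uin, h.uout, h.oin, h.oout, Multiset.filter_singleton]
  abel

theorem ReversesAt.outs_smoothing {r : ℕ → Bool} (h : ReversesAt r P c C)
    (hD : Proper ⟨P, c ::ₘ C⟩) : (smoothing r P c C).outs = outs ⟨P, c ::ₘ C⟩ := by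
  have h₁ := Multiset.filter_add_not (fun a => r a = true) (outs ⟨P, c ::ₘ C⟩)
  nth_rw 1 [← hD.ins_eq] at h₁
  rw [← h₁]
  simp only [smoothing, ins, outs, Multiset.map_add, (ReversesAt.map_points h.points).2,
    (ReversesAt.map_under h.under_eq).2, (ReversesAt.map_over h.over_eq).2,
    Multiset.filter_add, Crossing.disorientedSplit, Multiset.insert_eq_cons,
    Multiset.map_singleton, ← Multiset.singleton_add]
  simp [h.uin, h.uout, h.oin, h.oout, Multiset.filter_singleton]
  simp only [← Multiset.singleton_add]
  abel

theorem ReversesAt.proper_smoothing {r : ℕ → Bool} (h : ReversesAt r P c C)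
    (hD : Proper ⟨P, c ::ₘ C⟩) : (smoothing r P c C).Proper := by
  refine ⟨?_, ?_⟩
  · rw [h.ins_smoothing hD]
    exact hD.nodup
  · rw [h.ins_smoothing hD, h.outs_smoothing hD, hD.ins_eq]

theorem ReversesAt.arcs_smoothing {r : ℕ → Bool} (h : ReversesAt r P c C)
    (hD : Proper ⟨P, c ::ₘ C⟩) : (smoothing r P c C).arcs = arcs ⟨P, c ::ₘ C⟩ := by
  rw [arcs, h.ins_smoothing hD, arcs]

theorem conn_reorientPoint (r : ℕ → Bool) (p : ℕ × ℕ) {E : Multiset (ℕ × ℕ)} :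
    Conn E (reorientPoint r p).1 (reorientPoint r p).2 ↔ Conn E p.1 p.2 := by
  unfold reorientPoint
  split
  · exact ⟨Conn.symm, Conn.symm⟩
  · rfl

theorem forall_through (c : Crossing) {E : Multiset (ℕ × ℕ)} :
    (∀ e ∈ c.through, Conn E e.1 e.2) ↔ Conn E c.uin c.uout ∧ Conn E c.oin c.oout := by
  simp [Crossing.through]

theorem forall_through_reorient (r : ℕ → Bool) (c : Crossing) {E : Multiset (ℕ × ℕ)} :
    (∀ e ∈ (c.reorient r).through, Conn E e.1 e.2) ↔ ∀ e ∈ c.through, Conn E e.1 e.2 := by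
  have hsym : ∀ {x y}, Conn E x y ↔ Conn E y x := ⟨Conn.symm, Conn.symm⟩
  rw [forall_through, forall_through]
  unfold Crossing.reorient
  split <;> split <;> simp only [Crossing.revUnder, Crossing.revOver]
  · rw [hsym (x := c.uout), hsym (x := c.oout)]
  · rw [hsym (x := c.uout)]
  · rw [hsym (x := c.oout)]

theorem componentCount_smoothing {r : ℕ → Bool} (h : ReversesAt r P c C)
    (hD : Proper ⟨P, c ::ₘ C⟩) (h₁ : componentCount ⟨P, c ::ₘ C⟩ = 1) :
    (smoothing r P c C).componentCount = 1 := by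
  have hV := hD.closed
  obtain ⟨m₁, m₂, m₃, m₄⟩ := hV.mem
  obtain ⟨k₁, k₂, k₃⟩ := conn_of_componentCount_eq_one hD h₁
  obtain ⟨-, c₁, c₂⟩ := classCount_close (V := arcs ⟨P, c ::ₘ C⟩) m₁ m₃ m₂ k₁ k₂ k₃
  rw [componentCount, h.arcs_smoothing hD]
  have e₁ : classCount (arcs ⟨P, c ::ₘ C⟩) ((smoothing r P c C).points +
      (smoothing r P c C).crossings.bind Crossing.through) = classCount (arcs ⟨P, c ::ₘ C⟩)
        ({(c.uin, c.oin), (c.oout, c.uout)} + (P + C.bind Crossing.through)) := by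
    refine classCount_congr _ ?_ ?_
    · intro e he
      simp only [smoothing, Multiset.mem_add, Multiset.mem_map, Multiset.mem_bind] at he
      rcases he with (he | ⟨p, hp, rfl⟩) | ⟨_, ⟨d, hd, rfl⟩, he⟩
      · simp only [Crossing.disorientedSplit, Multiset.insert_eq_cons, Multiset.mem_cons,
          Multiset.mem_singleton] at he
        rcases he with rfl | rfl
        · exact Conn.of_mem (by simp)
        · exact (Conn.of_mem (by simp)).symm
      · rw [conn_reorientPoint]
        exact Conn.of_mem (by simp [hp])
      · revert e
        rw [forall_through_reorient]
        exact fun e he => Conn.of_mem (Multiset.mem_add.2 (Or.inr (Multiset.mem_add.2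
          (Or.inr (Multiset.mem_bind.2 ⟨d, hd, he⟩)))))
    · intro e he
      simp only [Multiset.mem_add, Multiset.mem_bind] at he
      rcases he with he | he | ⟨d, hd, he⟩
      · simp only [Multiset.insert_eq_cons, Multiset.mem_cons, Multiset.mem_singleton] at he
        rcases he with rfl | rfl
        · exact Conn.of_mem (by simp [smoothing, Crossing.disorientedSplit])
        · exact (Conn.of_mem (by simp [smoothing, Crossing.disorientedSplit])).symm
      · rw [← conn_reorientPoint r]
        exact Conn.of_mem (Multiset.mem_add.2 (Or.inl (Multiset.mem_add.2
          (Or.inr (Multiset.mem_map_of_mem _ he)))))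
      · revert e
        rw [← forall_through_reorient r]
        exact fun e he => Conn.of_mem (Multiset.mem_add.2 (Or.inr (Multiset.mem_bind.2
          ⟨_, Multiset.mem_map_of_mem _ hd, he⟩)))
  have e₂ : componentCount ⟨P, c ::ₘ C⟩ = classCount (arcs ⟨P, c ::ₘ C⟩)
        ({(c.uin, c.uout), (c.oout, c.oin)} + (P + C.bind Crossing.through)) := by
    rw [componentCount, Multiset.cons_bind, Crossing.through]
    have : (P + (({(c.uin, c.uout), (c.oin, c.oout)} : Multiset (ℕ × ℕ)) +
        C.bind Crossing.through)) = (c.oin, c.oout) ::ₘ (c.uin, c.uout) ::ₘ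
          (P + C.bind Crossing.through) := by
      simp only [Multiset.insert_eq_cons, ← Multiset.singleton_add]
      abel
    rw [this, classCount_swap, Multiset.cons_swap, Multiset.insert_eq_cons, Multiset.cons_add,
      Multiset.singleton_add]
  rw [e₁]
  omega

end Smoothing

end KnotDiag

/-! ### Planarity of the smoothing, and checkerboard colorings -/

namespace KnotDiag

open Diagram

section Regions

variable {P : Multiset (ℕ × ℕ)} {C : Multiset Crossing} {c : Crossing} {r : ℕ → Bool}

/-- The sides of arcs that are joined at a marked point. -/
def sides (p : ℕ × ℕ) : Multiset ((ℕ × Bool) × (ℕ × Bool)) :=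
  {((p.1, true), (p.2, true)), ((p.1, false), (p.2, false))}

/-- The pairs of sides of arcs that are joined at marked points and crossings. -/
def regionEdges (D : Diagram) : Multiset ((ℕ × Bool) × (ℕ × Bool)) :=
  D.points.bind sides + D.crossings.bind Crossing.corners

theorem regionCount_eq (D : Diagram) : D.regionCount =
    classCount (D.arcs ×ˢ (Finset.univ : Finset Bool)) (regionEdges D) := rfl

/-- The effect of a reversal of arcs on their sides. -/
def flipSide (r : ℕ → Bool) (x : ℕ × Bool) : ℕ × Bool := (x.1, xor x.2 (r x.1))

theorem flipSide_flipSide (r : ℕ → Bool) (x : ℕ × Bool) : flipSide r (flipSide r x) = x := by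
  simp [flipSide]

theorem conn_sides_reorient {p : ℕ × ℕ} (h : r p.1 = r p.2) :
    (∀ e ∈ sides p, Conn (sides (reorientPoint r p)) (flipSide r e.1) (flipSide r e.2)) ∧
    (∀ e ∈ sides (reorientPoint r p), Conn (sides p) (flipSide r e.1) (flipSide r e.2)) := by
  cases hp : r p.1 <;> rw [hp] at h <;>
    simp only [reorientPoint, hp, sides, Multiset.insert_eq_cons, Multiset.mem_cons,
      Multiset.mem_singleton, forall_eq_or_imp, forall_eq, flipSide, if_true, ← h, Prod.swap,
      Bool.xor_true, Bool.xor_false, Bool.not_true, Bool.not_false, Bool.false_eq_true, if_false]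
  · exact ⟨⟨Conn.of_mem (by simp), Conn.of_mem (by simp)⟩, Conn.of_mem (by simp),
      Conn.of_mem (by simp)⟩
  · exact ⟨⟨(Conn.of_mem (by simp)).symm, (Conn.of_mem (by simp)).symm⟩,
      (Conn.of_mem (by simp)).symm, (Conn.of_mem (by simp)).symm⟩

theorem conn_corners_reorient {d : Crossing} (hu : r d.uin = r d.uout) (ho : r d.oin = r d.oout) :
    (∀ e ∈ d.corners, Conn (d.reorient r).corners (flipSide r e.1) (flipSide r e.2)) ∧
    (∀ e ∈ (d.reorient r).corners, Conn d.corners (flipSide r e.1) (flipSide r e.2)) := by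
  have hne : ¬ (-1 : ℤˣ) = 1 := by decide
  cases h₁ : r d.uin <;> cases h₂ : r d.oin <;> rw [h₁] at hu <;> rw [h₂] at ho <;>
    rcases d.sign_eq with h | h <;>
    simp only [Crossing.reorient, Crossing.revUnder, Crossing.revOver, Crossing.corners, h, h₁, h₂,
      Multiset.insert_eq_cons, Multiset.mem_cons, Multiset.mem_singleton, forall_eq_or_imp,
      forall_eq, flipSide, if_true, ← hu, ← ho, Bool.xor_true, Bool.xor_false, Bool.not_true,
      Bool.not_false, Bool.false_eq_true, if_false, hne, neg_neg] <;>
    exact ⟨⟨Conn.of_mem (by simp), Conn.of_mem (by simp), Conn.of_mem (by simp),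
      Conn.of_mem (by simp)⟩, Conn.of_mem (by simp), Conn.of_mem (by simp), Conn.of_mem (by simp),
      Conn.of_mem (by simp)⟩

/-- The sides that are joined at the two new marked points of the smoothing, in terms of the old
orientation. -/
def smoothedCorners (c : Crossing) : Multiset ((ℕ × Bool) × (ℕ × Bool)) :=
  {((c.uin, true), (c.oin, false)), ((c.uin, false), (c.oin, true)),
    ((c.uout, true), (c.oout, false)), ((c.uout, false), (c.oout, true))}

/-- The joined sides in the smoothing, in terms of the old orientation. -/
def smoothedEdges (P : Multiset (ℕ × ℕ)) (c : Crossing) (C : Multiset Crossing) :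
    Multiset ((ℕ × Bool) × (ℕ × Bool)) :=
  smoothedCorners c + (P.bind sides + C.bind Crossing.corners)

theorem ReversesAt.conn_regionEdges_smoothing (h : ReversesAt r P c C)
    {e : (ℕ × Bool) × (ℕ × Bool)} (he : e ∈ smoothedEdges P c C) :
    Conn (regionEdges (smoothing r P c C)) (flipSide r e.1) (flipSide r e.2) := by
  simp only [smoothedEdges, Multiset.mem_add, Multiset.mem_bind] at he
  rcases he with he | ⟨p, hp, he⟩ | ⟨d, hd, he⟩
  · have hle : sides (c.uin, c.oin) + sides (c.uout, c.oout) ≤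
        regionEdges (smoothing r P c C) := by
      simp only [regionEdges, smoothing, Crossing.disorientedSplit, Multiset.add_bind,
        Multiset.insert_eq_cons, Multiset.cons_bind, Multiset.singleton_bind, add_assoc]
      rw [← add_assoc]
      exact Multiset.le_add_right _ _
    refine Conn.mono hle ?_
    simp only [smoothedCorners, Multiset.insert_eq_cons, Multiset.mem_cons,
      Multiset.mem_singleton] at he
    rcases he with rfl | rfl | rfl | rfl <;>
      exact Conn.of_mem (by simp [sides, flipSide, h.uin, h.oin, h.uout, h.oout])
  · exact ((conn_sides_reorient (h.points p hp)).1 e he).mono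
      ((Multiset.le_bind _ (Multiset.mem_add.2 (Or.inr (Multiset.mem_map_of_mem _ hp)))).trans
        (Multiset.le_add_right _ _))
  · exact ((conn_corners_reorient (h.under_eq d hd) (h.over_eq d hd)).1 e he).mono
      ((Multiset.le_bind _ (Multiset.mem_map_of_mem _ hd)).trans (Multiset.le_add_left _ _))

theorem ReversesAt.conn_smoothedEdges (h : ReversesAt r P c C)
    {e : (ℕ × Bool) × (ℕ × Bool)} (he : e ∈ regionEdges (smoothing r P c C)) :
    Conn (smoothedEdges P c C) (flipSide r e.1) (flipSide r e.2) := by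
  simp only [regionEdges, smoothing, Multiset.add_bind, Multiset.mem_add, Multiset.mem_bind,
    Multiset.mem_map] at he
  rcases he with (⟨p, hp, he⟩ | ⟨_, ⟨p, hp, rfl⟩, he⟩) | ⟨_, ⟨d, hd, rfl⟩, he⟩
  · refine Conn.mono (Multiset.le_add_right (smoothedCorners c) _) ?_
    simp only [Crossing.disorientedSplit, Multiset.insert_eq_cons, Multiset.mem_cons,
      Multiset.mem_singleton] at hp
    rcases hp with rfl | rfl <;>
      simp only [sides, Multiset.insert_eq_cons, Multiset.mem_cons,
        Multiset.mem_singleton] at he <;>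
      rcases he with rfl | rfl <;>
      exact Conn.of_mem (by simp [smoothedCorners, flipSide, h.uin, h.oin, h.uout, h.oout])
  · exact ((conn_sides_reorient (h.points p hp)).2 e he).mono
      (((Multiset.le_bind _ hp).trans (Multiset.le_add_right _ _)).trans (Multiset.le_add_left _ _))
  · exact ((conn_corners_reorient (h.under_eq d hd) (h.over_eq d hd)).2 e he).mono
      (((Multiset.le_bind _ hd).trans (Multiset.le_add_left _ _)).trans (Multiset.le_add_left _ _))

theorem ReversesAt.regionCount_smoothing (h : ReversesAt r P c C)
    (hD : Proper ⟨P, c ::ₘ C⟩) : (smoothing r P c C).regionCount =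
      classCount (arcs ⟨P, c ::ₘ C⟩ ×ˢ (Finset.univ : Finset Bool)) (smoothedEdges P c C) := by
  rw [regionCount_eq, h.arcs_smoothing hD]
  refine classCount_eq_of_maps (flipSide r) (flipSide r)
    (fun e he => h.conn_smoothedEdges he) (fun e he => h.conn_regionEdges_smoothing he) ?_ ?_ ?_ ?_
  · intro v hv
    simp only [Finset.mem_product, Finset.mem_univ, and_true] at hv ⊢
    exact hv
  · intro v hv
    simp only [Finset.mem_product, Finset.mem_univ, and_true] at hv ⊢
    exact hv
  · intro v _
    rw [flipSide_flipSide]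
    exact Conn.refl _ _
  · intro v _
    rw [flipSide_flipSide]
    exact Conn.refl _ _

/-- The replacement of two edges by two other edges with the same four ends. -/
theorem classCount_exchange {α : Type} {V : Finset α} {x₁ y₁ x₂ y₂ : α} (hx₁ : x₁ ∈ V)
    (hx₂ : x₂ ∈ V) (hy₁ : y₁ ∈ V) (E : Multiset (α × α)) :
    classCount V ((x₁, y₁) ::ₘ (x₂, y₂) ::ₘ E) ≤
        classCount V ((x₁, x₂) ::ₘ (y₁, y₂) ::ₘ E) + 1 ∧
      (classCount V ((x₁, y₁) ::ₘ (x₂, y₂) ::ₘ E) =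
        classCount V ((x₁, x₂) ::ₘ (y₁, y₂) ::ₘ E) + 1 →
      Conn ((x₁, x₂) ::ₘ (y₁, y₂) ::ₘ E) x₁ y₁ ∧ Conn ((x₁, x₂) ::ₘ (y₁, y₂) ::ₘ E) x₂ y₂) := by
  set F := (x₁, x₂) ::ₘ (y₁, y₂) ::ₘ E with hF
  set G := (x₁, y₁) ::ₘ (x₂, y₂) ::ₘ E with hG
  have h₁ : classCount V G ≤ classCount V ((x₁, x₂) ::ₘ G) + 1 := classCount_le_cons V _ _ hx₁ hx₂
  have hxx : Conn F x₁ x₂ := Conn.of_mem (by simp [hF])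
  have hyy : Conn F y₁ y₂ := Conn.of_mem (by simp [hF])
  have h₂ : classCount V ((x₁, x₂) ::ₘ G) ≤ classCount V ((x₁, y₁) ::ₘ F) := by
    refine classCount_mono V fun e he => ?_
    simp only [hF, Multiset.mem_cons] at he
    have k₁ : Conn ((x₁, x₂) ::ₘ G) x₁ y₁ := Conn.of_mem (by simp [hG])
    have k₂ : Conn ((x₁, x₂) ::ₘ G) x₁ x₂ := Conn.of_mem (by simp)
    have k₃ : Conn ((x₁, x₂) ::ₘ G) x₂ y₂ := Conn.of_mem (by simp [hG])
    rcases he with rfl | rfl | rfl | he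
    · exact k₁
    · exact k₂
    · exact k₁.symm.trans (k₂.trans k₃)
    · exact Conn.of_mem (by simp [hG, he])
  have h₃ : classCount V ((x₁, y₁) ::ₘ F) ≤ classCount V F :=
    classCount_mono V fun e he => (Conn.of_mem he).cons _
  refine ⟨by omega, fun h => ?_⟩
  have h₄ : Conn F x₁ y₁ := by
    by_contra hn
    have := classCount_cons_of_not_conn hx₁ hy₁ hn
    omega
  exact ⟨h₄, hxx.symm.trans (h₄.trans hyy)⟩

theorem classCount_corners_le {V : Finset ℕ}
    (hV : c.uin ∈ V ∧ c.uout ∈ V ∧ c.oin ∈ V ∧ c.oout ∈ V)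
    (F : Multiset ((ℕ × Bool) × (ℕ × Bool))) :
    classCount (V ×ˢ (Finset.univ : Finset Bool)) (c.corners + F) ≤
        classCount (V ×ˢ (Finset.univ : Finset Bool)) (smoothedCorners c + F) + 1 ∧
      (classCount (V ×ˢ (Finset.univ : Finset Bool)) (c.corners + F) =
        classCount (V ×ˢ (Finset.univ : Finset Bool)) (smoothedCorners c + F) + 1 →
        ∀ e ∈ c.corners, Conn (smoothedCorners c + F) e.1 e.2) := by
  obtain ⟨h₁, h₂, h₃, h₄⟩ := hV
  have hm : ∀ {a} (b : Bool), a ∈ V → (a, b) ∈ V ×ˢ (Finset.univ : Finset Bool) :=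
    fun b ha => by simpa using ha
  have hne : ¬ (-1 : ℤˣ) = 1 := by decide
  -- two of the four corners remain, the sides of the arcs at the two others are exchanged
  have main : ∀ {x₁ y₁ x₂ y₂ : ℕ × Bool} {E : Multiset ((ℕ × Bool) × (ℕ × Bool))},
      x₁ ∈ V ×ˢ (Finset.univ : Finset Bool) → x₂ ∈ V ×ˢ (Finset.univ : Finset Bool) →
      y₁ ∈ V ×ˢ (Finset.univ : Finset Bool) →
      (∀ e ∈ c.corners, e ∈ (x₁, y₁) ::ₘ (x₂, y₂) ::ₘ E ∨
        e.swap ∈ (x₁, y₁) ::ₘ (x₂, y₂) ::ₘ E) →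
      (∀ e ∈ (x₁, y₁) ::ₘ (x₂, y₂) ::ₘ E, e ∈ c.corners ∨ e.swap ∈ c.corners) →
      (∀ e ∈ smoothedCorners c, e ∈ (x₁, x₂) ::ₘ (y₁, y₂) ::ₘ E ∨
        e.swap ∈ (x₁, x₂) ::ₘ (y₁, y₂) ::ₘ E) →
      (∀ e ∈ (x₁, x₂) ::ₘ (y₁, y₂) ::ₘ E, e ∈ smoothedCorners c ∨ e.swap ∈ smoothedCorners c) →
      classCount (V ×ˢ (Finset.univ : Finset Bool)) (c.corners + F) ≤
        classCount (V ×ˢ (Finset.univ : Finset Bool)) (smoothedCorners c + F) + 1 ∧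
      (classCount (V ×ˢ (Finset.univ : Finset Bool)) (c.corners + F) =
        classCount (V ×ˢ (Finset.univ : Finset Bool)) (smoothedCorners c + F) + 1 →
        ∀ e ∈ c.corners, Conn (smoothedCorners c + F) e.1 e.2) := by
    intro x₁ y₁ x₂ y₂ E hx₁ hx₂ hy₁ hc hc' hs hs'
    have aux : ∀ {A B : Multiset ((ℕ × Bool) × (ℕ × Bool))},
        (∀ e ∈ A, e ∈ B ∨ e.swap ∈ B) → ∀ e ∈ A + F, Conn (B + F) e.1 e.2 := by
      intro A B hAB e he
      rcases Multiset.mem_add.1 he with he | he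
      · rcases hAB e he with h | h
        · exact Conn.of_mem (Multiset.mem_add.2 (Or.inl h))
        · exact (Conn.of_mem (Multiset.mem_add.2 (Or.inl h))).symm
      · exact Conn.of_mem (Multiset.mem_add.2 (Or.inr he))
    have key := classCount_exchange (y₂ := y₂) hx₁ hx₂ hy₁ (E + F)
    rw [← Multiset.cons_add, ← Multiset.cons_add, ← Multiset.cons_add, ← Multiset.cons_add,
      ← classCount_congr _ (aux hc) (aux hc'), ← classCount_congr _ (aux hs) (aux hs')] at key
    refine ⟨key.1, fun h e he => ?_⟩
    obtain ⟨k₁, k₂⟩ := key.2 h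
    have hall : ∀ e ∈ (x₁, y₁) ::ₘ (x₂, y₂) ::ₘ E, Conn (smoothedCorners c + F) e.1 e.2 := by
      intro e he
      rcases Multiset.mem_cons.1 he with rfl | he
      · exact k₁.mono' (aux hs')
      rcases Multiset.mem_cons.1 he with rfl | he
      · exact k₂.mono' (aux hs')
      exact aux hs' e (by simp [he])
    rcases hc e he with h | h
    · exact hall e h
    · exact (hall e.swap h).symm
  rcases c.sign_eq with h | h
  · refine main (x₁ := (c.uin, false)) (y₁ := (c.oout, false)) (x₂ := (c.oin, true))
      (y₂ := (c.uout, true)) (E := {((c.uin, true), (c.oin, false)),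
        ((c.uout, false), (c.oout, true))}) (hm _ h₁) (hm _ h₃) (hm _ h₄) ?_ ?_ ?_ ?_ <;>
      simp [Crossing.corners, smoothedCorners, h]
  · refine main (x₁ := (c.oin, false)) (y₁ := (c.uout, false)) (x₂ := (c.uin, true))
      (y₂ := (c.oout, true)) (E := {((c.uin, false), (c.oin, true)),
        ((c.uout, true), (c.oout, false))}) (hm _ h₃) (hm _ h₁) (hm _ h₂) ?_ ?_ ?_ ?_ <;>
      simp [Crossing.corners, smoothedCorners, h, hne]

theorem regionEdges_cons : regionEdges ⟨P, c ::ₘ C⟩ =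
    c.corners + (P.bind sides + C.bind Crossing.corners) := by
  rw [regionEdges, Multiset.cons_bind]
  abel

theorem ReversesAt.regionCount_le (h : ReversesAt r P c C) (hD : Proper ⟨P, c ::ₘ C⟩) :
    regionCount ⟨P, c ::ₘ C⟩ ≤ (smoothing r P c C).regionCount + 1 ∧
      (regionCount ⟨P, c ::ₘ C⟩ = (smoothing r P c C).regionCount + 1 →
        ∀ e ∈ c.corners, Conn (smoothedEdges P c C) e.1 e.2) := by
  rw [h.regionCount_smoothing hD, regionCount_eq, regionEdges_cons, smoothedEdges]
  exact classCount_corners_le hD.closed.mem _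

/-- A diagram with one component and without crossings has at most two regions, since all left
sides of arcs are joined, and all right sides. -/
theorem regionCount_zero_le (h : componentCount ⟨P, 0⟩ = 1) : regionCount ⟨P, 0⟩ ≤ 2 := by
  rw [regionCount_eq]
  have hE : ∀ (b : Bool) {x y : ℕ}, Conn P x y → Conn (regionEdges ⟨P, 0⟩) (x, b) (y, b) := by
    intro b x y hxy
    refine hxy.map (fun x => (x, b)) fun e he => Conn.of_mem ?_
    refine Multiset.mem_add.2 (Or.inl (Multiset.mem_bind.2 ⟨e, he, ?_⟩))
    cases b <;> simp [sides]
  have hP : ∀ {x y}, x ∈ arcs ⟨P, 0⟩ → y ∈ arcs ⟨P, 0⟩ → Conn P x y := by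
    intro x y hx hy
    rw [componentCount] at h
    simpa using conn_of_classCount_le_one h.le hx hy
  rcases (arcs ⟨P, 0⟩).eq_empty_or_nonempty with he | ⟨a, ha⟩
  · rw [he]
    simp [classCount_def]
  · rw [classCount_def]
    have hsub : Quot.mk (Conn (regionEdges ⟨P, 0⟩)) ''
        ((arcs ⟨P, 0⟩ ×ˢ (Finset.univ : Finset Bool) : Finset (ℕ × Bool)) : Set (ℕ × Bool)) ⊆
        {Quot.mk _ (a, true), Quot.mk _ (a, false)} := by
      rintro _ ⟨⟨x, b⟩, hx, rfl⟩
      have hx' : x ∈ arcs ⟨P, 0⟩ := by simpa using hx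
      have := quot_mk_eq_iff.2 (hE b (hP hx' ha))
      cases b
      · exact Or.inr this
      · exact Or.inl this
    refine (Set.ncard_le_ncard hsub (Set.toFinite _)).trans ((Set.ncard_insert_le _ _).trans ?_)
    rw [Set.ncard_singleton]

/-- The genus of a diagram with one component is not negative. -/
theorem regionCount_le_of_componentCount_eq_one (D : Diagram) (hD : D.Proper)
    (h : D.componentCount = 1) : D.regionCount ≤ Multiset.card D.crossings + 2 := by
  obtain ⟨P, C⟩ := D
  induction hn : Multiset.card C generalizing P C with
  | zero =>
    rw [Multiset.card_eq_zero] at hn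
    subst hn
    simpa using regionCount_zero_le h
  | succ n ih =>
    obtain ⟨c, C, rfl⟩ := Multiset.card_pos_iff_exists_mem.1 (by omega : 0 < Multiset.card C) |>.imp
      fun c hc => Multiset.exists_cons_of_mem hc
    obtain ⟨r, hr⟩ := exists_reversesAt hD h
    have h₁ := (hr.regionCount_le hD).1
    rw [Multiset.card_cons] at hn
    have h₂ := ih _ _ (hr.proper_smoothing hD) (componentCount_smoothing hr hD h)
      (by rw [Multiset.card_map]; omega)
    exact h₁.trans (Nat.succ_le_succ h₂)

/-- The smoothing of a knot diagram that does not respect the orientation is a knot diagram. The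
number of regions cannot drop by more than one, nor by less because of the bound by the number of
crossings. -/
theorem isKnotDiagram_smoothing (hr : ReversesAt r P c C) (hD : IsKnotDiagram ⟨P, c ::ₘ C⟩) :
    (smoothing r P c C).IsKnotDiagram ∧
      regionCount ⟨P, c ::ₘ C⟩ = (smoothing r P c C).regionCount + 1 := by
  have hp := hr.proper_smoothing hD.proper
  have hc := componentCount_smoothing hr hD.proper hD.2.2.1
  have h₁ := (hr.regionCount_le hD.proper).1
  have h₂ := regionCount_le_of_componentCount_eq_one _ hp hc
  have h₃ := hD.2.2.2
  have h₄ : Multiset.card (smoothing r P c C).crossings = Multiset.card C := by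
    simp [smoothing]
  simp only [Multiset.card_cons] at h₃
  exact ⟨⟨hp.1, hp.2, hc, by omega⟩, by omega⟩

/-- The color of a side of an arc, in a coloring of the regions; `η a` is the color of the left side
of `a`, and the two sides have different colors. -/
def sideColor (η : ℕ → ℤˣ) (x : ℕ × Bool) : ℤˣ := if x.2 then η x.1 else -η x.1

theorem sideColor_flipSide (η : ℕ → ℤˣ) (r : ℕ → Bool) (x : ℕ × Bool) :
    sideColor η (flipSide r x) = sideColor (fun a => if r a then -η a else η a) x := by
  obtain ⟨a, b⟩ := x
  cases b <;> cases h : r a <;> simp [sideColor, flipSide, h]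

/-- The regions of a knot diagram can be colored like a checkerboard. A coloring of the smoothing
at a crossing is also one of the diagram, because the four sides that are joined in other pairs
belong to the same region of the smoothing. -/
theorem exists_sideColor (D : Diagram) (hD : D.IsKnotDiagram) :
    ∃ η : ℕ → ℤˣ, ∀ e ∈ regionEdges D, sideColor η e.1 = sideColor η e.2 := by
  obtain ⟨P, C⟩ := D
  induction hn : Multiset.card C generalizing P C with
  | zero =>
    rw [Multiset.card_eq_zero] at hn
    subst hn
    refine ⟨1, fun e he => ?_⟩
    simp only [regionEdges, Multiset.zero_bind, add_zero, Multiset.mem_bind, sides,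
      Multiset.insert_eq_cons, Multiset.mem_cons, Multiset.mem_singleton] at he
    obtain ⟨p, -, rfl | rfl⟩ := he <;> simp [sideColor]
  | succ n ih =>
    obtain ⟨c, C, rfl⟩ := Multiset.card_pos_iff_exists_mem.1 (by omega : 0 < Multiset.card C) |>.imp
      fun c hc => Multiset.exists_cons_of_mem hc
    obtain ⟨r, hr⟩ := exists_reversesAt hD.proper hD.2.2.1
    obtain ⟨h₁, h₂⟩ := isKnotDiagram_smoothing hr hD
    rw [Multiset.card_cons] at hn
    obtain ⟨η, hη⟩ := ih _ _ h₁ (by rw [Multiset.card_map]; omega)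
    have key : ∀ {x y}, Conn (smoothedEdges P c C) x y →
        sideColor η (flipSide r x) = sideColor η (flipSide r y) := fun hxy =>
      (hxy.map (flipSide r) fun e he => hr.conn_regionEdges_smoothing he).apply_eq _ hη
    refine ⟨fun a => if r a then -η a else η a, fun e he => ?_⟩
    rw [← sideColor_flipSide, ← sideColor_flipSide]
    rw [regionEdges_cons] at he
    rcases Multiset.mem_add.1 he with he | he
    · exact key ((hr.regionCount_le hD.proper).2 h₂ e he)
    · exact key (Conn.of_mem (Multiset.mem_add.2 (Or.inr he)))

/-- A checkerboard coloring in terms of the arcs: the color of the left side changes at each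
crossing, and the two incoming arcs at a crossing have different colors on the left. -/
structure Alternating (η : ℕ → ℤˣ) (D : Diagram) : Prop where
  points : ∀ p ∈ D.points, η p.1 = η p.2
  uout : ∀ c ∈ D.crossings, η c.uout = -η c.uin
  oin : ∀ c ∈ D.crossings, η c.oin = -η c.uin
  oout : ∀ c ∈ D.crossings, η c.oout = η c.uin

theorem exists_alternating {D : Diagram} (hD : D.IsKnotDiagram) : ∃ η, Alternating η D := by
  obtain ⟨η, hη⟩ := exists_sideColor D hD
  have hne : ¬ (-1 : ℤˣ) = 1 := by decide
  have hc : ∀ c ∈ D.crossings, ∀ e ∈ c.corners, sideColor η e.1 = sideColor η e.2 :=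
    fun c hc e he => hη e (Multiset.mem_add.2 (Or.inr (Multiset.mem_bind.2 ⟨c, hc, he⟩)))
  have hall : ∀ c ∈ D.crossings, η c.uout = -η c.uin ∧ η c.oin = -η c.uin ∧ η c.oout = η c.uin := by
    intro c hcD
    have := hc c hcD
    rcases c.sign_eq with h | h <;>
      simp only [Crossing.corners, h, hne, if_true, if_false, Multiset.insert_eq_cons,
        Multiset.mem_cons, Multiset.mem_singleton, forall_eq_or_imp, forall_eq, sideColor,
        Bool.false_eq_true, neg_inj] at this
    · obtain ⟨h₁, h₂, h₃, h₄⟩ := this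
      exact ⟨by rw [h₁, h₂, neg_neg], by rw [← h₄, neg_neg], h₁.symm⟩
    · obtain ⟨h₁, h₂, h₃, h₄⟩ := this
      exact ⟨by rw [← h₂, ← h₁], h₁.symm, h₄⟩
  refine ⟨η, fun p hp => ?_, fun c h => (hall c h).1, fun c h => (hall c h).2.1,
    fun c h => (hall c h).2.2⟩
  exact hη ((p.1, true), (p.2, true)) (Multiset.mem_add.2 (Or.inl (Multiset.mem_bind.2
    ⟨p, hp, by simp [sides]⟩)))

end Regions

end KnotDiag

/-! ### Exponents of the bracket modulo four, and the substitution -/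

namespace KnotDiag

open Diagram

section Splittings

variable {V : Finset ℕ} {P E : Multiset (ℕ × ℕ)} {C : Multiset Crossing} {c : Crossing}

theorem classCount_pair_swap (V : Finset ℕ) (e : ℕ × ℕ) (x y : ℕ) (E : Multiset (ℕ × ℕ)) :
    classCount V ({e, (x, y)} + E) = classCount V ({e, (y, x)} + E) := by
  simp only [Multiset.insert_eq_cons, Multiset.cons_add, Multiset.singleton_add]
  rw [Multiset.cons_swap, classCount_swap, Multiset.cons_swap]

/-- The rest of the diagram joins the four ends at a crossing in pairs, in one of three ways. Of the
three ways of closing up, the one that agrees with it gives one circle more than the two others. -/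
theorem classCount_splits (h : ends E + c.ends = V.val + V.val) :
    (Conn E c.uin c.uout ∧ Conn E c.oin c.oout ∧ ¬ Conn E c.uin c.oin ∧
      classCount V (c.through + E) = classCount V E ∧
      classCount V (c.orientedSplit + E) + 1 = classCount V E ∧
      classCount V (c.disorientedSplit + E) + 1 = classCount V E) ∨
    (Conn E c.uin c.oin ∧ Conn E c.uout c.oout ∧ ¬ Conn E c.uin c.uout ∧
      classCount V (c.disorientedSplit + E) = classCount V E ∧
      classCount V (c.through + E) + 1 = classCount V E ∧
      classCount V (c.orientedSplit + E) + 1 = classCount V E) ∨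
    (Conn E c.uin c.oout ∧ Conn E c.oin c.uout ∧ ¬ Conn E c.uin c.oin ∧
      classCount V (c.orientedSplit + E) = classCount V E ∧
      classCount V (c.through + E) + 1 = classCount V E ∧
      classCount V (c.disorientedSplit + E) + 1 = classCount V E) := by
  have m₁ : c.uin ∈ V := mem_of_ends_add h (by simp [Crossing.ends])
  have m₂ : c.uout ∈ V := mem_of_ends_add h (by simp [Crossing.ends])
  have m₃ : c.oin ∈ V := mem_of_ends_add h (by simp [Crossing.ends])
  have m₄ : c.oout ∈ V := mem_of_ends_add h (by simp [Crossing.ends])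
  simp only [Crossing.through, Crossing.orientedSplit, Crossing.disorientedSplit]
  rcases pairing h with ⟨h₁, h₂, h₃⟩ | ⟨h₁, h₂, h₃⟩ | ⟨h₁, h₂, h₃⟩
  · obtain ⟨k₁, k₂, k₃⟩ := classCount_close m₁ m₃ m₄ h₁ h₂ h₃
    rw [classCount_pair_swap] at k₃
    exact Or.inl ⟨h₁, h₂, h₃, k₁, k₃, k₂⟩
  · obtain ⟨k₁, k₂, k₃⟩ := classCount_close m₁ m₂ m₄ h₁ h₂ h₃
    exact Or.inr (Or.inl ⟨h₁, h₂, h₃, k₁, k₂, k₃⟩)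
  · have h₄ : ¬ Conn E c.uin c.oin := fun h => h₃ (h.trans h₂.symm)
    obtain ⟨k₁, k₂, k₃⟩ := classCount_close m₁ m₃ m₂ h₁ h₂.symm h₄
    rw [classCount_pair_swap] at k₂ k₃
    exact Or.inr (Or.inr ⟨h₁, h₂.symm, h₄, k₁, k₃, k₂⟩)

theorem bind_cons_add (s : Crossing → Multiset (ℕ × ℕ)) (P : Multiset (ℕ × ℕ)) (c : Crossing)
    (C : Multiset Crossing) : P + (c ::ₘ C).bind s = s c + (P + C.bind s) := by
  rw [Multiset.cons_bind]
  abel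

/-- The parity of the number of Seifert circles. -/
theorem classCount_orientedSplit_mod_two (hV : Closed V P C) (h : Balanced inOut P C) :
    ((classCount V (P + C.bind Crossing.orientedSplit) : ℤ) + Multiset.card C) ≡
      classCount V (P + C.bind Crossing.through) [ZMOD 2] := by
  induction C using Multiset.induction_on generalizing P with
  | empty => simp [Int.ModEq]
  | cons c C ih =>
    have h₁ := ih (hV.split c.ends_orientedSplit) (h.split (inOut_orientedSplit c))
    have h₂ := hV.ends_add Crossing.ends_through
    have h₃ := pairing_inOut hV h Crossing.ends_through inOut_through
    rw [bind_cons_add, bind_cons_add, Multiset.card_cons]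
    rw [add_assoc, add_assoc] at h₁
    rcases classCount_splits h₂ with h₄ | ⟨k₁, k₂, k₃, -⟩ | h₄
    · unfold Int.ModEq at *
      push_cast
      omega
    · exfalso
      rcases h₃ with ⟨l, -⟩ | ⟨-, -, l⟩
      · exact k₃ l
      · exact l k₁
    · unfold Int.ModEq at *
      push_cast
      omega

/-- The weight of a crossing in an alternating coloring: with the arcs of color `-1` reversed, both
ends of the under-strand are directed towards the crossing, and both ends of the over-strand away
from it, or vice versa. -/
def sourceSink (η : ℕ → ℤˣ) (c : Crossing) (f : ℕ → ℤ) : ℤ :=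
  (η c.uin : ℤ) * (f c.uin + f c.uout - f c.oin - f c.oout)

theorem sourceSink_orientedSplit (η : ℕ → ℤˣ) (c : Crossing) (f : ℕ → ℤ)
    (h : ∀ e ∈ c.orientedSplit, f e.1 = f e.2) : sourceSink η c f = 0 := by
  simp only [Crossing.orientedSplit, Multiset.insert_eq_cons, Multiset.mem_cons,
    Multiset.mem_singleton, forall_eq_or_imp, forall_eq] at h
  rw [sourceSink, h.1, h.2]
  ring

theorem sourceSink_disorientedSplit (η : ℕ → ℤˣ) (c : Crossing) (f : ℕ → ℤ)
    (h : ∀ e ∈ c.disorientedSplit, f e.1 = f e.2) : sourceSink η c f = 0 := by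
  simp only [Crossing.disorientedSplit, Multiset.insert_eq_cons, Multiset.mem_cons,
    Multiset.mem_singleton, forall_eq_or_imp, forall_eq] at h
  rw [sourceSink, h.1, h.2]
  ring

theorem Alternating.balanced {η : ℕ → ℤˣ} {D : Diagram} (hη : Alternating η D) (h : D.Proper) :
    Balanced (sourceSink η) D.points D.crossings := by
  intro f hf
  have hsum := congrArg (fun s => (s.map fun a => (η a : ℤ) * f a).sum) h.ins_eq
  simp only [ins, outs, Multiset.map_add, Multiset.sum_add, Multiset.map_map,
    Function.comp_def] at hsum
  have hP : (D.points.map fun e => (η e.1 : ℤ) * f e.1).sum =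
      (D.points.map fun e => (η e.2 : ℤ) * f e.2).sum :=
    congrArg Multiset.sum (Multiset.map_congr rfl fun e he => by rw [hf e he, hη.points e he])
  have hC : (D.crossings.map fun c => sourceSink η c f) = D.crossings.map fun c =>
      (η c.uin : ℤ) * f c.uin + (η c.oin : ℤ) * f c.oin - (η c.uout : ℤ) * f c.uout -
        (η c.oout : ℤ) * f c.oout := by
    refine Multiset.map_congr rfl fun c hc => ?_
    rw [hη.uout c hc, hη.oin c hc, hη.oout c hc, sourceSink, Units.val_neg]
    ring
  rw [hC]
  simp only [Multiset.sum_map_add, Multiset.sum_map_sub]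
  linarith

end Splittings

section Grading

/-- The substitution `t = A⁻⁴`. -/
noncomputable def subst : ℤ[T;T⁻¹] →+* ℤ[T;T⁻¹] :=
  AddMonoidAlgebra.mapDomainRingHom ℤ (AddMonoidHom.mulLeft (-4 : ℤ))

theorem subst_apply (V : ℤ[T;T⁻¹]) :
    subst V = AddMonoidAlgebra.mapDomain (fun n : ℤ => -4 * n) V := rfl

theorem subst_T (n : ℤ) : subst (T n) = T (-4 * n) := by
  rw [subst_apply]
  exact AddMonoidAlgebra.mapDomain_single

theorem subst_injective : Function.Injective subst :=
  AddMonoidAlgebra.mapDomain_injective fun m n h => by simpa using h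

/-- All exponents of `p` are congruent to `e` modulo four. -/
def InDegree (e : ℤ) (p : ℤ[T;T⁻¹]) : Prop := ∃ V, p = T e * subst V

theorem InDegree.congr {e e' : ℤ} {p : ℤ[T;T⁻¹]} (h : InDegree e p) (he : e ≡ e' [ZMOD 4]) :
    InDegree e' p := by
  obtain ⟨V, rfl⟩ := h
  obtain ⟨k, hk⟩ := he.dvd
  refine ⟨T k * V, ?_⟩
  rw [map_mul, subst_T, ← mul_assoc, T_mul_T]
  congr 2
  omega

theorem InDegree.add {e : ℤ} {p q : ℤ[T;T⁻¹]} (hp : InDegree e p) (hq : InDegree e q) :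
    InDegree e (p + q) := by
  obtain ⟨V, rfl⟩ := hp
  obtain ⟨W, rfl⟩ := hq
  exact ⟨V + W, by rw [map_add, mul_add]⟩

theorem InDegree.T_mul {e : ℤ} {p : ℤ[T;T⁻¹]} (hp : InDegree e p) (m : ℤ) :
    InDegree (m + e) (T m * p) := by
  obtain ⟨V, rfl⟩ := hp
  exact ⟨V, by rw [← mul_assoc, T_mul_T]⟩

theorem inDegree_loopValue_pow (k : ℕ) : InDegree (2 * k) (loopValue ^ k) := by
  have h : loopValue = T 2 * subst (-1 - T 1) := by
    rw [map_sub, map_neg, map_one, subst_T, mul_sub, T_mul_T, loopValue]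
    norm_num
  refine ⟨(-1 - T 1) ^ k, ?_⟩
  rw [h, mul_pow, LaurentPolynomial.T_pow, map_pow, mul_comm (k : ℤ)]

variable {V : Finset ℕ} {P : Multiset (ℕ × ℕ)} {C : Multiset Crossing}

/-- The exponents in the state sum modulo four. A change of the splitting at one crossing changes
the number of circles by one, because in terms of the source-sink orientation it is the exchange
of the ends of two directed edges. -/
theorem inDegree_stateSum {η : ℕ → ℤˣ} (hne : V.Nonempty) (hV : Closed V P C)
    (h : Balanced (sourceSink η) P C) :
    InDegree ((C.map fun c => (c.sign : ℤ)).sum +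
      2 * (classCount V (P + C.bind Crossing.orientedSplit) - 1)) (stateSum V P C) := by
  induction C using Multiset.induction_on generalizing P with
  | empty =>
    have := classCount_pos hne P
    rw [stateSum_zero]
    refine (inDegree_loopValue_pow _).congr ?_
    rw [Multiset.zero_bind, add_zero, Multiset.map_zero, Multiset.sum_zero, zero_add,
      Nat.cast_sub this, Nat.cast_one]
  | cons c C ih =>
    have h₁ := ih (hV.split c.ends_orientedSplit) (h.split (sourceSink_orientedSplit η c))
    have h₂ := ih (hV.split c.ends_disorientedSplit) (h.split (sourceSink_disorientedSplit η c))
    have h₃ := hV.ends_add Crossing.ends_orientedSplit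
    have key : classCount V (c.orientedSplit + (P + C.bind Crossing.orientedSplit)) =
          classCount V (c.disorientedSplit + (P + C.bind Crossing.orientedSplit)) + 1 ∨
        classCount V (c.orientedSplit + (P + C.bind Crossing.orientedSplit)) + 1 =
          classCount V (c.disorientedSplit + (P + C.bind Crossing.orientedSplit)) := by
      rcases classCount_splits h₃ with ⟨k₁, k₂, k₃, -⟩ | h₄ | h₄
      · exfalso
        classical
        have := h.apply
          (f := fun x => if Conn (P + C.bind Crossing.orientedSplit) c.uin x then 1 else 0)
          (fun d _ => sourceSink_orientedSplit η d) (indicator_conn _ c.uin)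
        have k₄ : ¬ Conn (P + C.bind Crossing.orientedSplit) c.uin c.oout :=
          fun h => k₃ (h.trans k₂.symm)
        simp [sourceSink, k₁, k₃, k₄, Conn.refl] at this
      · omega
      · omega
    rw [stateSum_cons_sign, bind_cons_add]
    rw [add_assoc] at h₁ h₂
    refine ((h₁.T_mul _).congr ?_).add ((h₂.T_mul _).congr ?_)
    · rw [Multiset.map_cons, Multiset.sum_cons, add_assoc]
    · rw [Multiset.map_cons, Multiset.sum_cons]
      unfold Int.ModEq
      rcases c.sign_eq with hs | hs <;> rw [hs] <;> push_cast <;> omega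

theorem Diagram.IsKnotDiagram.arcs_nonempty {D : Diagram} (hD : D.IsKnotDiagram) :
    D.arcs.Nonempty := by
  rw [Finset.nonempty_iff_ne_empty]
  intro h
  have := hD.2.2.1
  rw [componentCount, h, classCount_def] at this
  simp at this

theorem writhe_mod_two (D : Diagram) : D.writhe ≡ Multiset.card D.crossings [ZMOD 2] := by
  rw [writhe]
  induction D.crossings using Multiset.induction_on with
  | empty => simp [Int.ModEq]
  | cons c C ih =>
    rw [Multiset.map_cons, Multiset.sum_cons, Multiset.card_cons]
    unfold Int.ModEq at *
    push_cast
    rcases c.sign_eq with h | h <;> rw [h] <;> push_cast <;> omega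

/-- The Jones polynomial exists. -/
theorem exists_hasJones {D : Diagram} (hD : D.IsKnotDiagram) : ∃ V, D.HasJones V := by
  obtain ⟨η, hη⟩ := exists_alternating hD
  have h₁ := inDegree_stateSum hD.arcs_nonempty hD.proper.closed (hη.balanced hD.proper)
  have h₂ := classCount_orientedSplit_mod_two hD.proper.closed hD.proper.balanced
  have h₃ := writhe_mod_two D
  have h₄ : classCount D.arcs (D.points + D.crossings.bind Crossing.through) = 1 := hD.2.2.1
  rw [h₄] at h₂
  have h₅ : InDegree (3 * D.writhe) D.bracket := by
    rw [bracket_eq_stateSum]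
    refine h₁.congr ?_
    change D.writhe + _ ≡ _ [ZMOD 4]
    unfold Int.ModEq at *
    push_cast at h₂
    omega
  obtain ⟨V, hV⟩ := h₅
  refine ⟨((D.writhe.negOnePow : ℤˣ) : ℤ) • V, ?_⟩
  rw [hasJones_iff, ← subst_apply, map_zsmul, normBracket, hV, ← mul_assoc, T_mul_T,
    neg_mul, neg_add_cancel, LaurentPolynomial.T_zero, one_mul]

end Grading

end KnotDiag

/-! ### The writhe of the smoothing, and the Jones polynomial near one -/

namespace KnotDiag

open Diagram

section Writhe

variable {P : Multiset (ℕ × ℕ)} {C : Multiset Crossing} {c : Crossing} {r : ℕ → Bool}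

theorem Crossing.sign_reorient (r : ℕ → Bool) (c : Crossing) :
    ((c.reorient r).sign : ℤ) = if r c.uin = r c.oin then (c.sign : ℤ) else -c.sign := by
  cases h₁ : r c.uin <;> cases h₂ : r c.oin <;>
    simp [reorient, revUnder, revOver, h₁, h₂]

/-- The writhe of the smoothing. The reversed strand crosses the other strand an even number of
times, which is seen by testing the balance in the source-sink orientation with the indicator
function of the reversed arcs. So the signs of these crossings, which are the ones that change, have
an even sum. -/
theorem ReversesAt.writhe_smoothing (hr : ReversesAt r P c C) (hD : IsKnotDiagram ⟨P, c ::ₘ C⟩) :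
    ∃ l : ℤ, (smoothing r P c C).writhe = writhe ⟨P, c ::ₘ C⟩ - c.sign - 4 * l := by
  obtain ⟨η, hη⟩ := exists_alternating hD
  have hb := hη.balanced hD.proper (fun a => if r a then 1 else 0) fun p hp => by
    rw [hr.points p hp]
  simp only [Multiset.map_cons, Multiset.sum_cons] at hb
  have hc : sourceSink η c (fun a => if r a then 1 else 0) = 0 := by
    simp [sourceSink, hr.uin, hr.uout, hr.oin, hr.oout]
  rw [hc, zero_add] at hb
  have key : ∃ m : ℤ, (C.map fun d => sourceSink η d (fun a => if r a then 1 else 0)).sum =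
      (C.map fun d => (d.sign : ℤ)).sum - (C.map fun d => ((d.reorient r).sign : ℤ)).sum +
        4 * m := by
    clear hb hD hη
    have hC := And.intro hr.under_eq hr.over_eq
    clear hr hc
    induction C using Multiset.induction_on with
    | empty => exact ⟨0, by simp⟩
    | cons d C ih =>
      obtain ⟨m, hm⟩ := ih ⟨fun e he => hC.1 e (Multiset.mem_cons_of_mem he),
        fun e he => hC.2 e (Multiset.mem_cons_of_mem he)⟩
      have hu := hC.1 d (Multiset.mem_cons_self _ _)
      have ho := hC.2 d (Multiset.mem_cons_self _ _)
      have hd : ∃ k : ℤ, sourceSink η d (fun a => if r a then 1 else 0) =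
          d.sign - (d.reorient r).sign + 4 * k := by
        rw [Crossing.sign_reorient, sourceSink, ← hu, ← ho]
        rcases d.sign_eq with hs | hs <;> rcases Int.units_eq_one_or (η d.uin) with hη | hη <;>
          cases h₁ : r d.uin <;> cases h₂ : r d.oin <;> simp only [hs, hη] <;>
          first
            | (refine ⟨0, ?_⟩; decide)
            | (refine ⟨1, ?_⟩; decide)
            | (refine ⟨-1, ?_⟩; decide)
      obtain ⟨k, hk⟩ := hd
      refine ⟨k + m, ?_⟩
      simp only [Multiset.map_cons, Multiset.sum_cons]
      linarith
  obtain ⟨m, hm⟩ := key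
  refine ⟨-m, ?_⟩
  have h₁ : (smoothing r P c C).writhe = (C.map fun d => ((d.reorient r).sign : ℤ)).sum := by
    simp [smoothing, writhe, Multiset.map_map]
  have h₂ : writhe ⟨P, c ::ₘ C⟩ = c.sign + (C.map fun d => (d.sign : ℤ)).sum := by
    simp [writhe]
  rw [h₁, h₂]
  linarith

end Writhe

section FirstOrder

open scoped DualNumber
open TrivSqZeroExt (fst snd)

/-- The expansion of a Laurent polynomial at `1` to first order: `T 1` is sent to `1 + ε`. -/
noncomputable def jet : ℤ[T;T⁻¹] →ₐ[ℤ] ℤ[ε] :=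
  AddMonoidAlgebra.lift ℤ ℤ[ε] ℤ
    { toFun := fun n => 1 + TrivSqZeroExt.inr (Multiplicative.toAdd n)
      map_one' := by simp
      map_mul' := fun m n => by ext <;> simp [add_comm] }

theorem jet_T (n : ℤ) : jet (T n) = 1 + TrivSqZeroExt.inr n := by
  rw [jet, LaurentPolynomial.T, AddMonoidAlgebra.lift_single]
  simp

theorem derivAtOne_add (p q : ℤ[T;T⁻¹]) : derivAtOne (p + q) = derivAtOne p + derivAtOne q := by
  unfold derivAtOne
  exact Finsupp.sum_add_index' (by simp) (by intros; ring)

theorem derivAtOne_C_mul_T (n a : ℤ) :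
    derivAtOne (LaurentPolynomial.C a * T n) = n * a := by
  rw [derivAtOne, ← LaurentPolynomial.single_eq_C_mul_T]
  exact Finsupp.sum_single_index (by simp)

theorem jet_C (a : ℤ) : jet (LaurentPolynomial.C a) = TrivSqZeroExt.inl a := by
  rw [LaurentPolynomial.C_eq_algebraMap, AlgHom.commutes]
  ext <;> simp

theorem snd_jet (p : ℤ[T;T⁻¹]) : snd (jet p) = derivAtOne p := by
  induction p using LaurentPolynomial.induction_on' with
  | add p q hp hq => rw [map_add, TrivSqZeroExt.snd_add, hp, hq, derivAtOne_add]
  | C_mul_T n a =>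
    rw [derivAtOne_C_mul_T, map_mul, jet_C, jet_T]
    simp [mul_comm]

theorem jet_subst (p : ℤ[T;T⁻¹]) :
    fst (jet (subst p)) = fst (jet p) ∧ snd (jet (subst p)) = -4 * snd (jet p) := by
  induction p using LaurentPolynomial.induction_on' with
  | add p q hp hq =>
    simp only [map_add, TrivSqZeroExt.fst_add, TrivSqZeroExt.snd_add, hp.1, hp.2, hq.1, hq.2]
    exact ⟨trivial, by ring⟩
  | C_mul_T n a =>
    have h : subst (LaurentPolynomial.C a) = LaurentPolynomial.C a := by
      simp
    rw [map_mul, map_mul, map_mul, subst_T, h, jet_C, jet_T, jet_T]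
    constructor <;> simp only [TrivSqZeroExt.fst_mul, TrivSqZeroExt.snd_mul, TrivSqZeroExt.fst_add,
      TrivSqZeroExt.snd_add, TrivSqZeroExt.fst_inl, TrivSqZeroExt.snd_inl, TrivSqZeroExt.fst_inr,
      TrivSqZeroExt.snd_inr, TrivSqZeroExt.fst_one, TrivSqZeroExt.snd_one, smul_eq_mul, smul_zero,
      add_zero, zero_add]
    ring

theorem jet_eq_one_of_subst {p : ℤ[T;T⁻¹]} (h : jet (subst p) = 1) : jet p = 1 := by
  obtain ⟨h₁, h₂⟩ := jet_subst p
  rw [h] at h₁ h₂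
  ext
  · exact h₁.symm
  · simp at h₂ ⊢
    omega

theorem jet_loopValue : jet loopValue = -2 := by
  rw [loopValue, map_sub, map_neg, jet_T, jet_T]
  ext <;> simp <;> rfl

variable {V : Finset ℕ} {P : Multiset (ℕ × ℕ)} {C : Multiset Crossing} {c : Crossing}

/-- At `A = 1` the value of a circle is `-2`, up to second order, and the sum over the three ways of
joining four ends in pairs is zero. -/
theorem jet_stateSum_splits (hV : Closed V P (c ::ₘ C)) :
    jet (stateSum V (c.orientedSplit + P) C) + jet (stateSum V (c.disorientedSplit + P) C) +
      jet (stateSum V (c.through + P) C) = 0 := by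
  induction C using Multiset.induction_on generalizing P with
  | empty =>
    have h := hV.ends_add Crossing.ends_through
    rw [Multiset.zero_bind, add_zero] at h
    have hne : V.Nonempty := ⟨_, hV.mem.1⟩
    have p₁ := classCount_pos hne (c.orientedSplit + P)
    have p₂ := classCount_pos hne (c.disorientedSplit + P)
    have p₃ := classCount_pos hne (c.through + P)
    simp only [stateSum_zero, map_pow, jet_loopValue]
    rcases classCount_splits h with ⟨-, -, -, h₁, h₂, h₃⟩ | ⟨-, -, -, h₁, h₂, h₃⟩ |
      ⟨-, -, -, h₁, h₂, h₃⟩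
    · obtain ⟨k, hk⟩ := Nat.exists_eq_add_of_lt p₁
      have e₁ : classCount V (c.orientedSplit + P) - 1 = k := by omega
      have e₂ : classCount V (c.disorientedSplit + P) - 1 = k := by omega
      have e₃ : classCount V (c.through + P) - 1 = k + 1 := by omega
      rw [e₁, e₂, e₃]
      ring
    · obtain ⟨k, hk⟩ := Nat.exists_eq_add_of_lt p₁
      have e₁ : classCount V (c.orientedSplit + P) - 1 = k := by omega
      have e₂ : classCount V (c.disorientedSplit + P) - 1 = k + 1 := by omega
      have e₃ : classCount V (c.through + P) - 1 = k := by omega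
      rw [e₁, e₂, e₃]
      ring
    · obtain ⟨k, hk⟩ := Nat.exists_eq_add_of_lt p₂
      have e₁ : classCount V (c.orientedSplit + P) - 1 = k + 1 := by omega
      have e₂ : classCount V (c.disorientedSplit + P) - 1 = k := by omega
      have e₃ : classCount V (c.through + P) - 1 = k := by omega
      rw [e₁, e₂, e₃]
      ring
  | cons d C ih =>
    rw [Multiset.cons_swap] at hV
    have hA : ends d.splitA = d.ends := by
      unfold Crossing.splitA
      split
      · exact d.ends_orientedSplit
      · exact d.ends_disorientedSplit
    have hB : ends d.splitB = d.ends := by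
      unfold Crossing.splitB
      split
      · exact d.ends_disorientedSplit
      · exact d.ends_orientedSplit
    have h₁ := ih (hV.split hA)
    have h₂ := ih (hV.split hB)
    simp only [← add_assoc, add_comm _ d.splitA, add_comm _ d.splitB] at h₁ h₂
    simp only [stateSum_cons, map_add, map_mul, ← add_assoc]
    linear_combination jet (T 1) * h₁ + jet (T (-1)) * h₂

theorem jet_stateSum_cons (V : Finset ℕ) (P : Multiset (ℕ × ℕ)) (c : Crossing)
    (C : Multiset Crossing) :
    fst (jet (stateSum V P (c ::ₘ C))) = fst (jet (stateSum V (c.orientedSplit + P) C)) +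
        fst (jet (stateSum V (c.disorientedSplit + P) C)) ∧
      snd (jet (stateSum V P (c ::ₘ C))) = snd (jet (stateSum V (c.orientedSplit + P) C)) +
        snd (jet (stateSum V (c.disorientedSplit + P) C)) +
          c.sign * (fst (jet (stateSum V (c.orientedSplit + P) C)) -
            fst (jet (stateSum V (c.disorientedSplit + P) C))) := by
  rw [stateSum_cons_sign, map_add, map_mul, map_mul, jet_T, jet_T]
  constructor
  · simp
  · simp
    ring

theorem fst_jet_stateSum (hV : Closed V P C) :
    fst (jet (stateSum V P C)) = (-1) ^ Multiset.card C *
      (-2) ^ (classCount V (P + C.bind Crossing.through) - 1) := by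
  induction C using Multiset.induction_on generalizing P with
  | empty =>
    rw [stateSum_zero, map_pow, jet_loopValue, TrivSqZeroExt.fst_pow, Multiset.zero_bind, add_zero,
      Multiset.card_zero, pow_zero, one_mul]
    rfl
  | cons c C ih =>
    have h₁ := congrArg fst (jet_stateSum_splits hV)
    have h₂ := ih (hV.split c.ends_through)
    simp only [TrivSqZeroExt.fst_add, TrivSqZeroExt.fst_zero] at h₁
    rw [(jet_stateSum_cons V P c C).1, bind_cons_add, Multiset.card_cons, pow_succ, ← add_assoc]
    linarith

/-- The state sum of a diagram with one component to first order at `A = 1`. -/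
theorem snd_jet_stateSum (hne : V.Nonempty) (hV : Closed V P C) (h : Balanced inOut P C)
    (h₁ : classCount V (P + C.bind Crossing.through) = 1) :
    snd (jet (stateSum V P C)) = (-1) ^ Multiset.card C *
      (3 * (C.map fun c => (c.sign : ℤ)).sum) := by
  induction C using Multiset.induction_on generalizing P with
  | empty =>
    rw [Multiset.zero_bind, add_zero] at h₁
    rw [stateSum_zero, h₁]
    simp
  | cons c C ih =>
    have h₂ := congrArg snd (jet_stateSum_splits hV)
    simp only [TrivSqZeroExt.snd_add, TrivSqZeroExt.snd_zero] at h₂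
    rw [bind_cons_add] at h₁
    have h₃ := ih (hV.split c.ends_through) (h.split (inOut_through c)) (by rw [add_assoc, h₁])
    have h₄ := fst_jet_stateSum (hV.split c.ends_orientedSplit)
    have h₅ := fst_jet_stateSum (hV.split c.ends_disorientedSplit)
    have h₆ := classCount_pos hne (P + C.bind Crossing.through)
    have h₇ : classCount V (c.orientedSplit + (P + C.bind Crossing.through)) = 2 ∧
        classCount V (c.disorientedSplit + (P + C.bind Crossing.through)) = 1 := by
      have k := hV.ends_add Crossing.ends_through
      rcases classCount_splits k with ⟨-, -, k₃, k₄, -⟩ | ⟨k₁, -, k₃, -⟩ | k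
      · exact absurd (conn_of_classCount_le_one (by omega) hV.mem.1 hV.mem.2.2.1) k₃
      · exfalso
        rcases pairing_inOut hV h Crossing.ends_through inOut_through with ⟨l, -⟩ | ⟨-, -, l⟩
        · exact k₃ l
        · exact l k₁
      · omega
    rw [add_assoc, h₇.1] at h₄
    rw [add_assoc, h₇.2] at h₅
    rw [(jet_stateSum_cons V P c C).2, h₄, h₅, Multiset.card_cons, Multiset.map_cons,
      Multiset.sum_cons, pow_succ]
    simp only [Nat.sub_self, pow_zero, mul_one]
    linear_combination h₂ - h₃

/-- The Jones polynomial `V` of a knot satisfies `V(1) = 1` and `V'(1) = 0`. -/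
theorem jet_eq_one {D : Diagram} (hD : D.IsKnotDiagram) {V : ℤ[T;T⁻¹]} (hV : D.HasJones V) :
    jet V = 1 := by
  apply jet_eq_one_of_subst
  rw [hasJones_iff, ← subst_apply] at hV
  rw [hV, normBracket, map_zsmul, map_mul, jet_T, bracket_eq_stateSum]
  have h₀ : classCount D.arcs (D.points + D.crossings.bind Crossing.through) = 1 := hD.2.2.1
  have h₁ := fst_jet_stateSum hD.proper.closed
  have h₂ := snd_jet_stateSum hD.arcs_nonempty hD.proper.closed hD.proper.balanced h₀
  rw [h₀] at h₁
  change _ = _ * (3 * D.writhe) at h₂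
  have h₃ : ((D.writhe.negOnePow : ℤˣ) : ℤ) = (-1) ^ Multiset.card D.crossings := by
    have h := writhe_mod_two D
    have : D.writhe.negOnePow = ((Multiset.card D.crossings : ℤ)).negOnePow :=
      Int.negOnePow_eq_iff _ _ |>.2 (even_iff_two_dvd.2 h.symm.dvd)
    rw [this, Int.coe_negOnePow_natCast]
  have h₄ : ((-1 : ℤ) ^ Multiset.card D.crossings) * (-1) ^ Multiset.card D.crossings = 1 := by
    rw [← mul_pow]
    simp
  rw [h₃]
  ext
  · simp [h₁, h₄]
  · simp only [TrivSqZeroExt.snd_smul, TrivSqZeroExt.snd_mul, TrivSqZeroExt.fst_add,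
      TrivSqZeroExt.snd_add, TrivSqZeroExt.fst_inr, TrivSqZeroExt.snd_inr, TrivSqZeroExt.fst_one,
      TrivSqZeroExt.snd_one, h₁, h₂]
    simp
    ring

end FirstOrder

end KnotDiag

/-! ### The relation between the three diagrams -/

namespace KnotDiag

open Diagram

theorem isDisorientedSmoothing_smoothing {r : ℕ → Bool} {P : Multiset (ℕ × ℕ)} {c : Crossing}
    {C : Multiset Crossing} (hD : IsKnotDiagram ⟨P, c ::ₘ C⟩)
    (hD' : (smoothing r P c C).IsKnotDiagram) :
    KnotDiagram.IsDisorientedSmoothing ⟨⟨P, c ::ₘ C⟩, hD⟩ c ⟨smoothing r P c C, hD'⟩ := by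
  refine ⟨C, rfl, ?_, ?_⟩
  · refine Multiset.Rel.add (Multiset.rel_refl_of_refl_on fun p _ => Or.inl rfl) ?_
    refine Multiset.rel_map_right.2 (Multiset.rel_refl_of_refl_on fun p _ => ?_)
    unfold reorientPoint
    split
    · exact Or.inr rfl
    · exact Or.inl rfl
  · exact Multiset.rel_map_right.2
      (Multiset.rel_refl_of_refl_on fun d _ => d.sameUnoriented_reorient r)

/-- Up to the orientation of the arcs, the smoothing is the state in which `c` is split against
the orientation. -/
theorem ReversesAt.bracket_smoothing {r : ℕ → Bool} {P : Multiset (ℕ × ℕ)} {c : Crossing}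
    {C : Multiset Crossing} (hr : ReversesAt r P c C) (hD : IsKnotDiagram ⟨P, c ::ₘ C⟩) :
    (smoothing r P c C).bracket =
      stateSum (arcs ⟨P, c ::ₘ C⟩) (c.disorientedSplit + P) C := by
  obtain ⟨C', hC, h₁, h₂⟩ :=
    isDisorientedSmoothing_smoothing hD (isKnotDiagram_smoothing hr hD).1
  obtain rfl : C = C' := (Multiset.cons_inj_right c).1 hC
  rw [bracket_eq_stateSum, hr.arcs_smoothing hD.proper]
  exact (stateSum_rel_crossings h₂ _ _).trans (stateSum_rel_points h₁ _ _)

theorem arcs_switch (P : Multiset (ℕ × ℕ)) (c : Crossing) (C : Multiset Crossing) :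
    arcs ⟨P, c.switch ::ₘ C⟩ = arcs ⟨P, c ::ₘ C⟩ := by
  ext a
  simp only [mem_arcs, ins, Crossing.switch, Multiset.map_cons, Multiset.mem_add,
    Multiset.mem_cons]
  tauto

theorem bracket_switch (P : Multiset (ℕ × ℕ)) (c : Crossing) (C : Multiset Crossing) :
    bracket ⟨P, c.switch ::ₘ C⟩ =
      T (-(c.sign : ℤ)) * stateSum (arcs ⟨P, c ::ₘ C⟩) (c.orientedSplit + P) C +
        T (c.sign : ℤ) * stateSum (arcs ⟨P, c ::ₘ C⟩) (c.disorientedSplit + P) C := by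
  rw [bracket_eq_stateSum, arcs_switch, stateSum_cons_sign]
  have h₁ : c.switch.orientedSplit = c.orientedSplit := Multiset.pair_comm _ _
  have h₂ : stateSum (arcs ⟨P, c ::ₘ C⟩) (c.switch.disorientedSplit + P) C =
      stateSum (arcs ⟨P, c ::ₘ C⟩) (c.disorientedSplit + P) C := by
    refine stateSum_rel_points (Multiset.Rel.add ?_
      (Multiset.rel_refl_of_refl_on fun p _ => Or.inl rfl)) _ _
    unfold Crossing.disorientedSplit
    exact .cons (.inr rfl) (.cons (.inr rfl) .zero)
  rw [h₁, h₂]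
  simp [Crossing.switch]

theorem normBracket_circle : circle.normBracket = 1 := by
  have h := isKnotDiagram_circle.2.2.1
  rw [normBracket, bracket_eq_stateSum]
  change ((0 : ℤ).negOnePow : ℤ) • (T (-3 * 0) * stateSum circle.arcs circle.points 0) = 1
  have h' : classCount circle.arcs circle.points = 1 := h
  rw [stateSum_zero, h']
  simp

/-- The three diagrams that differ at a positive crossing satisfy one linear relation, because the
brackets of the first two determine the two state sums at the crossing. -/
theorem jones_eq {P : Multiset (ℕ × ℕ)} {c : Crossing} {C : Multiset Crossing} {r : ℕ → Bool}
    (hr : ReversesAt r P c C) (hD : IsKnotDiagram ⟨P, c ::ₘ C⟩) (hc : c.sign = 1)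
    {V V' : ℤ[T;T⁻¹]} (hV : HasJones ⟨P, c ::ₘ C⟩ V)
    (h₀ : normBracket ⟨P, c.switch ::ₘ C⟩ = 1) (hV' : (smoothing r P c C).HasJones V') :
    ∃ l : ℤ, V = T 1 + (1 - T 1) * (T (3 * l) * V') := by
  obtain ⟨l, hl⟩ := hr.writhe_smoothing hD
  refine ⟨l, subst_injective ?_⟩
  rw [hasJones_iff, ← subst_apply] at hV hV'
  have hw : writhe ⟨P, c.switch ::ₘ C⟩ = writhe ⟨P, c ::ₘ C⟩ - 2 := by
    rw [writhe_cons, writhe_cons, Crossing.switch, hc]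
    push_cast
    ring
  have hb : bracket ⟨P, c ::ₘ C⟩ = _ := stateSum_cons_sign _ P c C
  rw [normBracket, hb, hc] at hV
  rw [normBracket, bracket_switch, hc, hw] at h₀
  rw [normBracket, hr.bracket_smoothing hD, hl, hc] at hV'
  set X := stateSum (arcs ⟨P, c ::ₘ C⟩) (c.orientedSplit + P) C
  set Y := stateSum (arcs ⟨P, c ::ₘ C⟩) (c.disorientedSplit + P) C
  generalize writhe ⟨P, c ::ₘ C⟩ = w at *
  have e₁ : (w - 2).negOnePow = w.negOnePow :=
    (Int.negOnePow_eq_iff _ _).2 ⟨-1, by ring⟩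
  have e₂ : (w - ((1 : ℤˣ) : ℤ) - 4 * l).negOnePow = -w.negOnePow := by
    rw [← Int.negOnePow_succ]
    exact (Int.negOnePow_eq_iff _ _).2 ⟨-1 - 2 * l, by push_cast; ring⟩
  rw [e₁] at h₀
  rw [e₂] at hV'
  simp only [zsmul_eq_mul, Units.val_one, Units.val_neg, Int.cast_neg] at hV h₀ hV'
  set u : ℤ[T;T⁻¹] := ((w.negOnePow : ℤ) : ℤ[T;T⁻¹])
  rw [hV]
  simp only [map_add, map_sub, map_mul, map_one, subst_T, hV']
  have t₁ : (T (-3 * (w - 2)) : ℤ[T;T⁻¹]) = T (-3 * w) * T 6 := by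
    rw [T_mul_T]; congr 1; ring
  have t₂ : (T (-4 * (3 * l)) : ℤ[T;T⁻¹]) * T (-3 * (w - 1 - 4 * l)) = T (-3 * w) * T 3 := by
    rw [T_mul_T, T_mul_T]; congr 1; ring
  have t₃ : (T 1 : ℤ[T;T⁻¹]) * T (-1) = 1 := by rw [T_mul_T]; simp
  have t₄ : (T 6 : ℤ[T;T⁻¹]) = T 1 ^ 6 := by simp
  have t₅ : (T 3 : ℤ[T;T⁻¹]) = T 1 ^ 3 := by simp
  have t₆ : (T (-4 * 1) : ℤ[T;T⁻¹]) = T (-1) ^ 4 := by simp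
  rw [t₁, t₄] at h₀
  rw [t₅] at t₂
  rw [t₆]
  generalize (T 1 : ℤ[T;T⁻¹]) = a at *
  generalize (T (-1) : ℤ[T;T⁻¹]) = b at *
  -- `b ^ 4 * h₀` eliminates `X`; the coefficient of `t₃` collects `1 - (a * b) ^ n`
  linear_combination b ^ 4 * h₀ + (1 - b ^ 4) * u * Y * t₂ -
    u * T (-3 * w) * (a * X * (1 + a * b + (a * b) ^ 2 + (a * b) ^ 3 + (a * b) ^ 4) +
      b * Y * (1 + a * b + (a * b) ^ 2) +
      a ^ 3 * Y * (1 + a * b + (a * b) ^ 2 + (a * b) ^ 3)) * t₃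

end KnotDiag

open KnotDiag in
theorem proposition3p1 (K : KnotDiag.Knot) (hu : K.unknottingNumber = 1)
    (D D₀ : KnotDiag.KnotDiagram) (c : KnotDiag.Crossing) (hD : D.knot = K) (hc : c.sign = 1)
    (hsw : D.IsSwitch c D₀) (hD₀ : D₀.knot = KnotDiag.Knot.unknot) :
    ∃ V W : ℤ[T;T⁻¹], K.IsJones V ∧ (T 1 - 1) * (1 - W) = V - 1 ∧
      ∃ K' : KnotDiag.Knot,
        (∃ D' : KnotDiag.KnotDiagram, D.IsDisorientedSmoothing c D' ∧ D'.knot = K') ∧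
        K'.IsJones (T (-KnotDiag.derivAtOne W) * W) := by
  obtain ⟨⟨P₁, C₁⟩, hk⟩ := D
  obtain ⟨⟨P, C₀⟩, hk₀⟩ := D₀
  obtain ⟨C, h₁, h₂, h₃⟩ := hsw
  dsimp only at h₁ h₂ h₃
  subst h₁ h₂ h₃ hD
  obtain ⟨r, hr⟩ := exists_reversesAt hk.proper hk.2.2.1
  have hk' := (isKnotDiagram_smoothing hr hk).1
  obtain ⟨V, hV⟩ := exists_hasJones hk
  obtain ⟨V', hV'⟩ := exists_hasJones hk'
  have h₀ := normBracket_eq_of_knot_eq hD₀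
  obtain ⟨l, hl⟩ := jones_eq hr hk hc hV (h₀.trans normBracket_circle) hV'
  have hd : derivAtOne (T (3 * l) * V') = 3 * l := by
    rw [← snd_jet, map_mul, jet_eq_one hk' hV', jet_T, mul_one]
    simp only [TrivSqZeroExt.snd_add, TrivSqZeroExt.snd_inr, TrivSqZeroExt.snd_one, zero_add]
  refine ⟨V, T (3 * l) * V', KnotDiagram.isJones_of_hasJones (D := ⟨⟨P, c ::ₘ C⟩, hk⟩) hV, ?_, _,
    ⟨⟨smoothing r P c C, hk'⟩, isDisorientedSmoothing_smoothing hk hk', rfl⟩, ?_⟩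
  · rw [hl]
    ring
  · rw [hd, ← mul_assoc, T_mul_T, neg_add_cancel, LaurentPolynomial.T_zero, one_mul]
    exact KnotDiagram.isJones_of_hasJones (D := ⟨smoothing r P c C, hk'⟩) hV'
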